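/- A Dirichlet series $F(s)=\sum_{n\ge 1} a_n n^{-s}$ belongs to the Selberg class $\mathcal S$ if it converges absolutely for $\operatorname{Re}s>1$ and: (1) for some integer $m\ge 0$, $(s-1)^mF(s)$ continues to an entire function of finite order; (2) $a_n\ll_\delta n^\delta$ for every $\delta>0$; (3) there are $k\ge 0$, $|\epsilon|=1$, $Q>0$, $w_i>0$ and $\operatorname{Re}\mu_i\ge 0$ $(1\le i\le k)$ such that $\Phi(s)=\epsilon Q^s\prod_{i=1}^k\Gamma(w_is+\mu_i)\,F(s)$ satisfies $\Phi(s)=\overline{\Phi(1-\bar s)}$; (4) $a_1=1$ and $\log F(s)=\sum_{n\ge 1} b_n n^{-s}$ for $\operatorname{Re}s>1$, where $b_n=0$ unless $n$ is a positive power of a prime, and $b_n\ll n^\theta$ for some $\theta<1/2$. Call $F\in\mathcal S$ primitive if $F\ne 1$ and $F=F_1F_2$ with $F_1,F_2\in\mathcal S$ implies $F_1=1$ or $F_2=1$. Write $a_p$, $a'_p$ for the coefficients of $F$, $F'$ at primes $p$. Assume Selberg's two conjectures on the distribution of coefficients: (Regularity of distribution) for every $F\in\mathcal S$ there is an integer $n_F$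 such that $\sum_{p\le x}|a_p|^2/p=n_F\log\log x+O(1)$ as $x\to\infty$; (Orthonormality) $n_F=1$ for every primitive $F$, and $\sum_{p\le x}a_p\overline{a'_p}/p=O(1)$ as $x\to\infty$ for all distinct primitive $F,F'$. Then for every $F\in\mathcal S$, the meromorphic continuation of $F$ has no zero on the line $\operatorname{Re}s=1$. -/

import Mathlib

open Complex Filter Asymptotics
open scoped ComplexConjugate

noncomputable section

/-- An entire function `E` of finite order: `|E(s)| ≤ C exp(|s| ^ ρ)` for some real `C` and `ρ`. -/
def IsEntireOfFiniteOrder (E : ℂ → ℂ) : Prop :=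
  Differentiable ℂ E ∧ ∃ C ρ : ℝ, ∀ s : ℂ, ‖E s‖ ≤ C * Real.exp (‖s‖ ^ ρ)

/-- The function `γ(s) = ε Q^s ∏ᵢ Γ(wᵢ s + μᵢ)`; the product may be empty. -/
def gammaFactor {k : ℕ} (ε : ℂ) (Q : ℝ) (w : Fin k → ℝ) (μ : Fin k → ℂ) (s : ℂ) : ℂ :=
  ε * (Q : ℂ) ^ s * ∏ i, Complex.Gamma ((w i : ℂ) * s + μ i)

/-- `s` is not a pole of any of the factors `Γ(wᵢ s + μᵢ)`. -/
def IsGammaRegular {k : ℕ} (w : Fin k → ℝ) (μ : Fin k → ℂ) (s : ℂ) : Prop :=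
  ∀ (i : Fin k) (n : ℕ), (w i : ℂ) * s + μ i ≠ -(n : ℂ)

/-- The Dirichlet series `∑ a n / n ^ s` belongs to the Selberg class, and `F` is its meromorphic
continuation to `ℂ`. Only the values of `F` away from the possible pole `s = 1` are constrained;
the value `F 1` is irrelevant. -/
structure IsSelberg (a : ArithmeticFunction ℂ) (F : ℂ → ℂ) : Prop where
  /-- The series converges absolutely to `F s` in `Re s > 1`. -/
  dirichlet_series : ∀ s : ℂ, 1 < s.re → LSeriesHasSum (fun n ↦ a n) s (F s)
  /-- `(s - 1) ^ m F(s)` is entire of finite order for some `m ≥ 0`. -/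
  analyticity : ∃ (m : ℕ) (E : ℂ → ℂ), IsEntireOfFiniteOrder E ∧
    ∀ s : ℂ, s ≠ 1 → (s - 1) ^ m * F s = E s
  /-- Ramanujan hypothesis: `a n ≪ n ^ δ` for every `δ > 0`. -/
  ramanujan : ∀ δ : ℝ, 0 < δ → (fun n : ℕ ↦ a n) =O[atTop] (fun n : ℕ ↦ (n : ℝ) ^ δ)
  /-- With `Φ(s) = γ(s) F(s)`, one has `Φ(s) = conj (Φ(1 - conj s))`, stated at all points where
  no factor on either side has a pole. -/
  functional_equation : ∃ (k : ℕ) (ε : ℂ) (Q : ℝ) (w : Fin k → ℝ) (μ : Fin k → ℂ),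
    ‖ε‖ = 1 ∧ 0 < Q ∧ (∀ i, 0 < w i) ∧ (∀ i, 0 ≤ (μ i).re) ∧
    ∀ s : ℂ, s ≠ 0 → s ≠ 1 → IsGammaRegular w μ s → IsGammaRegular w μ (1 - conj s) →
      gammaFactor ε Q w μ s * F s =
        conj (gammaFactor ε Q w μ (1 - conj s) * F (1 - conj s))
  /-- Euler product: `a 1 = 1` and `log F(s) = ∑ b n / n ^ s` in `Re s > 1`. -/
  euler_product : a 1 = 1 ∧ ∃ (b : ℕ → ℂ) (θ : ℝ), θ < 1 / 2 ∧
    (∀ n, ¬ IsPrimePow n → b n = 0) ∧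
    b =O[atTop] (fun n : ℕ ↦ (n : ℝ) ^ θ) ∧
    ∀ s : ℂ, 1 < s.re → LSeriesSummable b s ∧ Complex.exp (LSeries b s) = F s

/-- The Selberg class. A Dirichlet series is identified with its coefficient function, so that the
product of Dirichlet series is the product (Dirichlet convolution) of `ArithmeticFunction ℂ` and
the constant series `1` is the arithmetic function `1`. -/
def SelbergClass : Set (ArithmeticFunction ℂ) :=
  {a | ∃ F : ℂ → ℂ, IsSelberg a F}

/-- Primitive elements of the Selberg class: the nontrivial ones (`a ≠ 1`) that have no
factorization into two nontrivial members of the class. -/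
def IsPrimitiveSelberg (a : ArithmeticFunction ℂ) : Prop :=
  a ∈ SelbergClass ∧ a ≠ 1 ∧
    ∀ b ∈ SelbergClass, ∀ c ∈ SelbergClass, a = b * c → b = 1 ∨ c = 1

/-- The prime sum `∑_{p ≤ x} f p`. -/
def primeSum (f : ℕ → ℂ) (x : ℝ) : ℂ :=
  ∑ p ∈ Finset.Iic ⌊x⌋₊ with p.Prime, f p

/-- `n_a = n`, that is, `∑_{p ≤ x} |a p|² / p = n log log x + O(1)`. -/
def HasSelbergIndex (a : ArithmeticFunction ℂ) (n : ℤ) : Prop :=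
  (fun x : ℝ ↦ primeSum (fun p ↦ ((‖a p‖ ^ 2 / p : ℝ) : ℂ)) x
      - (((n : ℝ) * Real.log (Real.log x) : ℝ) : ℂ)) =O[atTop] (fun _ ↦ (1 : ℝ))

/-- Selberg's conjecture on regularity of distribution: `n_a` exists, for each member `a` of the
class, and is an integer. -/
def SelbergRegularityConjecture : Prop :=
  ∀ a ∈ SelbergClass, ∃ n : ℤ, HasSelbergIndex a n

/-- Selberg's orthonormality conjecture: `n_a = 1` for primitive `a`, and
`∑_{p ≤ x} a p * conj (a' p) / p = O(1)` for distinct primitive `a` and `a'`. -/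
def SelbergOrthonormalityConjecture : Prop :=
  (∀ a, IsPrimitiveSelberg a → HasSelbergIndex a 1) ∧
  ∀ a a', IsPrimitiveSelberg a → IsPrimitiveSelberg a' → a ≠ a' →
    (fun x : ℝ ↦ primeSum (fun p ↦ a p * conj (a' p) / p) x) =O[atTop] (fun _ ↦ (1 : ℝ))

/-- The meromorphic function `F` has a zero at `s` (a removable singularity at `s` being removed):
its order of vanishing at `s` is positive. -/
def HasZeroAt (F : ℂ → ℂ) (s : ℂ) : Prop :=
  0 < meromorphicOrderAt F s

end

/-! Everything reduces to primitive factors, and for these to the single point s = 1. If F is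
primitive and different from ζ, orthonormality of F and ζ says that ∑ a_p / p is bounded. By partial
summation log |F(σ)| then stays bounded as σ → 1+, so F has neither a zero nor a pole at 1
(`IsSelberg.meromorphicOrderAt_one_eq_zero`). Hence F extends to an entire function, and F(s + it)
is again in the class (`IsSelberg.imTwist`). Its coefficients a_n n^(-it) have the same moduli, so
its index is still 1 and it is again primitive (`IsPrimitiveSelberg.imTwist`). A primitive function
has no zero at 1, and applied to the shift this says F(1 + it) ≠ 0. For ζ itself the classical
non-vanishing on the line is used.

Two facts support this argument. The first is that factorizations into primitives exist
(`exists_list_primitive`). The number of nontrivial factors is bounded because ∑ w_i ≥ 1/76 for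
every element other than 1, so that each factor contributes a fixed power of t to the growth on Re s
= -1. Were ∑ w_i positive but smaller, a convexity bound and a contour shift to Re s = -9 would give
a_n ≪ n^(-3). The series would then converge absolutely on Re s = -1 and be bounded there, against
the growth forced by the functional equation. With no gamma factors at all, F is a Dirichlet
polynomial whose functional equation gives |a_N| = N^(1/2) for the top coefficient, while the Euler
product gives |a_N| ≤ N^θ with θ < 1/2; so N = 1.

The second is that ζ is primitive. Convolution is additive at primes, so a product of primitives
with multiplicities m_g has index ∑ m_g², and a nontrivial element of index at most 1 must be
primitive (`isPrimitiveSelberg_of_hasSelbergIndex`). Rankin's trick shows that ζ has index at most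
1. -/

/-! ### Bounds for Γ(z + c) / Γ(z) on vertical lines -/

lemma norm_complexGammaSeq {z : ℂ} {n : ℕ} (hn : 0 < n) :
    ‖Complex.GammaSeq z n‖ =
      (n : ℝ) ^ z.re * n.factorial / ∏ j ∈ Finset.range (n + 1), ‖z + j‖ := by
  have : (0 : ℝ) < n := by exact_mod_cast hn
  rw [Complex.GammaSeq, norm_div, norm_mul, norm_prod, ← Complex.ofReal_natCast n,
    Complex.norm_cpow_eq_rpow_re_of_pos this]
  simp

/-- In Euler's limit Γ(z) = lim n^z n! / ∏ (z + j), the condition `hsum` makes the powers of n on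
both sides agree, so a comparison of the individual factors passes to the limit. -/
lemma norm_Gamma_mul_le_of_forall {z w : ℂ} {X Y : ℝ} (hX : 0 < X) (_hY : 0 < Y)
    (hw : ∀ j : ℕ, w + j ≠ 0) (hsum : z.re + Y = w.re + X)
    (h : ∀ j : ℕ, ‖w + j‖ * (X + j) ≤ ‖z + j‖ * (Y + j)) :
    ‖Complex.Gamma z‖ * Real.Gamma Y ≤ ‖Complex.Gamma w‖ * Real.Gamma X := by
  refine le_of_tendsto_of_tendsto
    ((Complex.GammaSeq_tendsto_Gamma z).norm.mul (Real.GammaSeq_tendsto_Gamma Y))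
    ((Complex.GammaSeq_tendsto_Gamma w).norm.mul (Real.GammaSeq_tendsto_Gamma X)) ?_
  filter_upwards [eventually_gt_atTop 0] with n hn
  have hn' : (0 : ℝ) < n := by exact_mod_cast hn
  have key : ∀ (u : ℂ) (V : ℝ), ‖u.GammaSeq n‖ * V.GammaSeq n =
      ((n : ℝ) ^ (u.re + V) * (n.factorial) ^ 2) /
        ∏ j ∈ Finset.range (n + 1), (‖u + j‖ * (V + j)) := by
    intro u V
    rw [norm_complexGammaSeq hn, Real.GammaSeq, Finset.prod_mul_distrib, Real.rpow_add hn',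
      div_mul_div_comm]
    ring
  rw [key, key, hsum]
  refine div_le_div_of_nonneg_left (by positivity) ?_ ?_
  · exact Finset.prod_pos fun j _ ↦ mul_pos (norm_pos_iff.2 (hw j)) (by positivity)
  · exact Finset.prod_le_prod (fun j _ ↦ by positivity) fun j _ ↦ h j

/-- Adding c to z + j multiplies its modulus by at most the ratio that occurs on the real axis, (x +
c + j) / (x + j) with x = Re z. Hence |Γ(z + c) / Γ(z)| ≥ Γ(x + c) / Γ(x). -/
lemma norm_Gamma_add_ge {z : ℂ} {c : ℝ} (hz : 0 < z.re) (hc : 0 ≤ c) :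
    ‖Complex.Gamma z‖ * Real.Gamma (z.re + c) ≤
      ‖Complex.Gamma (z + c)‖ * Real.Gamma z.re := by
  refine norm_Gamma_mul_le_of_forall hz (by linarith) (fun j h ↦ ?_) (by simp; ring) fun j ↦ ?_
  · have := congrArg Complex.re h
    simp at this
    have : (0 : ℝ) ≤ j := j.cast_nonneg
    linarith
  · have hj : (0 : ℝ) ≤ j := j.cast_nonneg
    refine abs_le_of_sq_le_sq' ?_ (by positivity) |>.2
    rw [mul_pow, mul_pow, Complex.sq_norm, Complex.sq_norm, normSq_apply, normSq_apply]
    simp only [add_re, add_im, ofReal_re, ofReal_im, natCast_re, natCast_im, add_zero]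
    have : 0 ≤ z.im ^ 2 * ((z.re + c + j) ^ 2 - (z.re + j) ^ 2) :=
      mul_nonneg (sq_nonneg _) (by nlinarith)
    nlinarith

/-- The real comparison point is x + y². To first order in c, the factorwise inequality reads u /
(u² + y²) ≥ 1 / (u + y²) with u = x + j, which holds as soon as u ≥ 1. The price of this crude
choice is an exponent 2c instead of c in the growth in |y|. -/
lemma norm_Gamma_add_le {z : ℂ} {c : ℝ} (hz : 1 ≤ z.re) (hc : 0 ≤ c) :
    ‖Complex.Gamma (z + c)‖ * Real.Gamma (z.re + z.im ^ 2) ≤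
      ‖Complex.Gamma z‖ * Real.Gamma (z.re + z.im ^ 2 + c) := by
  have hX : 0 < z.re + z.im ^ 2 := by positivity
  refine norm_Gamma_mul_le_of_forall (by positivity) (by positivity)
    (fun j h ↦ ?_) (by simp; ring) fun j ↦ ?_
  · have := congrArg Complex.re h
    simp at this
    have : (0 : ℝ) ≤ j := j.cast_nonneg
    linarith
  · have hj : (0 : ℝ) ≤ j := j.cast_nonneg
    refine abs_le_of_sq_le_sq' ?_ (by positivity) |>.2
    rw [mul_pow, mul_pow, Complex.sq_norm, Complex.sq_norm, normSq_apply, normSq_apply]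
    simp only [add_re, add_im, ofReal_re, ofReal_im, natCast_re, natCast_im, add_zero]
    set u := z.re + j with hu
    set y := z.im
    have hu1 : 1 ≤ u := by linarith
    set X := z.re + y ^ 2 + j with hXdef
    have hXu : X = u + y ^ 2 := by rw [hXdef, hu]; ring
    have e1 : z.re + c + ↑j = u + c := by rw [hu]; ring
    have e2 : z.re + y ^ 2 + c + ↑j = X + c := by rw [hXdef]; ring
    rw [e1, e2, hXu]
    have h1 : 0 ≤ c * (u + y ^ 2) * ((u - 1) * y ^ 2) := by
      have : 0 ≤ u - 1 := by linarith
      positivity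
    have h2 : u * u + y * y ≤ (u + y ^ 2) ^ 2 := by nlinarith [mul_nonneg (sub_nonneg.2 hu1) (sq_nonneg y), sq_nonneg (y^2)]
    have h3 := mul_le_mul_of_nonneg_left h2 (sq_nonneg c)
    nlinarith

/-- By convexity of log Γ, the slope over [X, X + c] is at least the slope over [X - 1, X], which is
log (X - 1). The next upper bound uses [X + c, X + c + 1] in the same way. -/
lemma Gamma_add_ge {X c : ℝ} (hX : 1 < X) (hc : 0 ≤ c) :
    (X - 1) ^ c * Real.Gamma X ≤ Real.Gamma (X + c) := by
  rcases hc.eq_or_lt with rfl | hc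
  · simp
  have h := Real.convexOn_log_Gamma.slope_mono_adjacent (x := X - 1) (y := X) (z := X + c)
    (by simpa using hX) (by simp; linarith) (by linarith) (by linarith)
  have hG : Real.Gamma X = (X - 1) * Real.Gamma (X - 1) := by
    have := Real.Gamma_add_one (s := X - 1) (by linarith)
    simpa using this
  have h0 : 0 < Real.Gamma (X - 1) := Real.Gamma_pos_of_pos (by linarith)
  have h1 : 0 < Real.Gamma X := Real.Gamma_pos_of_pos (by linarith)
  have h2 : 0 < Real.Gamma (X + c) := Real.Gamma_pos_of_pos (by linarith)
  have e : Real.log (Real.Gamma X) - Real.log (Real.Gamma (X - 1)) = Real.log (X - 1) := by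
    rw [hG, Real.log_mul (by linarith) h0.ne']; ring
  simp only [Function.comp, e, sub_sub_cancel, div_one, add_sub_cancel_left] at h
  rw [le_div_iff₀ hc] at h
  rw [← Real.log_le_log_iff (mul_pos (Real.rpow_pos_of_pos (by linarith) _) h1) h2,
    Real.log_mul (Real.rpow_pos_of_pos (by linarith) _).ne' h1.ne', Real.log_rpow (by linarith)]
  linarith

lemma Gamma_add_le {X c : ℝ} (hX : 0 < X) (hc : 0 ≤ c) :
    Real.Gamma (X + c) ≤ (X + c) ^ c * Real.Gamma X := by
  rcases hc.eq_or_lt with rfl | hc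
  · simp
  have h := Real.convexOn_log_Gamma.slope_mono_adjacent (x := X) (y := X + c) (z := X + c + 1)
    (by simpa using hX) (by simp; linarith) (by linarith) (by linarith)
  have h1 : 0 < Real.Gamma X := Real.Gamma_pos_of_pos (by linarith)
  have h2 : 0 < Real.Gamma (X + c) := Real.Gamma_pos_of_pos (by linarith)
  have e : Real.log (Real.Gamma (X + c + 1)) - Real.log (Real.Gamma (X + c)) =
      Real.log (X + c) := by
    rw [Real.Gamma_add_one (by linarith), Real.log_mul (by linarith) h2.ne']; ring
  simp only [Function.comp, e, add_sub_cancel_left, div_one] at h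
  rw [div_le_iff₀ hc] at h
  rw [← Real.log_le_log_iff h2 (mul_pos (Real.rpow_pos_of_pos (by linarith) _) h1),
    Real.log_mul (Real.rpow_pos_of_pos (by linarith) _).ne' h1.ne', Real.log_rpow (by linarith)]
  linarith

lemma Gamma_add_natCast_eq_prod (z : ℂ) (M : ℕ) (hz : ∀ j : ℕ, z + j ≠ 0) :
    Complex.Gamma (z + M) = (∏ j ∈ Finset.range M, (z + j)) * Complex.Gamma z := by
  induction M with
  | zero => simp
  | succ M ih =>
    rw [Finset.prod_range_succ, Nat.cast_succ, ← add_assoc, Complex.Gamma_add_one _ (hz M), ih]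
    ring

lemma add_natCast_ne_zero_of_im {z : ℂ} (hz : z.im ≠ 0) (j : ℕ) : z + j ≠ 0 := fun h ↦
  hz (by simpa using congrArg Complex.im h)

lemma norm_add_ofReal_div_le {z : ℂ} {c : ℝ} (hz : z.im ≠ 0) (hc : 0 ≤ c) :
    ‖z + c‖ ≤ (1 + c / |z.im|) * ‖z‖ := by
  have h0 : 0 < |z.im| := abs_pos.2 hz
  calc ‖z + c‖ ≤ ‖z‖ + ‖(c : ℂ)‖ := norm_add_le _ _
    _ = ‖z‖ + c / |z.im| * |z.im| := by rw [div_mul_cancel₀ _ h0.ne']; simp [abs_of_nonneg hc]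
    _ ≤ ‖z‖ + c / |z.im| * ‖z‖ := by gcongr; exact abs_im_le_norm z
    _ = _ := by ring

lemma norm_prod_add_le {z : ℂ} {c : ℝ} (hz : z.im ≠ 0) (hc : 0 ≤ c) (M : ℕ) :
    ‖∏ j ∈ Finset.range M, (z + c + j)‖ ≤
      (1 + c / |z.im|) ^ M * ‖∏ j ∈ Finset.range M, (z + j)‖ := by
  rw [norm_prod, norm_prod]
  calc _ ≤ ∏ j ∈ Finset.range M, (1 + c / |z.im|) * ‖z + j‖ := by
        refine Finset.prod_le_prod (fun _ _ ↦ norm_nonneg _) fun j _ ↦ ?_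
        have := norm_add_ofReal_div_le (z := z + j) (c := c) (by simpa using hz) hc
        rw [add_right_comm]
        simpa using this
    _ = _ := by rw [Finset.prod_mul_distrib]; simp

/-- Lower bound for `Γ(z + c) / Γ(z)` on a vertical line. -/
lemma exists_norm_Gamma_add_ge (x c : ℝ) (hc : 0 ≤ c) :
    ∃ K > 0, ∀ z : ℂ, z.re = x → 1 ≤ |z.im| →
      K * |z.im| ^ c * ‖Complex.Gamma z‖ ≤ ‖Complex.Gamma (z + c)‖ := by
  obtain ⟨M, hM⟩ := exists_nat_ge (2 - x)
  refine ⟨Real.exp (-(c * (M + 2))), Real.exp_pos _, fun z hzx hy ↦ ?_⟩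
  have hz : z.im ≠ 0 := fun h ↦ by simp [h] at hy; linarith
  have hy0 : 0 < |z.im| := by linarith
  -- The shift by N brings the real part above |y|, where `Gamma_add_ge` yields |y|^c. As N is
  -- O(|y|), undoing the shift loses only (1 + c/|y|)^N = O(1).
  set N := M + ⌈|z.im|⌉₊ with hN
  have hNge : |z.im| ≤ ⌈|z.im|⌉₊ := Nat.le_ceil _
  have hNle : (⌈|z.im|⌉₊ : ℝ) < |z.im| + 1 := Nat.ceil_lt_add_one hy0.le
  have hzN : (z + N).re = x + N := by simp [hzx]
  have hNc : (N : ℝ) = M + ⌈|z.im|⌉₊ := by simp [hN]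
  have hX : 2 + |z.im| ≤ x + N := by rw [hNc]; linarith
  have h1 := norm_Gamma_add_ge (z := z + N) (c := c) (by rw [hzN]; linarith) hc
  rw [hzN] at h1
  have h2 := Gamma_add_ge (X := x + N) (c := c) (by linarith) hc
  have hG : 0 < Real.Gamma (x + N) := Real.Gamma_pos_of_pos (by linarith)
  have h3 : |z.im| ^ c ≤ (x + N - 1) ^ c := Real.rpow_le_rpow hy0.le (by linarith) hc
  have h4 : |z.im| ^ c * ‖Complex.Gamma (z + N)‖ ≤ ‖Complex.Gamma (z + N + c)‖ := by
    refine le_of_mul_le_mul_right ?_ hG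
    calc _ = ‖Complex.Gamma (z + N)‖ * (|z.im| ^ c * Real.Gamma (x + N)) := by ring
      _ ≤ ‖Complex.Gamma (z + N)‖ * Real.Gamma (x + N + c) := by
        gcongr; exact (mul_le_mul_of_nonneg_right h3 hG.le).trans h2
      _ ≤ _ := h1
  rw [add_right_comm, Gamma_add_natCast_eq_prod z N (add_natCast_ne_zero_of_im hz),
    Gamma_add_natCast_eq_prod (z + c) N (add_natCast_ne_zero_of_im (by simpa using hz)),
    norm_mul, norm_mul] at h4
  have h5 := norm_prod_add_le hz hc N
  have h6 : (1 + c / |z.im|) ^ N ≤ Real.exp (c * (M + 2)) := by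
    calc (1 + c / |z.im|) ^ N ≤ (Real.exp (c / |z.im|)) ^ N := by
          gcongr; linarith [Real.add_one_le_exp (c / |z.im|)]
      _ = Real.exp (N * (c / |z.im|)) := by rw [← Real.exp_nat_mul]
      _ ≤ _ := by
        refine Real.exp_le_exp.2 ?_
        rw [mul_div_assoc', div_le_iff₀ hy0]
        have : (N : ℝ) ≤ (M + 2) * |z.im| := by
          rw [hNc]; nlinarith [(Nat.cast_nonneg M : (0 : ℝ) ≤ M)]
        nlinarith
  have hP : 0 < ‖∏ j ∈ Finset.range N, (z + j)‖ :=
    norm_pos_iff.2 (Finset.prod_ne_zero_iff.2 fun j _ ↦ add_natCast_ne_zero_of_im hz j)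
  set P := ‖∏ j ∈ Finset.range N, (z + j)‖
  have h7 : |z.im| ^ c * ‖Complex.Gamma z‖ ≤
      Real.exp (c * (M + 2)) * ‖Complex.Gamma (z + c)‖ := by
    refine le_of_mul_le_mul_right ?_ hP
    calc _ = |z.im| ^ c * (P * ‖Complex.Gamma z‖) := by ring
      _ ≤ _ := h4
      _ ≤ Real.exp (c * (M + 2)) * P * ‖Complex.Gamma (z + c)‖ := by
        gcongr; exact h5.trans (mul_le_mul_of_nonneg_right h6 hP.le)
      _ = _ := by ring
  rw [Real.exp_neg, mul_assoc, inv_mul_le_iff₀ (Real.exp_pos _)]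
  exact h7

/-- Upper bound for `Γ(z + c) / Γ(z)` on a vertical line. -/
lemma exists_norm_Gamma_add_le (x c : ℝ) (hc : 0 ≤ c) :
    ∃ K > 0, ∀ z : ℂ, z.re = x → 1 ≤ |z.im| →
      ‖Complex.Gamma (z + c)‖ ≤ K * |z.im| ^ (2 * c) * ‖Complex.Gamma z‖ := by
  -- A shift independent of y is enough here: `norm_Gamma_add_le` only needs real part at least 1,
  -- and the factor |y|^(2c) comes from its comparison point.
  obtain ⟨M, hM⟩ := exists_nat_ge (1 - x)
  have hxM : 1 ≤ x + M := by linarith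
  refine ⟨(1 + c) ^ M * (x + M + 1 + c) ^ c, by positivity, fun z hzx hy ↦ ?_⟩
  have hz : z.im ≠ 0 := fun h ↦ by simp [h] at hy; linarith
  have hy0 : 0 < |z.im| := by linarith
  have hy2 : 1 ≤ z.im ^ 2 := by rw [← sq_abs]; nlinarith
  have hzM : (z + M).re = x + M := by simp [hzx]
  have hzM' : (z + M).im = z.im := by simp
  have h1 := norm_Gamma_add_le (z := z + M) (c := c) (by rw [hzM]; linarith) hc
  rw [hzM, hzM'] at h1
  have h2 := Gamma_add_le (X := x + M + z.im ^ 2) (c := c) (by positivity) hc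
  have hG : 0 < Real.Gamma (x + M + z.im ^ 2) := Real.Gamma_pos_of_pos (by positivity)
  have h3 : (x + M + z.im ^ 2 + c) ^ c ≤ (x + M + 1 + c) ^ c * |z.im| ^ (2 * c) := by
    rw [Real.rpow_mul hy0.le, ← Real.mul_rpow (by positivity) (by positivity)]
    refine Real.rpow_le_rpow (by positivity) ?_ hc
    rw [Real.rpow_two, sq_abs]
    nlinarith
  set B := (x + M + 1 + c) ^ c * |z.im| ^ (2 * c) with hB
  have hB0 : 0 ≤ B := by positivity
  have h4 : ‖Complex.Gamma (z + M + c)‖ ≤ B * ‖Complex.Gamma (z + M)‖ := by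
    refine le_of_mul_le_mul_right ?_ hG
    calc _ ≤ _ := h1
      _ ≤ ‖Complex.Gamma (z + M)‖ * (B * Real.Gamma (x + M + z.im ^ 2)) := by
        gcongr; exact h2.trans (mul_le_mul_of_nonneg_right h3 hG.le)
      _ = _ := by ring
  have hzc : (z + c).im ≠ 0 := by simpa using hz
  rw [add_right_comm, Gamma_add_natCast_eq_prod z M (add_natCast_ne_zero_of_im hz),
    Gamma_add_natCast_eq_prod (z + c) M (add_natCast_ne_zero_of_im hzc),
    norm_mul, norm_mul] at h4
  have hP : 0 < ‖∏ j ∈ Finset.range M, (z + c + j)‖ :=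
    norm_pos_iff.2 (Finset.prod_ne_zero_iff.2 fun j _ ↦ add_natCast_ne_zero_of_im hzc j)
  have h5 : ‖∏ j ∈ Finset.range M, (z + j)‖ ≤
      (1 + c) ^ M * ‖∏ j ∈ Finset.range M, (z + c + j)‖ := by
    rw [norm_prod, norm_prod, ← Finset.card_range M, ← Finset.prod_const,
      Finset.card_range, ← Finset.prod_mul_distrib]
    refine Finset.prod_le_prod (fun _ _ ↦ norm_nonneg _) fun j _ ↦ ?_
    calc ‖z + j‖ = ‖(z + c + j) - c‖ := by congr 1; ring
      _ ≤ ‖z + c + j‖ + ‖(c : ℂ)‖ := norm_sub_le _ _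
      _ = ‖z + c + j‖ + c * 1 := by simp [abs_of_nonneg hc]
      _ ≤ ‖z + c + j‖ + c * ‖z + c + j‖ := by
        gcongr
        refine hy.trans ?_
        have := abs_im_le_norm (z + c + j)
        simpa using this
      _ = _ := by ring
  refine le_of_mul_le_mul_left ?_ hP
  calc _ ≤ _ := h4
    _ ≤ B * (((1 + c) ^ M * ‖∏ j ∈ Finset.range M, (z + c + j)‖) * ‖Complex.Gamma z‖) := by
      gcongr
    _ = _ := by rw [hB]; ring

/-! ### The functional equation and growth to the left of the critical strip -/

/-- The functional equation of the Selberg class with the given gamma factor. -/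
def HasFunctionalEquation {k : ℕ} (ε : ℂ) (Q : ℝ) (w : Fin k → ℝ) (μ : Fin k → ℂ)
    (F : ℂ → ℂ) : Prop :=
  ‖ε‖ = 1 ∧ 0 < Q ∧ (∀ i, 0 < w i) ∧ (∀ i, 0 ≤ (μ i).re) ∧
    ∀ s : ℂ, s ≠ 0 → s ≠ 1 → IsGammaRegular w μ s → IsGammaRegular w μ (1 - conj s) →
      gammaFactor ε Q w μ s * F s =
        conj (gammaFactor ε Q w μ (1 - conj s) * F (1 - conj s))

lemma isPreconnected_compl_singleton_one : IsPreconnected ({1}ᶜ : Set ℂ) :=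
  (isConnected_compl_singleton_of_one_lt_rank (by simp) _).isPreconnected

/-- Two functions holomorphic off `1` that agree on `Re s > 1` agree off `1`. -/
lemma eq_of_eq_on_one_lt_re {F G : ℂ → ℂ} (hF : ∀ s ≠ 1, DifferentiableAt ℂ F s)
    (hG : ∀ s ≠ 1, DifferentiableAt ℂ G s) (h : ∀ s : ℂ, 1 < s.re → F s = G s)
    {s : ℂ} (hs : s ≠ 1) : F s = G s := by
  have ho : IsOpen ({1}ᶜ : Set ℂ) := isOpen_compl_singleton
  have hF' : AnalyticOnNhd ℂ F {1}ᶜ :=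
    DifferentiableOn.analyticOnNhd (fun z hz ↦ (hF z hz).differentiableWithinAt) ho
  have hG' : AnalyticOnNhd ℂ G {1}ᶜ :=
    DifferentiableOn.analyticOnNhd (fun z hz ↦ (hG z hz).differentiableWithinAt) ho
  refine hF'.eqOn_of_preconnected_of_eventuallyEq hG' isPreconnected_compl_singleton_one
    (z₀ := 2) (by simp) ?_ hs
  filter_upwards [(isOpen_lt continuous_const continuous_re).mem_nhds
    (show (1 : ℝ) < (2 : ℂ).re by simp)] with z hz using h z hz

namespace IsSelberg

variable {a : ArithmeticFunction ℂ} {F : ℂ → ℂ}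

lemma differentiableAt (hF : IsSelberg a F) {s : ℂ} (hs : s ≠ 1) : DifferentiableAt ℂ F s := by
  obtain ⟨m, E, ⟨hE, -⟩, h⟩ := hF.analyticity
  have h1 : DifferentiableAt ℂ (fun z ↦ E z / (z - 1) ^ m) s :=
    (hE s).div (by fun_prop) (pow_ne_zero _ (sub_ne_zero.2 hs))
  refine h1.congr_of_eventuallyEq ?_
  filter_upwards [isOpen_compl_singleton.mem_nhds hs] with z hz
  rw [← h z hz, mul_div_cancel_left₀ _ (pow_ne_zero _ (sub_ne_zero.2 hz))]

lemma meromorphicAt (hF : IsSelberg a F) (s : ℂ) : MeromorphicAt F s := by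
  obtain ⟨m, E, ⟨hE, -⟩, h⟩ := hF.analyticity
  have h1 : MeromorphicAt (fun z ↦ E z / (z - 1) ^ m) s :=
    (hE.analyticAt s).meromorphicAt.div (by fun_prop)
  refine h1.congr ?_
  have : ∀ᶠ z in nhdsWithin s {s}ᶜ, z ≠ 1 := by
    rcases eq_or_ne s 1 with rfl | hs
    · exact self_mem_nhdsWithin
    · exact nhdsWithin_le_nhds (isOpen_compl_singleton.mem_nhds hs)
  filter_upwards [this] with z hz
  rw [← h z hz, mul_div_cancel_left₀ _ (pow_ne_zero _ (sub_ne_zero.2 hz))]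

lemma summable (hF : IsSelberg a F) {s : ℂ} (hs : 1 < s.re) :
    LSeriesSummable (fun n ↦ a n) s := (hF.dirichlet_series s hs).LSeriesSummable

lemma eq_LSeries (hF : IsSelberg a F) {s : ℂ} (hs : 1 < s.re) :
    F s = LSeries (fun n ↦ a n) s := (hF.dirichlet_series s hs).LSeries_eq.symm

end IsSelberg

/-- A Dirichlet series is bounded in a closed half-plane of absolute convergence. -/
lemma LSeries.norm_le_tsum_of_re_le {f : ℕ → ℂ} {s₀ s : ℂ} (h : LSeriesSummable f s₀)
    (hs : s₀.re ≤ s.re) : ‖LSeries f s‖ ≤ ∑' n, ‖LSeries.term f s₀ n‖ := by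
  have h1 : ∀ n, ‖LSeries.term f s n‖ ≤ ‖LSeries.term f s₀ n‖ := fun n ↦
    LSeries.norm_term_le_of_re_le_re f hs n
  have h2 : Summable fun n ↦ ‖LSeries.term f s n‖ := h.norm.of_nonneg_of_le (fun _ ↦ norm_nonneg _) h1
  exact (norm_tsum_le_tsum_norm h2).trans (h2.tsum_le_tsum h1 h.norm)

namespace IsSelberg

variable {a : ArithmeticFunction ℂ} {F : ℂ → ℂ}

lemma exists_norm_le (hF : IsSelberg a F) {σ : ℝ} (hσ : 1 < σ) :
    ∃ C > 0, ∀ s : ℂ, σ ≤ s.re → ‖F s‖ ≤ C := by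
  refine ⟨1 + ∑' n, ‖LSeries.term (fun n ↦ a n) σ n‖, by positivity, fun s hs ↦ ?_⟩
  rw [hF.eq_LSeries (hσ.trans_le hs)]
  have := LSeries.norm_le_tsum_of_re_le (s := s) (hF.summable (s := σ) (by simpa)) (by simpa)
  linarith

/-- |F| is the exponential of the real part of an absolutely convergent Dirichlet series, so it is
bounded away from 0. -/
lemma exists_le_norm (hF : IsSelberg a F) {σ : ℝ} (hσ : 1 < σ) :
    ∃ c > 0, ∀ s : ℂ, σ ≤ s.re → c ≤ ‖F s‖ := by
  obtain ⟨-, b, θ, -, -, -, hb⟩ := hF.euler_product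
  refine ⟨Real.exp (-∑' n, ‖LSeries.term b σ n‖), Real.exp_pos _, fun s hs ↦ ?_⟩
  rw [← (hb s (hσ.trans_le hs)).2, Complex.norm_exp]
  refine Real.exp_le_exp.2 ?_
  have := LSeries.norm_le_tsum_of_re_le (s := s) (hb σ (by simpa)).1 (by simpa)
  linarith [neg_le_of_abs_le (abs_re_le_norm (LSeries b s))]

end IsSelberg

lemma isGammaRegular_of_im {k : ℕ} {w : Fin k → ℝ} {μ : Fin k → ℂ} {s : ℂ}
    (h : ∀ i, w i * s.im + (μ i).im ≠ 0) : IsGammaRegular w μ s := fun i n hn ↦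
  h i (by simpa using congrArg Complex.im hn)

lemma norm_gammaFactor {k : ℕ} {ε : ℂ} {Q : ℝ} {w : Fin k → ℝ} {μ : Fin k → ℂ} (hε : ‖ε‖ = 1)
    (hQ : 0 < Q) (s : ℂ) :
    ‖gammaFactor ε Q w μ s‖ = Q ^ s.re * ∏ i, ‖Complex.Gamma (w i * s + μ i)‖ := by
  rw [gammaFactor, norm_mul, norm_mul, hε, norm_prod,
    Complex.norm_cpow_eq_rpow_re_of_pos hQ, one_mul]

namespace HasFunctionalEquation

variable {k : ℕ} {ε : ℂ} {Q : ℝ} {w : Fin k → ℝ} {μ : Fin k → ℂ} {F : ℂ → ℂ}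

/-- The functional equation in absolute value, across a pair of vertical lines. -/
lemma norm_eq (h : HasFunctionalEquation ε Q w μ F) (A : ℝ) {t : ℝ} (ht : t ≠ 0)
    (hreg : ∀ i, w i * t + (μ i).im ≠ 0) :
    ‖F (-A + t * I)‖ * ∏ i, ‖Complex.Gamma (w i * (-A + t * I) + μ i)‖ =
      Q ^ (1 + 2 * A) * (∏ i, ‖Complex.Gamma (w i * (-A + t * I) + μ i +
        ((w i * (1 + 2 * A) : ℝ) : ℂ))‖) * ‖F (1 + A + t * I)‖ := by
  obtain ⟨hε, hQ, hw, hμ, h⟩ := h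
  set s : ℂ := -A + t * I with hs
  have hre : s.re = -A := by simp [hs]
  have him : s.im = t := by simp [hs]
  have hconj : 1 - conj s = 1 + A + t * I := by
    apply Complex.ext <;> simp [hs]
  have e := congrArg norm (h s (fun h0 ↦ ht (by simpa [h0] using him.symm))
    (fun h0 ↦ ht (by simpa [h0] using him.symm))
    (isGammaRegular_of_im (by simpa [him] using hreg))
    (isGammaRegular_of_im (by simpa [him] using hreg)))
  rw [RCLike.norm_conj, norm_mul, norm_mul, norm_gammaFactor hε hQ, norm_gammaFactor hε hQ,
    hconj, hre] at e
  -- Reflection s ↦ 1 - conj s keeps the imaginary part, so the gamma arguments on the two lines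
  -- differ by a real number and the quotient bounds apply.
  have e2 : ∀ i, (w i : ℂ) * (1 + A + t * I) + μ i =
      w i * s + μ i + ((w i * (1 + 2 * A) : ℝ) : ℂ) := by
    intro i; push_cast; rw [hs]; ring
  have e3 : (1 + A + t * I : ℂ).re = 1 + A := by simp
  simp only [e2, e3] at e
  have hQA : (0 : ℝ) < Q ^ (-A) := Real.rpow_pos_of_pos hQ _
  refine mul_left_cancel₀ hQA.ne' ?_
  have e4 : Q ^ (1 + A) = Q ^ (-A) * Q ^ (1 + 2 * A) := by
    rw [← Real.rpow_add hQ]; congr 1; ring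
  rw [e4] at e
  linarith

/-- The imaginary parts of the gamma arguments are comparable to `|t|`. -/
lemma exists_abs_im (h : HasFunctionalEquation ε Q w μ F) :
    ∃ T ≥ 1, ∀ t : ℝ, T ≤ |t| → ∀ i, 1 ≤ |w i * t + (μ i).im| ∧
      w i / 2 * |t| ≤ |w i * t + (μ i).im| ∧ |w i * t + (μ i).im| ≤ 2 * w i * |t| := by
  -- This threshold forces w_i |t| ≥ 2 (|Im μ_i| + 1) for every i.
  refine ⟨1 + ∑ i, 2 * (|(μ i).im| + 1) / w i, ?_, fun t ht i ↦ ?_⟩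
  · have : 0 ≤ ∑ i, 2 * (|(μ i).im| + 1) / w i := Finset.sum_nonneg fun i _ ↦ by
      have := h.2.2.1 i; positivity
    linarith
  have hw := h.2.2.1 i
  have h1 : 2 * (|(μ i).im| + 1) / w i ≤ |t| := by
    refine le_trans ?_ ht
    have := Finset.single_le_sum (f := fun i ↦ 2 * (|(μ i).im| + 1) / w i) (fun i _ ↦ by
      have := h.2.2.1 i; positivity) (Finset.mem_univ i)
    linarith
  rw [div_le_iff₀ hw] at h1
  have h2 : |w i * t| = w i * |t| := by rw [abs_mul, abs_of_pos hw]
  have h3 : |w i * t + (μ i).im| ≤ |w i * t| + |(μ i).im| := abs_add_le _ _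
  have h4 : |w i * t| - |(μ i).im| ≤ |w i * t + (μ i).im| := by
    have := abs_sub_abs_le_abs_sub (w i * t) (-(μ i).im)
    rwa [abs_neg, sub_neg_eq_add] at this
  have h5 := abs_nonneg (μ i).im
  refine ⟨by nlinarith, by nlinarith, by nlinarith⟩

/-- Growth from below to the left of the critical strip. -/
lemma exists_le_norm (h : HasFunctionalEquation ε Q w μ F) {A c : ℝ} (hA : 0 < A) (hc : 0 < c)
    (hF : ∀ s : ℂ, 1 + A ≤ s.re → c ≤ ‖F s‖) :
    ∃ K > 0, ∀ᶠ t : ℝ in atTop, K * t ^ ((1 + 2 * A) * ∑ i, w i) ≤ ‖F (-A + t * I)‖ := by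
  have hQ := h.2.1
  have hw := h.2.2.1
  have hd : ∀ i, 0 ≤ w i * (1 + 2 * A) := fun i ↦ mul_nonneg (hw i).le (by linarith)
  choose K hK hG using fun i ↦ exists_norm_Gamma_add_ge (-(w i * A) + (μ i).re) _ (hd i)
  refine ⟨Q ^ (1 + 2 * A) * (∏ i, K i * (w i / 2) ^ (w i * (1 + 2 * A))) * c, ?_, ?_⟩
  · have : 0 < ∏ i, K i * (w i / 2) ^ (w i * (1 + 2 * A)) := Finset.prod_pos fun i _ ↦
      mul_pos (hK i) (Real.rpow_pos_of_pos (half_pos (hw i)) _)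
    have := Real.rpow_pos_of_pos hQ (1 + 2 * A)
    positivity
  obtain ⟨T, hT, hi⟩ := h.exists_abs_im
  filter_upwards [eventually_ge_atTop T] with t ht
  have ht0 : 0 < t := by linarith
  replace hi := hi t (ht.trans (le_abs_self t))
  simp only [abs_of_pos ht0] at hi
  have hne : ∀ i, w i * t + (μ i).im ≠ 0 := fun i h0 ↦ by
    have := (hi i).1; rw [h0] at this; norm_num at this
  have e := h.norm_eq A ht0.ne' hne
  have him : ∀ i, (w i * (-A + t * I) + μ i : ℂ).im = w i * t + (μ i).im := fun i ↦ by simp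
  have hre : ∀ i, (w i * (-A + t * I) + μ i : ℂ).re = -(w i * A) + (μ i).re := fun i ↦ by simp
  have hP : 0 < ∏ i, ‖Complex.Gamma (w i * (-A + t * I) + μ i)‖ := Finset.prod_pos fun i _ ↦ by
    refine norm_pos_iff.2 (Complex.Gamma_ne_zero fun m hm ↦ ?_)
    exact hne i (by rw [← him, hm]; simp)
  refine le_of_mul_le_mul_right ?_ hP
  rw [e, mul_comm _ (∑ i, w i), Finset.sum_mul, Real.rpow_sum_of_pos ht0]
  calc _ = Q ^ (1 + 2 * A) * (∏ i, K i * (w i / 2 * t) ^ (w i * (1 + 2 * A)) *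
          ‖Complex.Gamma (w i * (-A + t * I) + μ i)‖) * c := by
        simp only [Finset.prod_mul_distrib, fun i ↦ Real.mul_rpow (half_pos (hw i)).le ht0.le
          (z := w i * (1 + 2 * A))]
        ring
    _ ≤ _ := by
        refine mul_le_mul ?_ (hF _ (by simp)) hc.le (by positivity)
        refine mul_le_mul_of_nonneg_left (Finset.prod_le_prod (fun i _ ↦ ?_) fun i _ ↦ ?_)
          (Real.rpow_pos_of_pos hQ _).le
        · have := hK i; have := hw i; positivity
        · have h1 := hG i _ (hre i) (by rw [him]; exact (hi i).1)
          rw [him] at h1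
          refine le_trans ?_ h1
          have := hK i; have := hw i
          gcongr
          exact (hi i).2.1

/-- Growth from above to the left of the critical strip. -/
lemma exists_norm_le (h : HasFunctionalEquation ε Q w μ F) {A C : ℝ} (hA : 0 < A) (hC : 0 < C)
    (hF : ∀ s : ℂ, 1 + A ≤ s.re → ‖F s‖ ≤ C) :
    ∃ K > 0, ∃ T ≥ 1, ∀ t : ℝ, T ≤ |t| →
      ‖F (-A + t * I)‖ ≤ K * |t| ^ (2 * (1 + 2 * A) * ∑ i, w i) := by
  have hQ := h.2.1
  have hw := h.2.2.1
  have hd : ∀ i, 0 ≤ w i * (1 + 2 * A) := fun i ↦ mul_nonneg (hw i).le (by linarith)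
  choose K hK hG using fun i ↦ exists_norm_Gamma_add_le (-(w i * A) + (μ i).re) _ (hd i)
  obtain ⟨T, hT, hi⟩ := h.exists_abs_im
  refine ⟨Q ^ (1 + 2 * A) * (∏ i, K i * (2 * w i) ^ (2 * (w i * (1 + 2 * A)))) * C, ?_, T, hT, fun t ht ↦ ?_⟩
  · have : 0 < ∏ i, K i * (2 * w i) ^ (2 * (w i * (1 + 2 * A))) := Finset.prod_pos fun i _ ↦
      mul_pos (hK i) (Real.rpow_pos_of_pos (mul_pos two_pos (hw i)) _)
    have := Real.rpow_pos_of_pos hQ (1 + 2 * A)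
    positivity
  have ht0 : 0 < |t| := by linarith
  replace hi := hi t ht
  have hne : ∀ i, w i * t + (μ i).im ≠ 0 := fun i h0 ↦ by
    have := (hi i).1; rw [h0] at this; norm_num at this
  have e := h.norm_eq A (abs_pos.1 ht0) hne
  have him : ∀ i, (w i * (-A + t * I) + μ i : ℂ).im = w i * t + (μ i).im := fun i ↦ by simp
  have hre : ∀ i, (w i * (-A + t * I) + μ i : ℂ).re = -(w i * A) + (μ i).re := fun i ↦ by simp
  have hP : 0 < ∏ i, ‖Complex.Gamma (w i * (-A + t * I) + μ i)‖ := Finset.prod_pos fun i _ ↦ by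
    refine norm_pos_iff.2 (Complex.Gamma_ne_zero fun m hm ↦ ?_)
    exact hne i (by rw [← him, hm]; simp)
  refine le_of_mul_le_mul_right ?_ hP
  have e5 : 2 * (1 + 2 * A) * ∑ i, w i = ∑ i, 2 * (w i * (1 + 2 * A)) := by
    rw [← Finset.mul_sum, ← Finset.sum_mul]; ring
  rw [e, e5, Real.rpow_sum_of_pos ht0]
  calc _ ≤ Q ^ (1 + 2 * A) * (∏ i, K i * (2 * w i * |t|) ^ (2 * (w i * (1 + 2 * A))) *
          ‖Complex.Gamma (w i * (-A + t * I) + μ i)‖) * C := by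
        refine mul_le_mul ?_ (hF _ (by simp)) (norm_nonneg _) ?_
        · refine mul_le_mul_of_nonneg_left (Finset.prod_le_prod (fun i _ ↦ norm_nonneg _)
            fun i _ ↦ ?_) (Real.rpow_pos_of_pos hQ _).le
          have h1 := hG i _ (hre i) (by rw [him]; exact (hi i).1)
          rw [him] at h1
          refine h1.trans ?_
          have := hK i; have := hw i
          gcongr
          exact (hi i).2.2
        · have : ∀ i, 0 ≤ K i * (2 * w i * |t|) ^ (2 * (w i * (1 + 2 * A))) := fun i ↦ by
            have := hK i; have := hw i; positivity
          exact mul_nonneg (Real.rpow_pos_of_pos hQ _).le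
            (Finset.prod_nonneg fun i _ ↦ mul_nonneg (this i) (norm_nonneg _))
    _ = _ := by
        simp only [Finset.prod_mul_distrib, fun i ↦ Real.mul_rpow (mul_pos two_pos (hw i)).le
          ht0.le (z := 2 * (w i * (1 + 2 * A)))]
        ring

end HasFunctionalEquation

/-! ### Convexity bound in the strip by Phragmén–Lindelöf -/

lemma IsEntireOfFiniteOrder.exists_norm_le_exp_pow {E : ℂ → ℂ} (hE : IsEntireOfFiniteOrder E) :
    ∃ C > 0, ∃ n : ℕ, ∀ s : ℂ, 1 ≤ ‖s‖ → ‖E s‖ ≤ C * Real.exp (‖s‖ ^ n) := by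
  obtain ⟨-, C, ρ, h⟩ := hE
  obtain ⟨n, hn⟩ := exists_nat_ge ρ
  refine ⟨|C| + 1, by positivity, n, fun s hs ↦ (h s).trans ?_⟩
  have : ‖s‖ ^ ρ ≤ ‖s‖ ^ n := by
    rw [← Real.rpow_natCast]; exact Real.rpow_le_rpow_of_exponent_le hs hn
  refine mul_le_mul ?_ (Real.exp_le_exp.2 this) (Real.exp_pos _).le (by positivity)
  linarith [le_abs_self C]

lemma exists_norm_le_of_forall_le_abs {f : ℝ → ℂ} (hf : Continuous f) {T K : ℝ}
    (h : ∀ t, T ≤ |t| → ‖f t‖ ≤ K) : ∃ C, ∀ t, ‖f t‖ ≤ C := by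
  obtain ⟨C, hC⟩ := (isCompact_Icc (a := -T) (b := T)).exists_bound_of_continuousOn
    hf.continuousOn
  refine ⟨max C K, fun t ↦ ?_⟩
  rcases le_total T |t| with ht | ht
  · exact (h t ht).trans (le_max_right _ _)
  · exact (hC t (abs_le.1 ht)).trans (le_max_left _ _)

namespace IsSelberg

variable {a : ArithmeticFunction ℂ} {F : ℂ → ℂ}

/-- Convexity bound: a bound `O(|t| ^ (1 / 2))` on a vertical line to the left of the critical
strip extends to the strip. -/
lemma exists_norm_le_strip (hF : IsSelberg a F) {A K T : ℝ} (hA : 0 < A)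
    (h : ∀ t : ℝ, T ≤ |t| → ‖F (-A + t * I)‖ ≤ K * |t| ^ (1 / 2 : ℝ)) :
    ∃ C > 0, ∀ s : ℂ, -A ≤ s.re → s.re ≤ 3 → 1 ≤ |s.im| →
      ‖F s‖ ≤ C * |s.im| ^ (1 / 2 : ℝ) := by
  obtain ⟨m, E, hE, hEF⟩ := hF.analyticity
  obtain ⟨C₀, hC₀, n, hn⟩ := hE.exists_norm_le_exp_pow
  -- Squaring turns the bound |t|^(1/2) for F into |t|, which integer powers can absorb: 2m for the
  -- factor (s - 1)^m and one more for F². The denominator does not vanish for Re s ≥ -A.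
  set g : ℂ → ℂ := fun s ↦ E s ^ 2 / (s + A + 1) ^ (2 * m + 1) with hg
  have hre1 : ∀ s : ℂ, -A ≤ s.re → 1 ≤ ‖s + A + 1‖ := fun s hs ↦ by
    refine le_trans ?_ (re_le_norm _)
    simp; linarith
  have hne : ∀ s : ℂ, -A ≤ s.re → s + A + 1 ≠ 0 := fun s hs h0 ↦ by
    have := hre1 s hs; rw [h0] at this; norm_num at this
  have hdiff : ∀ s : ℂ, -A ≤ s.re → DifferentiableAt ℂ g s := fun s hs ↦
    ((hE.1 s).pow 2).div (by fun_prop) (pow_ne_zero _ (hne s hs))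
  have hnorm : ∀ s : ℂ, ‖g s‖ = ‖E s‖ ^ 2 / ‖s + A + 1‖ ^ (2 * m + 1) := fun s ↦ by
    simp [hg]
  have hs1 : ∀ s : ℂ, -A ≤ s.re → ‖s - 1‖ ≤ (A + 3) * ‖s + A + 1‖ := fun s hs ↦ by
    have e : s - 1 = (s + A + 1) - ((A + 2 : ℝ) : ℂ) := by push_cast; ring
    have h2 := norm_sub_le (s + A + 1) ((A + 2 : ℝ) : ℂ)
    rw [Complex.norm_real, Real.norm_of_nonneg (by linarith), ← e] at h2
    nlinarith [hre1 s hs]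
  have hedge : ∀ (s : ℂ) (K : ℝ), -A ≤ s.re → s ≠ 1 → ‖F s‖ ^ 2 ≤ K ^ 2 * ‖s + A + 1‖ →
      ‖g s‖ ≤ (A + 3) ^ (2 * m) * K ^ 2 := fun s K hs h1 hK ↦ by
    have h0 := hre1 s hs
    rw [hnorm, ← hEF s h1, norm_mul, norm_pow, div_le_iff₀ (by positivity)]
    calc (‖s - 1‖ ^ m * ‖F s‖) ^ 2 = ‖s - 1‖ ^ (2 * m) * ‖F s‖ ^ 2 := by ring
      _ ≤ ((A + 3) * ‖s + A + 1‖) ^ (2 * m) * (K ^ 2 * ‖s + A + 1‖) := by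
          gcongr; exact hs1 s hs
      _ = _ := by rw [mul_pow]; ring
  have him : ∀ s : ℂ, |s.im| ≤ ‖s + A + 1‖ := fun s ↦ by
    have := abs_im_le_norm (s + A + 1); simpa using this
  have hcont : ∀ x : ℝ, -A ≤ x → Continuous fun t : ℝ ↦ g (x + t * I) := fun x hx ↦ by
    rw [continuous_iff_continuousAt]
    intro t
    exact ContinuousAt.comp (f := fun t : ℝ ↦ (x + t * I : ℂ)) (g := g)
      (hdiff _ (by simpa using hx)).continuousAt (by fun_prop)
  obtain ⟨C₁, hC₁⟩ : ∃ C, ∀ t : ℝ, ‖g ((-A : ℝ) + t * I)‖ ≤ C := by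
    refine exists_norm_le_of_forall_le_abs (hcont _ le_rfl) (T := max T 1)
      (K := (A + 3) ^ (2 * m) * K ^ 2) fun t ht ↦ ?_
    have ht1 : 1 ≤ |t| := (le_max_right _ _).trans ht
    refine hedge _ _ (by simp) (fun h0 ↦ ?_) ?_
    · have : t = 0 := by simpa using congrArg Complex.im h0
      simp [this] at ht1; linarith
    · have h1 := h t ((le_max_left _ _).trans ht)
      push_cast
      have h3 := him (-A + t * I)
      simp only [add_im, neg_im, ofReal_im, mul_im, ofReal_re, I_im, mul_one, I_re, mul_zero,
        add_zero, neg_zero, zero_add] at h3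
      calc ‖F (-A + t * I)‖ ^ 2 ≤ (K * |t| ^ (1 / 2 : ℝ)) ^ 2 := by gcongr
        _ = K ^ 2 * |t| := by
          rw [mul_pow, ← Real.rpow_natCast (|t| ^ _), ← Real.rpow_mul (abs_nonneg _)]; norm_num
        _ ≤ _ := by gcongr
  obtain ⟨C₂, hC₂⟩ : ∃ C, ∀ t : ℝ, ‖g ((3 : ℝ) + t * I)‖ ≤ C := by
    obtain ⟨C, hC0, hC⟩ := hF.exists_norm_le (σ := 3) (by norm_num)
    refine ⟨(A + 3) ^ (2 * m) * C ^ 2, fun t ↦ hedge _ _ (by simp; linarith) (fun h0 ↦ ?_) ?_⟩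
    · have : (3 : ℝ) = 1 := by simpa using congrArg Complex.re h0
      norm_num at this
    · have h1 := hC ((3 : ℝ) + t * I) (by simp)
      have h2 := hre1 ((3 : ℝ) + t * I) (by simp; linarith)
      calc _ ≤ C ^ 2 := by gcongr
        _ ≤ _ := le_mul_of_one_le_right (by positivity) h2
  have hPL : ∀ s : ℂ, -A ≤ s.re → s.re ≤ 3 → ‖g s‖ ≤ max C₁ C₂ := fun s hs hs' ↦ by
    refine PhragmenLindelof.vertical_strip (a := -A) (b := 3) ?_ ?_ ?_ ?_ hs hs'
    · refine DifferentiableOn.diffContOnCl fun z hz ↦ (hdiff z ?_).differentiableWithinAt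
      have : closure (re ⁻¹' Set.Ioo (-A) 3) ⊆ re ⁻¹' Set.Ici (-A) :=
        closure_minimal (fun z hz ↦ hz.1.le) (isClosed_Ici.preimage continuous_re)
      exact this hz
    · have hA3 : 0 < 3 + A := by linarith
      -- Phragmén–Lindelöf in a strip of width 3 + A allows growth exp (B exp (c |y|)) with c < π /
      -- (3 + A). Finite order gives exp (|z|^n), and |z|^n is dominated by a multiple of exp (c
      -- |y|).
      set c := 1 / (3 + A) with hc
      have hc0 : 0 < c := by positivity
      refine ⟨c, ?_, 2 * ((c⁻¹) ^ n * n.factorial * Real.exp (c * (A + 3))), ?_⟩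
      · rw [sub_neg_eq_add, hc]
        gcongr
        linarith [Real.pi_gt_three]
      · refine IsBigO.of_bound (C₀ ^ 2) ?_
        have h1 : ∀ᶠ z : ℂ in comap (abs ∘ im) atTop, 1 ≤ |z.im| :=
          tendsto_comap.eventually (eventually_ge_atTop 1)
        filter_upwards [mem_inf_of_left h1, mem_inf_of_right (mem_principal_self _)] with z hz hz'
        have hz1 : 1 ≤ ‖z‖ := hz.trans (abs_im_le_norm z)
        have hzn : ‖z‖ ≤ (A + 3) + |z.im| := by
          refine (norm_le_abs_re_add_abs_im z).trans ?_
          gcongr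
          rw [abs_le]
          constructor <;> linarith [hz'.1, hz'.2]
        have h3 : ‖z‖ ^ n ≤ (c⁻¹) ^ n * n.factorial * Real.exp (c * (A + 3)) *
            Real.exp (c * |z.im|) := by
          have := Real.pow_div_factorial_le_exp (c * ‖z‖) (by positivity) n
          rw [div_le_iff₀ (by positivity)] at this
          calc ‖z‖ ^ n = (c⁻¹) ^ n * (c * ‖z‖) ^ n := by
                rw [← mul_pow, inv_mul_cancel_left₀ hc0.ne']
            _ ≤ (c⁻¹) ^ n * (Real.exp (c * ((A + 3) + |z.im|)) * n.factorial) := by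
                gcongr
                refine this.trans ?_
                gcongr
            _ = _ := by rw [mul_add, Real.exp_add]; ring
        rw [hnorm, Real.norm_of_nonneg (Real.exp_pos _).le]
        calc ‖E z‖ ^ 2 / ‖z + A + 1‖ ^ (2 * m + 1) ≤ ‖E z‖ ^ 2 :=
              div_le_self (by positivity) (one_le_pow₀ (hre1 z hz'.1.le))
          _ ≤ (C₀ * Real.exp (‖z‖ ^ n)) ^ 2 := by gcongr; exact hn z hz1
          _ = C₀ ^ 2 * Real.exp (2 * ‖z‖ ^ n) := by
              rw [mul_pow, ← Real.exp_nat_mul]; norm_num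
          _ ≤ _ := by
              gcongr C₀ ^ 2 * Real.exp ?_
              linarith
    · intro z hz
      have : z = ((-A : ℝ) : ℂ) + z.im * I := by
        rw [← hz]; exact (re_add_im z).symm
      rw [this]; exact (hC₁ _).trans (le_max_left _ _)
    · intro z hz
      have : z = ((3 : ℝ) : ℂ) + z.im * I := by
        rw [← hz]; exact (re_add_im z).symm
      rw [this]; exact (hC₂ _).trans (le_max_right _ _)
  have hM0 : 0 ≤ max C₁ C₂ := (norm_nonneg _).trans (hPL (3 : ℝ) (by simp; linarith) (by simp))
  refine ⟨(max C₁ C₂ * (A + 5) ^ (2 * m + 1)) ^ (1 / 2 : ℝ) + 1, by positivity,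
    fun s hs hs' hs'' ↦ ?_⟩
  have h1 := hPL s hs hs'
  have hs0 : s ≠ 1 := fun h0 ↦ by simp [h0] at hs''; linarith
  have him0 : 0 < |s.im| := by linarith
  have h0 : 0 < ‖s + A + 1‖ := zero_lt_one.trans_le (hre1 s hs)
  rw [hnorm, div_le_iff₀ (by positivity), ← hEF s hs0, norm_mul, norm_pow] at h1
  have h2 : ‖s + A + 1‖ ≤ (A + 5) * |s.im| := by
    refine (norm_le_abs_re_add_abs_im _).trans ?_
    simp only [add_re, ofReal_re, one_re, add_im, ofReal_im, add_zero, one_im]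
    rw [abs_of_nonneg (by linarith)]
    nlinarith
  have h3 : |s.im| ≤ ‖s - 1‖ := by
    have := abs_im_le_norm (s - 1); simpa using this
  have h4 : ‖F s‖ ^ 2 ≤ max C₁ C₂ * (A + 5) ^ (2 * m + 1) * |s.im| := by
    refine le_of_mul_le_mul_left ?_ (pow_pos him0 (2 * m))
    calc |s.im| ^ (2 * m) * ‖F s‖ ^ 2 ≤ ‖s - 1‖ ^ (2 * m) * ‖F s‖ ^ 2 := by gcongr
      _ = (‖s - 1‖ ^ m * ‖F s‖) ^ 2 := by ring
      _ ≤ _ := h1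
      _ ≤ max C₁ C₂ * ((A + 5) * |s.im|) ^ (2 * m + 1) := by gcongr
      _ = _ := by rw [mul_pow]; ring
  have h5 : ‖F s‖ ≤ (max C₁ C₂ * (A + 5) ^ (2 * m + 1) * |s.im|) ^ (1 / 2 : ℝ) := by
    rw [← Real.sqrt_eq_rpow]; exact Real.le_sqrt_of_sq_le h4
  rw [Real.mul_rpow (by positivity) (by positivity)] at h5
  refine h5.trans ?_
  gcongr
  linarith

end IsSelberg

/-! ### Coefficients by a contour shift; no small positive ∑ w_i -/

/-- Separation of the frequencies log n; it bounds the oscillating integrals in the mean value of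
F(s) n^s. -/
lemma inv_mul_le_abs_log_sub_log {m n : ℕ} (hm : m ≠ 0) (hn : n ≠ 0) (h : m ≠ n) :
    ((n : ℝ) * m)⁻¹ ≤ |Real.log n - Real.log m| := by
  wlog hlt : m < n generalizing m n
  · rw [mul_comm, abs_sub_comm]
    exact this hn hm h.symm (lt_of_le_of_ne (not_lt.1 hlt) h.symm)
  have hm0 : (0 : ℝ) < m := by positivity
  have hn0 : (0 : ℝ) < n := by positivity
  have hm1 : (1 : ℝ) ≤ m := by exact_mod_cast Nat.one_le_iff_ne_zero.2 hm
  have h1 := Real.one_sub_inv_le_log_of_pos (x := n / m) (by positivity)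
  rw [Real.log_div hn0.ne' hm0.ne', inv_div] at h1
  refine le_trans ?_ (le_trans h1 (le_abs_self _))
  have h2 : (m : ℝ) + 1 ≤ n := by exact_mod_cast hlt
  rw [one_sub_div hn0.ne', ← one_div, div_le_div_iff₀ (by positivity) hn0]
  nlinarith [mul_pos hn0 hm0]

namespace IsSelberg

variable {a : ArithmeticFunction ℂ} {F : ℂ → ℂ}

/-- The mean value of `F(s) n ^ s` on the line `Re s = 3` detects the coefficient `a n`. -/
lemma exists_norm_integral_sub_le (hF : IsSelberg a F) : ∃ C > 0, ∀ n : ℕ, n ≠ 0 → ∀ T : ℝ,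
    ‖(∫ y in T..2 * T, F (3 + y * I) * (n : ℂ) ^ (3 + y * I : ℂ)) - a n * T‖ ≤ C * n ^ 4 := by
  -- The m-th off-diagonal term integrates to at most 2 / |log n - log m| ≤ 2nm times its size. The
  -- factor m turns the absolute series at 3 into the one at 2, and the factor n turns n³ into n⁴.
  have hs2 : LSeriesSummable (fun n ↦ a n) 2 := hF.summable (by simp)
  have hs3 : LSeriesSummable (fun n ↦ a n) 3 := hF.summable (by simp)
  refine ⟨2 * (∑' m, ‖LSeries.term (fun n ↦ a n) 2 m‖) + 1, by positivity, fun n hn T ↦ ?_⟩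
  have hn0 : (0 : ℝ) < n := by positivity
  set c : ℕ → ℂ := fun m ↦ (n : ℂ) ^ (3 : ℂ) * LSeries.term (fun n ↦ a n) 3 m with hc
  set d : ℕ → ℂ := fun m ↦ ((Real.log n - Real.log m : ℝ) : ℂ) * I with hd
  set f : ℕ → C(ℝ, ℂ) := fun m ↦ ⟨fun y ↦ c m * Complex.exp (d m * y), by fun_prop⟩ with hf
  have hnd : ∀ (m : ℕ) (y : ℝ), ‖Complex.exp (d m * y)‖ = 1 := fun m y ↦ by
    have : d m * y = (((Real.log n - Real.log m) * y : ℝ) : ℂ) * I := by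
      simp only [hd]; push_cast; ring
    rw [this, Complex.norm_exp_ofReal_mul_I]
  have hnc : ∀ m, ‖c m‖ = n ^ 3 * ‖LSeries.term (fun n ↦ a n) 3 m‖ := fun m ↦ by
    rw [hc]
    simp only [norm_mul]
    congr 1
    rw [show (3 : ℂ) = ((3 : ℕ) : ℂ) by norm_num, Complex.cpow_natCast]; simp
  have hterm : ∀ (m : ℕ) (y : ℝ), LSeries.term (fun n ↦ a n) (3 + y * I) m *
      (n : ℂ) ^ (3 + y * I : ℂ) = f m y := fun m y ↦ by
    rcases eq_or_ne m 0 with rfl | hm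
    · simp [hf, hc]
    have hnC : (n : ℂ) ≠ 0 := by exact_mod_cast hn
    have hmC : (m : ℂ) ≠ 0 := by exact_mod_cast hm
    simp only [hf, hc, ContinuousMap.coe_mk, LSeries.term_of_ne_zero hm]
    rw [Complex.cpow_add _ _ hnC, Complex.cpow_add _ _ hmC]
    have e : Complex.exp (d m * y) = (n : ℂ) ^ (y * I : ℂ) / (m : ℂ) ^ (y * I : ℂ) := by
      rw [Complex.cpow_def_of_ne_zero hnC, Complex.cpow_def_of_ne_zero hmC, ← Complex.exp_sub,
        ← Complex.natCast_log, ← Complex.natCast_log]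
      congr 1
      simp only [hd]; push_cast; ring
    rw [e]
    ring
  have hsum : Summable fun m ↦ ‖c m‖ := by
    simp only [hnc]; exact hs3.norm.mul_left _
  have hint := intervalIntegral.hasSum_intervalIntegral_of_summable_norm (a := T) (b := 2 * T)
    (f := f) (hsum.of_nonneg_of_le (fun _ ↦ norm_nonneg _) fun m ↦ by
      refine (ContinuousMap.norm_le _ (norm_nonneg _)).2 fun y ↦ ?_
      simp [hf, hnd])
  have hI : (∫ y in T..2 * T, ∑' m, f m y) =
      ∫ y in T..2 * T, F (3 + y * I) * (n : ℂ) ^ (3 + y * I : ℂ) := by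
    congr 1; ext y
    rw [hF.eq_LSeries (by simp), LSeries, ← tsum_mul_right]
    simp only [hterm]
  rw [hI] at hint
  have hn1 : ∫ y in T..2 * T, f n y = a n * T := by
    have hnC : (n : ℂ) ^ (3 : ℂ) ≠ 0 := by
      rw [Ne, Complex.cpow_eq_zero_iff]; simp [hn]
    have : ∀ y, f n y = a n := fun y ↦ by
      simp only [hf, hc, hd, ContinuousMap.coe_mk, LSeries.term_of_ne_zero hn]
      simp only [sub_self, ofReal_zero, zero_mul, Complex.exp_zero, mul_one]
      exact mul_div_cancel₀ _ hnC
    simp only [this, intervalIntegral.integral_const]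
    rw [Complex.real_smul]; push_cast; ring
  have hint2 := hint.sub (hasSum_ite_eq n (a n * (T : ℂ)))
  have hb : HasSum (fun m ↦ 2 * (n : ℝ) ^ 4 * ‖LSeries.term (fun n ↦ a n) 2 m‖)
      (2 * (n : ℝ) ^ 4 * ∑' m, ‖LSeries.term (fun n ↦ a n) 2 m‖) := hs2.norm.hasSum.mul_left _
  refine (hint2.norm_le_of_bounded hb fun m ↦ ?_).trans ?_
  · rcases eq_or_ne m n with rfl | hmn
    · simp [hn1]; positivity
    rw [if_neg hmn, sub_zero]
    rcases eq_or_ne m 0 with rfl | hm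
    · simp [hf, hc]
    have hm0 : (0 : ℝ) < m := by positivity
    have hlog := inv_mul_le_abs_log_sub_log hm hn hmn
    have hlog0 : 0 < |Real.log n - Real.log m| := lt_of_lt_of_le (by positivity) hlog
    have hdn : ‖d m‖ = |Real.log n - Real.log m| := by
      simp only [hd, norm_mul, norm_I, mul_one, Complex.norm_real, Real.norm_eq_abs]
    have hd0 : d m ≠ 0 := norm_pos_iff.1 (hdn ▸ hlog0)
    simp only [hf, ContinuousMap.coe_mk, intervalIntegral.integral_const_mul,
      integral_exp_mul_complex hd0]
    rw [norm_mul, norm_div, hdn, hnc]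
    have h2 : ‖Complex.exp (d m * ((2 * T : ℝ) : ℂ)) - Complex.exp (d m * (T : ℝ))‖ ≤ 2 := by
      refine (norm_sub_le _ _).trans ?_
      rw [hnd, hnd]; norm_num
    have ht : ‖LSeries.term (fun n ↦ a n) 3 m‖ * m = ‖LSeries.term (fun n ↦ a n) 2 m‖ := by
      rw [LSeries.norm_term_eq, LSeries.norm_term_eq, if_neg hm, if_neg hm]
      have e3 : (m : ℝ) ^ (3 : ℂ).re = m ^ (2 : ℂ).re * m := by
        have : (3 : ℂ).re = (2 : ℂ).re + 1 := by norm_num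
        rw [this, Real.rpow_add_one hm0.ne']
      rw [e3]; field_simp
    calc _ ≤ (n : ℝ) ^ 3 * ‖LSeries.term (fun n ↦ a n) 3 m‖ * (2 * (n * m)) := by
          gcongr
          rw [div_le_iff₀ hlog0]
          refine h2.trans ?_
          have := mul_le_mul_of_nonneg_left hlog (show 0 ≤ (n : ℝ) * m by positivity)
          rw [mul_inv_cancel₀ (by positivity)] at this
          nlinarith
      _ = 2 * (n : ℝ) ^ 4 * (‖LSeries.term (fun n ↦ a n) 3 m‖ * m) := by ring
      _ = _ := by rw [ht]
      _ ≤ _ := le_rfl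
  · have : (0 : ℝ) < n ^ 4 := by positivity
    nlinarith

/-- Bound for a coefficient in terms of the size of `F` to the left of the critical strip. -/
lemma exists_norm_coeff_le (hF : IsSelberg a F) {A K T₀ : ℝ} (hA : 0 < A)
    (h : ∀ t : ℝ, T₀ ≤ |t| → ‖F (-A + t * I)‖ ≤ K * |t| ^ (1 / 2 : ℝ)) :
    ∃ C > 0, ∀ n : ℕ, n ≠ 0 → ∀ T : ℝ, 1 ≤ T → ∀ L : ℝ,
      (∀ t, T ≤ t → t ≤ 2 * T → ‖F (-A + t * I)‖ ≤ L) →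
      ‖a n‖ * T ≤ C * (n ^ 4 + n ^ 3 * T ^ (1 / 2 : ℝ)) + (n : ℝ) ^ (-A) * L * T := by
  obtain ⟨C₁, hC₁, h1⟩ := hF.exists_norm_integral_sub_le
  obtain ⟨C₂, hC₂, h2⟩ := hF.exists_norm_le_strip hA h
  refine ⟨C₁ + (C₂ * (3 + A) + C₂ * 2 * (3 + A)), by positivity, fun n hn T hT L hL ↦ ?_⟩
  have hn0 : (0 : ℝ) < n := by positivity
  have hn1 : (1 : ℝ) ≤ n := by exact_mod_cast Nat.one_le_iff_ne_zero.2 hn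
  have hT0 : 0 < T := by linarith
  set g : ℂ → ℂ := fun s ↦ F s * (n : ℂ) ^ s with hg
  have hgn : ∀ s, ‖g s‖ = ‖F s‖ * (n : ℝ) ^ s.re := fun s ↦ by
    simp only [hg, norm_mul]
    rw [← Complex.ofReal_natCast, Complex.norm_cpow_eq_rpow_re_of_pos hn0]
  have hnC : (n : ℂ) ≠ 0 := by exact_mod_cast hn
  -- Cauchy on [-A, 3] × [T, 2T], which misses the pole since T ≥ 1. The right side carries a_n T up
  -- to O(n⁴), the left side is at most n^(-A) L T, and the horizontal sides are O(n³ T^(1/2)) by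
  -- the convexity bound.
  have hrect := Complex.integral_boundary_rect_eq_zero_of_differentiableOn g
    ((-A : ℝ) + (T : ℝ) * I) ((3 : ℝ) + (2 * T : ℝ) * I) (fun s hs ↦ by
      refine DifferentiableAt.differentiableWithinAt ?_
      refine (hF.differentiableAt fun h0 ↦ ?_).mul
        (differentiableAt_id.const_cpow (Or.inl hnC))
      have := hs.2
      simp [h0, Set.uIcc_of_le (show T ≤ 2 * T by linarith)] at this
      linarith)
  have r1 : ((-A : ℝ) + (T : ℝ) * I : ℂ).re = -A := by simp
  have r2 : ((3 : ℝ) + (2 * T : ℝ) * I : ℂ).re = 3 := by simp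
  have i1 : ((-A : ℝ) + (T : ℝ) * I : ℂ).im = T := by simp
  have i2 : ((3 : ℝ) + (2 * T : ℝ) * I : ℂ).im = 2 * T := by simp
  rw [r1, r2, i1, i2] at hrect
  have hh : ∀ y : ℝ, 1 ≤ y → ‖∫ x in (-A)..3, g (x + y * I)‖ ≤
      C₂ * y ^ (1 / 2 : ℝ) * n ^ 3 * (3 + A) := fun y hy ↦ by
    refine (intervalIntegral.norm_integral_le_of_norm_le_const
      (C := C₂ * y ^ (1 / 2 : ℝ) * n ^ 3) fun x hx ↦ ?_).trans ?_
    · rw [Set.uIoc_of_le (by linarith)] at hx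
      rw [hgn]
      have h3 := h2 (x + y * I) (by simpa using hx.1.le) (by simpa using hx.2)
        (by simpa using hy.trans (le_abs_self y))
      have e : ((x : ℂ) + y * I).im = y := by simp
      have e' : ((x : ℂ) + y * I).re = x := by simp
      rw [e, abs_of_nonneg (by linarith)] at h3
      rw [e', ← Real.rpow_natCast]
      gcongr
      simpa using hx.2
    · rw [abs_of_nonneg (by linarith)]; linarith
  have hl : ‖∫ y in T..2 * T, g ((-A : ℝ) + y * I)‖ ≤ (n : ℝ) ^ (-A) * L * T := by
    refine (intervalIntegral.norm_integral_le_of_norm_le_const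
      (C := (n : ℝ) ^ (-A) * L) fun y hy ↦ ?_).trans ?_
    · rw [Set.uIoc_of_le (by linarith)] at hy
      rw [hgn, mul_comm]
      have e' : (((-A : ℝ) : ℂ) + y * I).re = -A := by simp
      rw [e']
      gcongr
      have := hL y hy.1.le hy.2
      push_cast
      exact this
    · rw [show 2 * T - T = T by ring, abs_of_nonneg hT0.le]
  have hr := h1 n hn T
  have hr' : (∫ y in T..2 * T, F (3 + y * I) * (n : ℂ) ^ (3 + y * I : ℂ)) =
      ∫ y in T..2 * T, g ((3 : ℝ) + y * I) := by simp [hg]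
  rw [hr'] at hr
  set R := ∫ y in T..2 * T, g ((3 : ℝ) + y * I)
  set Lf := ∫ y in T..2 * T, g ((-A : ℝ) + y * I)
  set H1 := ∫ x in (-A)..3, g (x + T * I)
  set H2 := ∫ x in (-A)..3, g (x + (2 * T : ℝ) * I)
  have hH1 : ‖H1‖ ≤ C₂ * T ^ (1 / 2 : ℝ) * n ^ 3 * (3 + A) := hh T hT
  have hH2 : ‖H2‖ ≤ C₂ * (2 * T) ^ (1 / 2 : ℝ) * n ^ 3 * (3 + A) := hh (2 * T) (by linarith)
  have h2T : (2 * T) ^ (1 / 2 : ℝ) ≤ 2 * T ^ (1 / 2 : ℝ) := by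
    rw [Real.mul_rpow two_pos.le hT0.le]
    gcongr
    calc (2 : ℝ) ^ (1 / 2 : ℝ) ≤ 2 ^ (1 : ℝ) := by
          apply Real.rpow_le_rpow_of_exponent_le <;> norm_num
      _ = 2 := by norm_num
  have hRn : ‖R‖ ≤ ‖Lf‖ + ‖H1‖ + ‖H2‖ := by
    have e : I * R = I * Lf - H1 + H2 := by
      simp only [smul_eq_mul] at hrect
      linear_combination hrect
    calc ‖R‖ = ‖I * R‖ := by simp
      _ ≤ ‖I * Lf - H1‖ + ‖H2‖ := by rw [e]; exact norm_add_le _ _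
      _ ≤ ‖I * Lf‖ + ‖H1‖ + ‖H2‖ := by gcongr; exact norm_sub_le _ _
      _ = _ := by simp
  have ha : ‖a n‖ * T ≤ C₁ * n ^ 4 + ‖R‖ := by
    have h5 : ‖a n * (T : ℂ)‖ ≤ ‖R - a n * T‖ + ‖R‖ := by
      have := norm_sub_le (a n * (T : ℂ) - R) (-R)
      rw [norm_neg, sub_neg_eq_add, sub_add_cancel, norm_sub_rev] at this
      exact this
    rw [norm_mul, Complex.norm_real, Real.norm_of_nonneg hT0.le] at h5
    linarith
  have p1 : 0 ≤ (n : ℝ) ^ 4 := by positivity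
  have p2 : 0 ≤ (n : ℝ) ^ 3 * T ^ (1 / 2 : ℝ) := by positivity
  have p3 : C₂ * (2 * T) ^ (1 / 2 : ℝ) * n ^ 3 * (3 + A) ≤
      C₂ * (2 * T ^ (1 / 2 : ℝ)) * n ^ 3 * (3 + A) := by gcongr
  have p4 : 0 ≤ (C₂ * (3 + A) + C₂ * 2 * (3 + A)) * (n : ℝ) ^ 4 := by positivity
  have p5 : 0 ≤ C₁ * ((n : ℝ) ^ 3 * T ^ (1 / 2 : ℝ)) := by positivity
  nlinarith

end IsSelberg

namespace IsSelberg

variable {a : ArithmeticFunction ℂ} {F : ℂ → ℂ}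

/-- `F` is given by its Dirichlet series wherever the latter converges absolutely. -/
lemma eq_LSeries_of_abscissa (hF : IsSelberg a F) {x : ℝ}
    (hx : ∀ s : ℂ, x < s.re → LSeriesSummable (fun n ↦ a n) s) {s : ℂ} (hs : x < s.re)
    (hs1 : s ≠ 1) : F s = LSeries (fun n ↦ a n) s := by
  obtain ⟨m, E, hE, hEF⟩ := hF.analyticity
  have ho : IsOpen {s : ℂ | x < s.re} := isOpen_lt continuous_const continuous_re
  have habs : LSeries.abscissaOfAbsConv (fun n ↦ a n) ≤ x :=
    LSeries.abscissaOfAbsConv_le_of_forall_lt_LSeriesSummable fun y hy ↦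
      hx y (by simpa using hy)
  have hG : AnalyticOnNhd ℂ (fun s ↦ (s - 1) ^ m * LSeries (fun n ↦ a n) s)
      {s : ℂ | x < s.re} := by
    refine DifferentiableOn.analyticOnNhd (fun z hz ↦ ?_) ho
    refine DifferentiableAt.differentiableWithinAt ?_
    refine DifferentiableAt.mul (by fun_prop) ?_
    exact (LSeries_hasDerivAt (habs.trans_lt (by exact_mod_cast hz))).differentiableAt
  have hE' : AnalyticOnNhd ℂ E {s : ℂ | x < s.re} :=
    DifferentiableOn.analyticOnNhd hE.1.differentiableOn ho
  have hpre : IsPreconnected {s : ℂ | x < s.re} :=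
    (convex_halfSpace_re_gt x).isPreconnected
  have h0 := hE'.eqOn_of_preconnected_of_eventuallyEq hG hpre
    (z₀ := ((max x 1 + 1 : ℝ) : ℂ)) (by
      simp only [Set.mem_ofPred_eq, ofReal_re]; linarith [le_max_left x 1]) (by
      have : ∀ᶠ z : ℂ in nhds ((max x 1 + 1 : ℝ) : ℂ), 1 < z.re :=
        (isOpen_lt continuous_const continuous_re).mem_nhds (by
          simp only [Set.mem_ofPred_eq, ofReal_re]; linarith [le_max_right x 1])
      filter_upwards [this] with z hz
      rw [← hEF z (fun h ↦ by simp [h] at hz), hF.eq_LSeries hz])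
  have := h0 (show s ∈ {s : ℂ | x < s.re} from hs)
  rw [← hEF s hs1] at this
  exact mul_left_cancel₀ (pow_ne_zero m (sub_ne_zero.2 hs1)) this

/-- There are no elements of small positive degree. -/
lemma sum_ge_of_hasFunctionalEquation (hF : IsSelberg a F) {k : ℕ} {ε : ℂ} {Q : ℝ}
    {w : Fin k → ℝ} {μ : Fin k → ℂ} (h : HasFunctionalEquation ε Q w μ F) (hk : k ≠ 0) :
    1 / 76 ≤ ∑ i, w i := by
  -- On Re s = -9 the upper growth exponent is 2 (1 + 2·9) ∑ w_i = 38 ∑ w_i, which is below 1/2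
  -- exactly when ∑ w_i < 1/76.
  by_contra! hD
  have hD0 : 0 < ∑ i, w i := by
    have : Nonempty (Fin k) := ⟨⟨0, Nat.pos_of_ne_zero hk⟩⟩
    exact Finset.sum_pos (fun i _ ↦ h.2.2.1 i) Finset.univ_nonempty
  set D := ∑ i, w i with hDdef
  obtain ⟨C₀, hC₀, hup⟩ := hF.exists_norm_le (σ := 1 + 9) (by norm_num)
  obtain ⟨K, hK, T₀, hT₀, hleft⟩ := h.exists_norm_le (A := 9) (by norm_num) hC₀ hup
  have hleft' : ∀ t : ℝ, T₀ ≤ |t| → ‖F (-(9 : ℝ) + t * I)‖ ≤ K * |t| ^ (1 / 2 : ℝ) := by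
    intro t ht
    refine (hleft t ht).trans ?_
    gcongr
    · exact hT₀.trans ht
    · linarith
  obtain ⟨C, hC, hcoeff⟩ := hF.exists_norm_coeff_le (A := 9) (by norm_num) hleft'
  have hT0 : 0 < T₀ := by linarith
  -- Take T = T₀ n^12 in the coefficient bound. After division by T the three terms are of order
  -- n^(4-12), n^(3-6) and n^(-9+6), so all are O(n^(-3)).
  have ha : ∀ n : ℕ, n ≠ 0 → ‖a n‖ ≤
      (C * (1 + T₀ ^ (1 / 2 : ℝ)) + K * (2 * T₀) ^ (1 / 2 : ℝ)) * (n : ℝ) ^ ((-2 : ℝ) - 1) := by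
    intro n hn
    have hn0 : (0 : ℝ) < n := by positivity
    have hn1 : (1 : ℝ) ≤ n := by exact_mod_cast Nat.one_le_iff_ne_zero.2 hn
    have hn12 : (1 : ℝ) ≤ n ^ 12 := one_le_pow₀ hn1
    have hT1 : T₀ ≤ T₀ * n ^ 12 := le_mul_of_one_le_right hT0.le hn12
    have hsq : ((n : ℝ) ^ 12) ^ (1 / 2 : ℝ) = n ^ 6 := by
      rw [← Real.rpow_natCast, ← Real.rpow_mul hn0.le, ← Real.rpow_natCast]; norm_num
    have h1 := hcoeff n hn (T₀ * n ^ 12) (hT₀.trans hT1) (K * ((2 * T₀) ^ (1 / 2 : ℝ) * n ^ 6)) (by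
      intro t ht ht'
      have ht0 : 0 < t := by linarith
      have := hleft' t ((hT1.trans ht).trans (le_abs_self t))
      refine this.trans ?_
      rw [abs_of_pos ht0, ← hsq, ← Real.mul_rpow (by positivity) (by positivity)]
      gcongr
      linarith)
    rw [Real.mul_rpow hT0.le (by positivity), hsq] at h1
    have e3 : (n : ℝ) ^ ((-2 : ℝ) - 1) = ((n : ℝ) ^ 3)⁻¹ := by
      rw [← Real.rpow_natCast, ← Real.rpow_neg hn0.le]; norm_num
    have e9 : (n : ℝ) ^ (-9 : ℝ) = ((n : ℝ) ^ 9)⁻¹ := by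
      rw [← Real.rpow_natCast, ← Real.rpow_neg hn0.le]; norm_num
    rw [e9] at h1
    rw [e3, ← div_eq_mul_inv, le_div_iff₀ (by positivity)]
    have h2 : (n : ℝ) ^ 4 ≤ T₀ * n ^ 9 := by
      calc (n : ℝ) ^ 4 ≤ n ^ 9 := pow_le_pow_right₀ hn1 (by norm_num)
        _ ≤ _ := le_mul_of_one_le_left (by positivity) hT₀
    have h3 : (n : ℝ) ^ 3 * (T₀ ^ (1 / 2 : ℝ) * n ^ 6) ≤ T₀ ^ (1 / 2 : ℝ) * (T₀ * n ^ 9) := by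
      calc _ = T₀ ^ (1 / 2 : ℝ) * n ^ 9 := by ring
        _ ≤ _ := by gcongr; exact le_mul_of_one_le_left (by positivity) hT₀
    have h4 : C * ((n : ℝ) ^ 4 + n ^ 3 * (T₀ ^ (1 / 2 : ℝ) * n ^ 6)) ≤
        C * (1 + T₀ ^ (1 / 2 : ℝ)) * (T₀ * n ^ 9) := by
      rw [mul_assoc]
      gcongr
      linarith
    have h5 : ((n : ℝ) ^ 9)⁻¹ * (K * ((2 * T₀) ^ (1 / 2 : ℝ) * n ^ 6)) * (T₀ * n ^ 12) =
        K * (2 * T₀) ^ (1 / 2 : ℝ) * (T₀ * n ^ 9) := by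
      field_simp
    rw [h5] at h1
    refine le_of_mul_le_mul_right ?_ (show 0 < T₀ * (n : ℝ) ^ 9 by positivity)
    calc ‖a n‖ * n ^ 3 * (T₀ * n ^ 9) = ‖a n‖ * (T₀ * n ^ 12) := by ring
      _ ≤ _ := h1
      _ ≤ _ := by linarith
  have hsum : ∀ s : ℂ, -2 < s.re → LSeriesSummable (fun n ↦ a n) s := fun s hs ↦
    LSeriesSummable_of_le_const_mul_rpow hs ⟨_, ha⟩
  -- F is now bounded on Re s = -1 by its absolutely convergent series, while the functional
  -- equation makes it grow at least like t^(3D) there with D > 0.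
  obtain ⟨c, hc, hlow⟩ := hF.exists_le_norm (σ := 1 + 1) (by norm_num)
  obtain ⟨K', hK', hlow'⟩ := h.exists_le_norm one_pos hc hlow
  have htend : Tendsto (fun t : ℝ ↦ K' * t ^ ((1 + 2 * 1) * D)) atTop atTop :=
    (tendsto_rpow_atTop (by positivity)).const_mul_atTop hK'
  obtain ⟨t, ⟨ht, ht1⟩, ht2⟩ := ((hlow'.and (eventually_ge_atTop 1)).and
    (htend.eventually_gt_atTop (∑' n, ‖LSeries.term (fun n ↦ a n) (-1) n‖))).exists
  have h1 : (-(1 : ℝ) + t * I : ℂ) ≠ 1 := fun h0 ↦ by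
    have : t = 0 := by simpa using congrArg Complex.im h0
    linarith
  rw [hF.eq_LSeries_of_abscissa hsum (by simp) h1] at ht
  have := LSeries.norm_le_tsum_of_re_le (s := (-(1 : ℝ) + t * I : ℂ))
    (hsum (-1) (by simp)) (by simp)
  linarith

end IsSelberg

/-! ### Euler products with finitely many terms; the case of no gamma factors -/

/-- If the Taylor coefficients of a polynomial and of its logarithm are `c` and `β`, geometric growth
of `β` bounds the leading coefficient. -/
lemma norm_le_pow_of_log_coeff {c β : ℕ → ℂ} {C ρ : ℝ} {k : ℕ} (hρ : 0 < ρ) (h0 : c 0 = 1)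
    (hrec : ∀ j : ℕ, ((j : ℂ) + 1) * c (j + 1) =
      ∑ x ∈ Finset.HasAntidiagonal.antidiagonal j, (((x.1 : ℂ) + 1) * β (x.1 + 1)) * c x.2)
    (hk : ∀ j, k < j → c j = 0) (hck : c k ≠ 0) (hβ : ∀ i, ‖β (i + 1)‖ ≤ C * ρ ^ (i + 1)) :
    ‖c k‖ ≤ ρ ^ k := by
  set P : Polynomial ℂ := ∑ j ∈ Finset.range (k + 1), Polynomial.monomial j (c j) with hP
  have hcoeff : ∀ j, P.coeff j = c j := by
    intro j
    simp only [hP, Polynomial.finsetSum_coeff, Polynomial.coeff_monomial]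
    rw [Finset.sum_ite_eq' (Finset.range (k + 1)) j c]
    split_ifs with h
    · rfl
    · exact (hk j (by simpa using h)).symm
  have hdeg : P.natDegree = k := by
    refine le_antisymm ?_ (Polynomial.le_natDegree_of_ne_zero (by rwa [hcoeff]))
    exact Polynomial.natDegree_le_iff_coeff_eq_zero.2 fun j hj ↦ by rw [hcoeff, hk j hj]
  have hC : 0 ≤ C := by
    have := (norm_nonneg _).trans (hβ 0)
    simp only [zero_add, pow_one] at this
    exact nonneg_of_mul_nonneg_left this hρ
  have hsumK : ∀ r : ℝ, 0 ≤ r → r * ρ < 1 →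
      Summable fun i : ℕ ↦ ((i : ℝ) + 1) * (C * ρ ^ (i + 1)) * r ^ i := by
    intro r hr hr1
    have h1 := (summable_pow_mul_geometric_of_norm_lt_one 1 (r := r * ρ)
      (by rwa [Real.norm_of_nonneg (by positivity)]))
    have h2 := summable_geometric_of_lt_one (r := r * ρ) (by positivity) hr1
    refine ((h1.add h2).mul_left (C * ρ)).congr fun i ↦ ?_
    rw [mul_pow]; ring
  -- The recurrence is P' = (log P)' · P read off coefficientwise; the bound on β makes the
  -- logarithmic derivative converge for |x| < 1/ρ.
  have hderiv : ∀ x : ℂ, ‖x‖ * ρ < 1 → P.derivative.eval x =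
      (∑' i : ℕ, (((i : ℂ) + 1) * β (i + 1)) * x ^ i) * P.eval x := by
    intro x hx
    have hPx : HasSum (fun j ↦ c j * x ^ j) (P.eval x) := by
      rw [Polynomial.eval_eq_sum_range]
      simp only [hcoeff, hdeg]
      refine hasSum_sum_of_ne_finset_zero fun j hj ↦ ?_
      rw [hk j (by simpa using hj), zero_mul]
    have hPd : HasSum (fun j : ℕ ↦ ((j : ℂ) + 1) * c (j + 1) * x ^ j) (P.derivative.eval x) := by
      rw [Polynomial.eval_eq_sum_range' (n := k + 1)
        ((Polynomial.natDegree_derivative_le P).trans_lt (by omega))]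
      simp only [Polynomial.coeff_derivative, hcoeff]
      have : ∀ j : ℕ, ((j : ℂ) + 1) * c (j + 1) * x ^ j = c (j + 1) * (j + 1) * x ^ j :=
        fun j ↦ by ring
      simp only [this]
      refine hasSum_sum_of_ne_finset_zero fun j hj ↦ ?_
      rw [hk (j + 1) (by simp at hj; omega), zero_mul, zero_mul]
    rw [← hPx.tsum_eq, tsum_mul_tsum_eq_tsum_sum_antidiagonal_of_summable_norm, ← hPd.tsum_eq]
    · refine tsum_congr fun j ↦ ?_
      rw [hrec, Finset.sum_mul]
      refine Finset.sum_congr rfl fun y hy ↦ ?_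
      rw [← Finset.HasAntidiagonal.mem_antidiagonal.1 hy, pow_add]; ring
    · refine (hsumK ‖x‖ (norm_nonneg _) hx).of_nonneg_of_le (fun _ ↦ norm_nonneg _) fun i ↦ ?_
      rw [norm_mul, norm_mul, norm_pow]
      have : ‖(i : ℂ) + 1‖ = (i : ℝ) + 1 := by
        rw [← Nat.cast_succ, Complex.norm_natCast]; simp
      rw [this]
      gcongr
      exact hβ i
    · refine summable_of_ne_finset_zero (s := Finset.range (k + 1)) fun j hj ↦ ?_
      rw [hk j (by simpa using hj)]; simp
  -- At a root x with |x| < 1/ρ, the inequality |P'| ≤ M |P| on the segment from x to 0 and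
  -- Gronwall's lemma would propagate the zero to P(0) = 1.
  have hroot : ∀ x : ℂ, P.IsRoot x → 1 ≤ ‖x‖ * ρ := by
    intro x hx
    by_contra! hlt
    set M : ℝ := ∑' i : ℕ, ((i : ℝ) + 1) * (C * ρ ^ (i + 1)) * ‖x‖ ^ i
    have hbd : ∀ y : ℂ, ‖y‖ ≤ ‖x‖ → ‖P.derivative.eval y‖ ≤ M * ‖P.eval y‖ := by
      intro y hy
      rw [hderiv y (lt_of_le_of_lt (by gcongr) hlt), norm_mul]
      gcongr
      refine tsum_of_norm_bounded (hsumK ‖x‖ (norm_nonneg _) hlt).hasSum fun i ↦ ?_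
      rw [norm_mul, norm_mul, norm_pow]
      have : ‖(i : ℂ) + 1‖ = (i : ℝ) + 1 := by
        rw [← Nat.cast_succ, Complex.norm_natCast]; simp
      rw [this]
      gcongr
      exact hβ i
    have hd : ∀ t : ℝ, HasDerivAt (fun t : ℝ ↦ P.eval ((1 - t : ℝ) * x))
        (P.derivative.eval ((1 - t : ℝ) * x) * (-x)) t := by
      intro t
      have h1 : HasDerivAt (fun t : ℝ ↦ (((1 - t : ℝ) : ℂ) * x)) (-x) t := by
        have := (((hasDerivAt_id t).const_sub 1).ofReal_comp).mul_const x
        simpa using this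
      exact (P.hasDerivAt _).comp t h1
    have := norm_le_gronwallBound_of_norm_deriv_right_le (a := 0) (b := 1) (δ := 0) (ε := 0)
      (K := M * ‖x‖) (f := fun t : ℝ ↦ P.eval ((1 - t : ℝ) * x))
      (f' := fun t : ℝ ↦ P.derivative.eval ((1 - t : ℝ) * x) * (-x))
      (fun t _ ↦ (hd t).continuousAt.continuousWithinAt) (fun t _ ↦ (hd t).hasDerivWithinAt)
      (by simpa using hx) (fun t ht ↦ ?_) 1 (by simp)
    · rw [gronwallBound_ε0_δ0] at this
      simp only [sub_self, ofReal_zero, zero_mul, norm_le_zero_iff] at this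
      rw [← Polynomial.coeff_zero_eq_eval_zero, hcoeff, h0] at this
      exact one_ne_zero this
    · rw [add_zero, norm_mul, norm_neg]
      have h2 := hbd ((1 - t : ℝ) * x) (by
        rw [norm_mul, Complex.norm_real, Real.norm_of_nonneg (by linarith [ht.2])]
        exact mul_le_of_le_one_left (norm_nonneg _) (by linarith [ht.1]))
      calc _ ≤ M * ‖P.eval ((1 - t : ℝ) * x)‖ * ‖x‖ := by gcongr
        _ = _ := by ring
  -- The leading coefficient times the product of the k roots is ±P(0) = ±1, and each root has
  -- modulus at least 1/ρ.
  have hsplit := (IsAlgClosed.splits P).coeff_zero_eq_leadingCoeff_mul_prod_roots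
  have hcard : P.roots.card = k := by
    rw [← hdeg]; exact (IsAlgClosed.splits P).natDegree_eq_card_roots.symm
  rw [hcoeff, h0, Polynomial.leadingCoeff, hcoeff, hdeg] at hsplit
  have hn := congrArg norm hsplit
  rw [norm_mul, norm_mul, norm_pow, norm_neg, norm_one, one_pow, one_mul] at hn
  have hprod : 1 ≤ ‖P.roots.prod‖ * ρ ^ k := by
    rw [← hcard]
    have : ∀ m : Multiset ℂ, (∀ x ∈ m, 1 ≤ ‖x‖ * ρ) → 1 ≤ ‖m.prod‖ * ρ ^ m.card := by
      intro m
      induction m using Multiset.induction_on with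
      | empty => simp
      | cons x m ih =>
        intro h
        have h1 := h x (by simp)
        have h2 := ih fun y hy ↦ h y (by simp [hy])
        rw [Multiset.prod_cons, Multiset.card_cons, norm_mul, pow_succ]
        calc (1 : ℝ) ≤ (‖x‖ * ρ) * (‖m.prod‖ * ρ ^ m.card) := one_le_mul_of_one_le_of_one_le h1 h2
          _ = _ := by ring
    exact this _ fun x hx ↦ hroot x (Polynomial.isRoot_of_mem_roots hx)
  calc ‖c k‖ = ‖c k‖ * 1 := (mul_one _).symm
    _ ≤ ‖c k‖ * (‖P.roots.prod‖ * ρ ^ k) := by gcongr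
    _ = (‖c k‖ * ‖P.roots.prod‖) * ρ ^ k := by ring
    _ = ρ ^ k := by rw [← hn, one_mul]

/-- The relation between the coefficients of a Dirichlet series and those of its logarithm. -/
lemma log_mul_eq_sum_divisors {a b : ℕ → ℂ} (hab : ∀ s : ℂ, 1 < s.re →
      LSeriesSummable a s ∧ LSeriesSummable b s ∧ Complex.exp (LSeries b s) = LSeries a s)
    {n : ℕ} (hn : n ≠ 0) :
    Complex.log n * a n = ∑ d ∈ n.divisors, Complex.log d * b d * a (n / d) := by
  have ha : LSeries.abscissaOfAbsConv a ≤ 1 :=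
    LSeries.abscissaOfAbsConv_le_of_forall_lt_LSeriesSummable fun y hy ↦
      (hab y (by simpa using hy)).1
  have hb : LSeries.abscissaOfAbsConv b ≤ 1 :=
    LSeries.abscissaOfAbsConv_le_of_forall_lt_LSeriesSummable fun y hy ↦
      (hab y (by simpa using hy)).2.1
  have hb' : LSeries.abscissaOfAbsConv (LSeries.logMul b) ≤ 1 := by
    rwa [LSeries.abscissaOfAbsConv_logMul]
  have h1 : (1 : EReal) < ⊤ := by exact_mod_cast EReal.coe_lt_top 1
  -- Differentiating A = exp B gives -A' = (-B') A, and Dirichlet coefficients are unique.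
  have key : LSeries.logMul a n = LSeries.convolution (LSeries.logMul b) a n := by
    refine LSeries.eq_of_LSeries_eventually_eq ?_ ?_ ?_ hn
    · rw [LSeries.abscissaOfAbsConv_logMul]; exact ha.trans_lt h1
    · exact (LSeries.abscissaOfAbsConv_convolution_le _ _).trans_lt
        (max_lt (hb'.trans_lt h1) (ha.trans_lt h1))
    · filter_upwards [eventually_gt_atTop 1] with x hx
      have hx' : (1 : EReal) < ((x : ℂ).re : EReal) := by
        rw [ofReal_re]; exact_mod_cast hx
      rw [LSeries_convolution (hb'.trans_lt hx') (ha.trans_lt hx')]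
      have hda := LSeries_hasDerivAt (ha.trans_lt hx')
      have hdb := (LSeries_hasDerivAt (hb.trans_lt hx')).cexp
      have heq : LSeries a =ᶠ[nhds (x : ℂ)] fun s ↦ Complex.exp (LSeries b s) := by
        filter_upwards [(isOpen_lt continuous_const continuous_re).mem_nhds
          (show (1 : ℝ) < (x : ℂ).re by simpa using hx)] with z hz using (hab z hz).2.2.symm
      have := (hdb.congr_of_eventuallyEq heq).unique hda
      rw [(hab x (by simpa using hx)).2.2] at this
      linear_combination this
  rw [LSeries.convolution_def] at key
  simp only [LSeries.logMul] at key
  rw [key, Nat.sum_divisorsAntidiagonal (f := fun i j ↦ Complex.log i * b i * a j)]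

namespace IsSelberg

variable {a : ArithmeticFunction ℂ} {F : ℂ → ℂ}

/-- The coefficients `b` of `log F`, with the estimate for `b` made uniform. -/
lemma exists_log_coeff (hF : IsSelberg a F) : ∃ (b : ℕ → ℂ) (θ C : ℝ), 0 < C ∧ θ < 1 / 2 ∧
    (∀ n, ¬ IsPrimePow n → b n = 0) ∧ (∀ n : ℕ, n ≠ 0 → ‖b n‖ ≤ C * (n : ℝ) ^ θ) ∧
    (∀ s : ℂ, 1 < s.re → LSeriesSummable b s ∧ Complex.exp (LSeries b s) = F s) ∧
    (∀ n : ℕ, n ≠ 0 →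
      Complex.log n * a n = ∑ d ∈ n.divisors, Complex.log d * b d * a (n / d)) := by
  obtain ⟨-, b, θ, hθ, hpp, hO, hb⟩ := hF.euler_product
  obtain ⟨C, hC, h⟩ := hO.exists_pos
  rw [isBigOWith_iff, eventually_atTop] at h
  obtain ⟨N, hN⟩ := h
  have hnn : ∀ n : ℕ, n ≠ 0 → (0 : ℝ) < (n : ℝ) ^ θ := fun n hn ↦
    Real.rpow_pos_of_pos (by positivity) _
  refine ⟨b, θ, C + ∑ n ∈ Finset.range N, ‖b n‖ / (n : ℝ) ^ θ, ?_, hθ, hpp, fun n hn ↦ ?_, hb,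
    fun n hn ↦ log_mul_eq_sum_divisors (fun s hs ↦ ⟨hF.summable hs, (hb s hs).1, ?_⟩) hn⟩
  · have : 0 ≤ ∑ n ∈ Finset.range N, ‖b n‖ / (n : ℝ) ^ θ := Finset.sum_nonneg fun n _ ↦ by
      positivity
    linarith
  · rw [← div_le_iff₀ (hnn n hn)]
    rcases le_or_gt N n with h | h
    · have h1 := hN n h
      rw [Real.norm_of_nonneg (hnn n hn).le, ← div_le_iff₀ (hnn n hn)] at h1
      have : 0 ≤ ∑ n ∈ Finset.range N, ‖b n‖ / (n : ℝ) ^ θ := Finset.sum_nonneg fun n _ ↦ by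
        positivity
      linarith
    · have := Finset.single_le_sum (f := fun n : ℕ ↦ ‖b n‖ / (n : ℝ) ^ θ)
        (fun n _ ↦ by positivity) (Finset.mem_range.2 h)
      linarith
  · rw [(hb s hs).2, hF.eq_LSeries hs]

end IsSelberg

/-- A function whose logarithm is supported on prime powers is multiplicative. -/
lemma isMultiplicative_of_log_coeff {a : ArithmeticFunction ℂ} {b : ℕ → ℂ} (h1 : a 1 = 1)
    (hpp : ∀ n, ¬ IsPrimePow n → b n = 0)
    (h : ∀ n : ℕ, n ≠ 0 →
      Complex.log n * a n = ∑ d ∈ n.divisors, Complex.log d * b d * a (n / d)) :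
    a.IsMultiplicative := by
  refine ⟨h1, ?_⟩
  -- Strong induction on the product. In the recurrence for mn only prime powers d contribute, and
  -- such a d divides exactly one of m and n. The induction hypothesis splits a(mn/d), and log (mn)
  -- = log m + log n reassembles the two sums.
  have main : ∀ N m n : ℕ, m * n = N → m ≠ 0 → n ≠ 0 → m.Coprime n → a (m * n) = a m * a n := by
    intro N
    induction N using Nat.strong_induction_on with
    | _ N ih =>
      intro m n hN hm hn hmn
      by_cases h1' : m * n = 1
      · obtain ⟨rfl, rfl⟩ := mul_eq_one.1 h1'
        simp [h1]
      have hmn0 : m * n ≠ 0 := mul_ne_zero hm hn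
      have hlog : Complex.log ((m * n : ℕ) : ℂ) ≠ 0 := by
        rw [← Complex.natCast_log, Complex.ofReal_ne_zero]
        exact (Real.log_pos (by exact_mod_cast (by omega : 1 < m * n))).ne'
      refine mul_left_cancel₀ hlog ?_
      rw [h _ hmn0]
      set f : ℕ → ℂ := fun d ↦ Complex.log d * b d with hf
      have hf1 : f 1 = 0 := by simp [hf]
      have hfpp : ∀ d, ¬ IsPrimePow d → f d = 0 := fun d hd ↦ by simp [hf, hpp d hd]
      have hsub : m.divisors ∪ n.divisors ⊆ (m * n).divisors :=
        Finset.union_subset (Nat.divisors_subset_of_dvd hmn0 (dvd_mul_right _ _))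
          (Nat.divisors_subset_of_dvd hmn0 (dvd_mul_left _ _))
      have hinter : ∑ d ∈ m.divisors ∩ n.divisors, f d * a (m * n / d) = 0 := by
        refine Finset.sum_eq_zero fun d hd ↦ ?_
        have hd1 := Nat.dvd_of_mem_divisors (Finset.mem_inter.1 hd).1
        have hd2 := Nat.dvd_of_mem_divisors (Finset.mem_inter.1 hd).2
        have : d = 1 := Nat.eq_one_of_dvd_coprimes hmn hd1 hd2
        rw [this, hf1, zero_mul]
      have e : ∑ d ∈ (m * n).divisors, f d * a (m * n / d) =
          ∑ d ∈ m.divisors, f d * a (m * n / d) + ∑ d ∈ n.divisors, f d * a (m * n / d) := by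
        rw [← Finset.sum_union_inter, hinter, add_zero]
        refine (Finset.sum_subset hsub fun d hd hd' ↦ ?_).symm
        by_cases hdp : IsPrimePow d
        · exfalso
          refine hd' (Finset.mem_union.2 ?_)
          rcases (hmn.isPrimePow_dvd_mul hdp).1 (Nat.dvd_of_mem_divisors hd) with h | h
          · exact Or.inl (Nat.mem_divisors.2 ⟨h, hm⟩)
          · exact Or.inr (Nat.mem_divisors.2 ⟨h, hn⟩)
        · rw [hfpp d hdp, zero_mul]
      have em : ∑ d ∈ m.divisors, f d * a (m * n / d) = (Complex.log m * a m) * a n := by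
        rw [h m hm, Finset.sum_mul]
        refine Finset.sum_congr rfl fun d hd ↦ ?_
        by_cases hd1 : d = 1
        · simp [hd1, hf1]
        obtain ⟨c, rfl⟩ := Nat.dvd_of_mem_divisors hd
        have hd0 : 0 < d := Nat.pos_of_ne_zero fun h0 ↦ hm (by simp [h0])
        have he0 : c ≠ 0 := fun h0 ↦ hm (by simp [h0])
        rw [mul_assoc d c n, Nat.mul_div_cancel_left _ hd0, Nat.mul_div_cancel_left _ hd0,
          ih (c * n) ?_ c n rfl he0 hn (Nat.Coprime.coprime_mul_left hmn)]
        · ring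
        · rw [← hN, mul_assoc]
          have : 0 < c * n := Nat.pos_of_ne_zero (mul_ne_zero he0 hn)
          nlinarith [show 2 ≤ d by omega]
      have en : ∑ d ∈ n.divisors, f d * a (m * n / d) = a m * (Complex.log n * a n) := by
        rw [h n hn, Finset.mul_sum]
        refine Finset.sum_congr rfl fun d hd ↦ ?_
        by_cases hd1 : d = 1
        · simp [hd1, hf1]
        obtain ⟨c, rfl⟩ := Nat.dvd_of_mem_divisors hd
        have hd0 : 0 < d := Nat.pos_of_ne_zero fun h0 ↦ hn (by simp [h0])
        have he0 : c ≠ 0 := fun h0 ↦ hn (by simp [h0])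
        rw [show m * (d * c) = d * (m * c) by ring, Nat.mul_div_cancel_left _ hd0,
          Nat.mul_div_cancel_left _ hd0,
          ih (m * c) ?_ m c rfl hm he0 (Nat.Coprime.coprime_mul_left_right hmn)]
        · ring
        · rw [← hN, show m * (d * c) = d * (m * c) by ring]
          have : 0 < m * c := Nat.pos_of_ne_zero (mul_ne_zero hm he0)
          nlinarith [show 2 ≤ d by omega]
      have hlogmul : Complex.log ((m * n : ℕ) : ℂ) = Complex.log m + Complex.log n := by
        rw [← Complex.natCast_log, ← Complex.natCast_log, ← Complex.natCast_log, Nat.cast_mul,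
          Real.log_mul (by exact_mod_cast hm) (by exact_mod_cast hn), Complex.ofReal_add]
      rw [e, em, en, hlogmul]
      ring
  intro m n hmn
  rcases eq_or_ne m 0 with rfl | hm
  · simp
  rcases eq_or_ne n 0 with rfl | hn
  · simp
  exact main _ m n rfl hm hn hmn

lemma log_coeff_prime {a : ArithmeticFunction ℂ} {b : ℕ → ℂ} (h1 : a 1 = 1)
    (h : ∀ n : ℕ, n ≠ 0 →
      Complex.log n * a n = ∑ d ∈ n.divisors, Complex.log d * b d * a (n / d))
    {p : ℕ} (hp : p.Prime) : b p = a p := by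
  have hlog : Complex.log (p : ℂ) ≠ 0 := by
    rw [← Complex.natCast_log, Complex.ofReal_ne_zero]
    exact (Real.log_pos (by exact_mod_cast hp.one_lt)).ne'
  have := h p hp.ne_zero
  rw [hp.sum_divisors, Nat.div_self hp.pos] at this
  simp only [h1, Nat.cast_one, Complex.log_one, zero_mul, mul_one, add_zero] at this
  exact (mul_left_cancel₀ hlog this).symm

/-- The top coefficient of a multiplicative function of finite support whose logarithm has
coefficients `O(n ^ θ)`. -/
lemma norm_top_coeff_le {a : ArithmeticFunction ℂ} {b : ℕ → ℂ} {θ C : ℝ}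
    (ha : a.IsMultiplicative) (hbC : ∀ n : ℕ, n ≠ 0 → ‖b n‖ ≤ C * (n : ℝ) ^ θ)
    (h : ∀ n : ℕ, n ≠ 0 →
      Complex.log n * a n = ∑ d ∈ n.divisors, Complex.log d * b d * a (n / d))
    {N : ℕ} (hN : a N ≠ 0) (hmax : ∀ n, N < n → a n = 0) : ‖a N‖ ≤ (N : ℝ) ^ θ := by
  have hN0 : N ≠ 0 := fun h0 ↦ hN (by simp [h0])
  -- The coefficients a(p^j) form a polynomial whose degree is the exponent v of p in N: for j > v
  -- the product a(p^j) a(N/p^v) is a coefficient beyond N, hence 0, while a(N/p^v) ≠ 0. The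
  -- preceding polynomial bound applies with ρ = p^θ.
  have hloc : ∀ p : ℕ, p.Prime → ‖a (p ^ N.factorization p)‖ ≤
      ((p : ℝ) ^ θ) ^ N.factorization p := by
    intro p hp
    have hp0 : (0 : ℝ) < p := by exact_mod_cast hp.pos
    have hsplit : p ^ N.factorization p * (N / p ^ N.factorization p) = N :=
      Nat.ordProj_mul_ordCompl_eq_self N p
    have hcop : ∀ j, (p ^ j).Coprime (N / p ^ N.factorization p) := fun j ↦
      (Nat.coprime_ordCompl hp hN0).pow_left j
    have hmul := ha.2 (hcop (N.factorization p))
    rw [hsplit] at hmul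
    have hlog : Complex.log (p : ℂ) ≠ 0 := by
      rw [← Complex.natCast_log, Complex.ofReal_ne_zero]
      exact (Real.log_pos (by exact_mod_cast hp.one_lt)).ne'
    have hlogpow : ∀ j : ℕ, Complex.log ((p ^ j : ℕ) : ℂ) = j * Complex.log p := fun j ↦ by
      rw [← Complex.natCast_log, ← Complex.natCast_log, Nat.cast_pow, Real.log_pow]; push_cast; rfl
    refine norm_le_pow_of_log_coeff (c := fun j ↦ a (p ^ j)) (β := fun j ↦ b (p ^ j)) (C := C)
      (Real.rpow_pos_of_pos hp0 _) (by simpa using ha.1) (fun j ↦ ?_) (fun j hj ↦ ?_)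
      (fun h0 ↦ hN (by rw [hmul, h0, zero_mul])) fun i ↦ ?_
    · have h1 := h (p ^ (j + 1)) (pow_ne_zero _ hp.ne_zero)
      rw [Nat.sum_divisors_prime_pow hp, Finset.sum_range_succ'] at h1
      simp only [hlogpow, pow_zero, Nat.cast_one, Complex.log_one, zero_mul, add_zero] at h1
      rw [Finset.Nat.sum_antidiagonal_eq_sum_range_succ
        (fun x y ↦ ((x : ℂ) + 1) * b (p ^ (x + 1)) * a (p ^ y)) j]
      refine mul_left_cancel₀ hlog ?_
      rw [Finset.mul_sum]
      push_cast at h1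
      rw [← mul_assoc, mul_comm (Complex.log p), h1]
      refine Finset.sum_congr rfl fun x hx ↦ ?_
      rw [Nat.pow_div (by have := Finset.mem_range.1 hx; omega) hp.pos, Nat.add_sub_add_right]
      ring
    · have h2 := ha.2 (hcop j)
      rw [hmax _ ?_] at h2
      · refine (mul_eq_zero.1 h2.symm).resolve_right fun h0 ↦ hN ?_
        rw [hmul, h0, mul_zero]
      · calc N = p ^ N.factorization p * (N / p ^ N.factorization p) := hsplit.symm
          _ < p ^ j * (N / p ^ N.factorization p) :=
            Nat.mul_lt_mul_of_pos_right (Nat.pow_lt_pow_right hp.one_lt hj)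
              (Nat.ordCompl_pos p hN0)
    · refine (hbC _ (pow_ne_zero _ hp.ne_zero)).trans_eq ?_
      rw [Nat.cast_pow, ← Real.rpow_natCast, ← Real.rpow_natCast, ← Real.rpow_mul hp0.le,
        ← Real.rpow_mul hp0.le, mul_comm θ]
  rw [ha.multiplicative_factorization a hN0, Finsupp.prod, norm_prod]
  calc _ ≤ ∏ p ∈ N.factorization.support, ((p : ℝ) ^ θ) ^ N.factorization p :=
        Finset.prod_le_prod (fun _ _ ↦ norm_nonneg _) fun p hp ↦
          hloc p (Nat.prime_of_mem_primeFactors (by simpa using hp))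
    _ = ∏ p ∈ N.factorization.support, ((p : ℝ) ^ N.factorization p) ^ θ := by
        refine Finset.prod_congr rfl fun p _ ↦ ?_
        rw [← Real.rpow_natCast, ← Real.rpow_natCast, ← Real.rpow_mul (by positivity),
          ← Real.rpow_mul (by positivity), mul_comm]
    _ = (∏ p ∈ N.factorization.support, ((p : ℝ) ^ N.factorization p)) ^ θ :=
        Real.finsetProd_rpow _ _ (fun _ _ ↦ by positivity) _
    _ = (N : ℝ) ^ θ := by
        congr 1
        conv_rhs => rw [← Nat.prod_factorization_pow_eq_self hN0]
        simp [Finsupp.prod]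

/-- The leading behaviour of a Dirichlet polynomial far to the left. -/
lemma tendsto_dirichletPolynomial {a : ℕ → ℂ} {N : ℕ} (hN : N ≠ 0) :
    Tendsto (fun σ : ℝ ↦ ‖∑ n ∈ Finset.range (N + 1),
      LSeries.term a (-σ + (1 : ℝ) * I) n‖ * (N : ℝ) ^ (-σ)) atTop (nhds ‖a N‖) := by
  have hNC : (N : ℂ) ≠ 0 := by exact_mod_cast hN
  have hN0 : (0 : ℝ) < N := by positivity
  have h1 : ∀ n ∈ Finset.range N, Tendsto (fun σ : ℝ ↦
      LSeries.term a (-σ + (1 : ℝ) * I) n * (N : ℂ) ^ (-σ + (1 : ℝ) * I : ℂ)) atTop (nhds 0) := by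
    intro n hn
    have hnN : (n : ℝ) < N := by exact_mod_cast Finset.mem_range.1 hn
    rcases eq_or_ne n 0 with rfl | hn0
    · simp
    have hn0' : (0 : ℝ) < n := by positivity
    rw [tendsto_zero_iff_norm_tendsto_zero]
    have h2 : ∀ σ : ℝ, ‖LSeries.term a (-σ + (1 : ℝ) * I) n *
        (N : ℂ) ^ (-σ + (1 : ℝ) * I : ℂ)‖ = ‖a n‖ * ((n : ℝ) / N) ^ σ := by
      intro σ
      have e : (-(σ : ℂ) + (1 : ℝ) * I).re = -σ := by simp
      rw [norm_mul, LSeries.norm_term_eq, if_neg hn0, ← Complex.ofReal_natCast N,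
        Complex.norm_cpow_eq_rpow_re_of_pos hN0, e, Real.rpow_neg hn0'.le, Real.rpow_neg hN0.le,
        Real.div_rpow hn0'.le hN0.le]
      field_simp
    simp only [h2]
    have := (tendsto_rpow_atTop_of_base_lt_one ((n : ℝ) / N)
      (by have : (0:ℝ) < n / N := by positivity
          linarith) ((div_lt_one hN0).2 hnN)).const_mul ‖a n‖
    simpa using this
  have h3 := (tendsto_finsetSum _ h1).add_const (a N)
  have h4 := h3.norm
  simp only [Finset.sum_const_zero, zero_add] at h4
  refine h4.congr fun σ ↦ ?_
  have e : (-(σ : ℂ) + (1 : ℝ) * I).re = -σ := by simp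
  have e2 : ‖(N : ℂ) ^ (-σ + (1 : ℝ) * I : ℂ)‖ = (N : ℝ) ^ (-σ) := by
    rw [← Complex.ofReal_natCast N, Complex.norm_cpow_eq_rpow_re_of_pos hN0, e]
  rw [← e2, ← norm_mul, Finset.sum_range_succ, add_mul, ← Finset.sum_mul,
    LSeries.term_of_ne_zero hN, div_mul_cancel₀]
  rw [Ne, Complex.cpow_eq_zero_iff]; simp [hN]

namespace IsSelberg

variable {a : ArithmeticFunction ℂ} {F : ℂ → ℂ}

/-- Elements of degree zero are Dirichlet polynomials. -/
lemma coeff_eq_zero_of_degree_zero (hF : IsSelberg a F) {ε : ℂ} {Q : ℝ} {w : Fin 0 → ℝ}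
    {μ : Fin 0 → ℂ} (h : HasFunctionalEquation ε Q w μ F) {n : ℕ} (hn : Q ^ 2 < n) : a n = 0 := by
  have hQ := h.2.1
  have hn0' : (0 : ℝ) < n := lt_of_le_of_lt (by positivity) hn
  have hn0 : n ≠ 0 := fun h0 ↦ by simp [h0] at hn0'
  obtain ⟨C, hC, hup⟩ := hF.exists_norm_le (σ := 2) (by norm_num)
  -- Without gamma factors F is bounded on Re s = -A, so T → ∞ kills the error terms of the
  -- coefficient bound and leaves n^(-A) Q^(1+2A) C. Letting A → ∞ afterwards gives 0 for n > Q².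
  have hA : ∀ A : ℝ, 1 ≤ A → ‖a n‖ ≤ Q * C * (Q ^ 2 / n) ^ A := by
    intro A hA
    have hleft : ∀ t : ℝ, t ≠ 0 → ‖F (-A + t * I)‖ ≤ Q ^ (1 + 2 * A) * C := by
      intro t ht
      have := h.norm_eq A ht (fun i ↦ i.elim0)
      simp only [Finset.univ_eq_empty, Finset.prod_empty, mul_one] at this
      rw [this]
      gcongr
      exact hup _ (by simp; linarith)
    obtain ⟨C', hC', hcoeff⟩ := hF.exists_norm_coeff_le (A := A) (T₀ := 1)
      (K := Q ^ (1 + 2 * A) * C) (by linarith) (fun t ht ↦ by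
        have ht0 : t ≠ 0 := fun h0 ↦ by simp [h0] at ht; linarith
        refine (hleft t ht0).trans (le_mul_of_one_le_right (by positivity) ?_)
        exact Real.one_le_rpow ht (by norm_num))
    have hlim : Tendsto (fun T : ℝ ↦ C' * (n ^ 4 * T ^ (-1 : ℝ) + n ^ 3 * T ^ (-(1 / 2) : ℝ)) +
        (n : ℝ) ^ (-A) * (Q ^ (1 + 2 * A) * C)) atTop
        (nhds (C' * (n ^ 4 * 0 + n ^ 3 * 0) + (n : ℝ) ^ (-A) * (Q ^ (1 + 2 * A) * C))) :=
      (((tendsto_rpow_neg_atTop one_pos).const_mul _).add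
        ((tendsto_rpow_neg_atTop (by norm_num)).const_mul _)).const_mul _ |>.add_const _
    have hle : ‖a n‖ ≤ _ := ge_of_tendsto hlim (by
      filter_upwards [eventually_ge_atTop 1] with T hT
      have hT0 : 0 < T := by linarith
      have h1 := hcoeff n hn0 T hT (Q ^ (1 + 2 * A) * C) (fun t ht _ ↦ hleft t (by linarith))
      refine le_of_mul_le_mul_right (h1.trans_eq ?_) hT0
      have e1 : T ^ (-1 : ℝ) * T = 1 := by
        rw [Real.rpow_neg_one, inv_mul_cancel₀ hT0.ne']
      have e2 : T ^ (-(1 / 2) : ℝ) * T = T ^ (1 / 2 : ℝ) := by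
        rw [← Real.rpow_add_one hT0.ne']; norm_num
      rw [← e2]
      linear_combination -(C' * n ^ 4) * e1)
    refine hle.trans_eq ?_
    rw [Real.rpow_add hQ, Real.rpow_one, Real.rpow_mul hQ.le, Real.rpow_two,
      Real.div_rpow (by positivity) hn0'.le, Real.rpow_neg hn0'.le]
    ring
  have hlim : Tendsto (fun A : ℝ ↦ Q * C * (Q ^ 2 / n) ^ A) atTop (nhds (Q * C * 0)) := by
    refine (tendsto_rpow_atTop_of_base_lt_one _ ?_ ((div_lt_one hn0').2 hn)).const_mul _
    have : 0 < Q ^ 2 / (n : ℝ) := by positivity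
    linarith
  rw [mul_zero] at hlim
  have := ge_of_tendsto hlim ((eventually_ge_atTop 1).mono hA)
  exact norm_le_zero_iff.1 this

/-- The only element of degree zero is `1`. -/
lemma eq_one_of_degree_zero (hF : IsSelberg a F) {ε : ℂ} {Q : ℝ} {w : Fin 0 → ℝ}
    {μ : Fin 0 → ℂ} (h : HasFunctionalEquation ε Q w μ F) : a = 1 := by
  have hQ := h.2.1
  obtain ⟨M, hM⟩ := exists_nat_gt (Q ^ 2)
  have hzero : ∀ n, M ≤ n → a n = 0 := fun n hn ↦ hF.coeff_eq_zero_of_degree_zero h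
    (hM.trans_le (by exact_mod_cast hn))
  have ha1 : a 1 = 1 := hF.euler_product.1
  obtain ⟨N, hN, hmax⟩ : ∃ N, a N ≠ 0 ∧ ∀ n, N < n → a n = 0 := by
    classical
    have hex : ∃ n ≤ M, a n ≠ 0 := by
      refine ⟨1, ?_, by simp [ha1]⟩
      by_contra! h0
      exact one_ne_zero (ha1.symm.trans (hzero 1 h0.le))
    obtain ⟨n₀, hn₀, hn₀'⟩ := hex
    refine ⟨Nat.findGreatest (fun n ↦ a n ≠ 0) M,
      Nat.findGreatest_spec (P := fun n ↦ a n ≠ 0) hn₀ hn₀', fun n hn ↦ ?_⟩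
    rcases le_or_gt n M with h1 | h1
    · by_contra h2
      exact Nat.findGreatest_is_greatest hn h1 h2
    · exact hzero n h1.le
  have hN0 : N ≠ 0 := fun h0 ↦ hN (by simp [h0])
  have hN0' : (0 : ℝ) < N := by positivity
  have hFsum : ∀ s : ℂ, s ≠ 1 →
      F s = ∑ n ∈ Finset.range (N + 1), LSeries.term (fun n ↦ a n) s n := by
    intro s hs
    have hterm : ∀ s : ℂ, ∀ n ∉ Finset.range (N + 1), LSeries.term (fun n ↦ a n) s n = 0 := by
      intro s n hn
      rw [LSeries.term_def₀ (by simp), hmax n (by simpa using hn), zero_mul]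
    rw [hF.eq_LSeries_of_abscissa (x := s.re - 1)
      (fun z _ ↦ summable_of_ne_finset_zero (hterm z)) (by linarith) hs, LSeries,
      tsum_eq_sum (hterm s)]
  have hlim1 := tendsto_dirichletPolynomial (a := fun n ↦ a n) hN0
  have hlim2 : Tendsto (fun σ : ℝ ↦ ‖F (1 + σ + (1 : ℝ) * I)‖) atTop (nhds 1) := by
    have h1 : Tendsto (fun σ : ℝ ↦ F (1 + σ + (1 : ℝ) * I)) atTop
        (nhds (∑ n ∈ Finset.range (N + 1), if n = 1 then (1 : ℂ) else 0)) := by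
      have : ∀ σ : ℝ, F (1 + σ + (1 : ℝ) * I) = ∑ n ∈ Finset.range (N + 1),
          LSeries.term (fun n ↦ a n) (1 + σ + (1 : ℝ) * I) n := fun σ ↦ hFsum _ fun h0 ↦ by
        have := congrArg Complex.im h0; simp at this
      simp only [this]
      refine tendsto_finsetSum _ fun n _ ↦ ?_
      rcases eq_or_ne n 0 with rfl | hn0
      · simp
      split_ifs with hn1
      · subst hn1
        simp [LSeries.term_of_ne_zero, ha1]
      · rw [tendsto_zero_iff_norm_tendsto_zero]
        have hn2 : 1 < (n : ℝ) := by exact_mod_cast (by omega : 1 < n)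
        have e : ∀ σ : ℝ, (1 + (σ : ℂ) + (1 : ℝ) * I).re = σ + 1 := fun σ ↦ by simp; ring
        simp only [LSeries.norm_term_eq, if_neg hn0, e]
        refine Tendsto.div_atTop tendsto_const_nhds ?_
        exact (tendsto_rpow_atTop_of_base_gt_one _ hn2).comp
          (tendsto_atTop_add_const_right _ _ tendsto_id)
    rw [Finset.sum_ite_eq' , if_pos (Finset.mem_range.2 (by omega))] at h1
    simpa using h1.norm
  -- The functional equation on Im s = 1, normalized by N^(-σ): as σ → ∞ the right side tends to
  -- |a_N| and the value of F on the left tends to modulus 1.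
  have hfe : ∀ σ : ℝ, Q * (Q ^ 2 / N) ^ σ * ‖F (1 + σ + (1 : ℝ) * I)‖ =
      ‖∑ n ∈ Finset.range (N + 1),
        LSeries.term (fun n ↦ a n) (-σ + (1 : ℝ) * I) n‖ * (N : ℝ) ^ (-σ) := by
    intro σ
    have h1 := h.norm_eq σ one_ne_zero (fun i ↦ i.elim0)
    simp only [Finset.univ_eq_empty, Finset.prod_empty, mul_one] at h1
    rw [← hFsum _ fun h0 ↦ by have := congrArg Complex.im h0; simp at this, h1,
      Real.rpow_add hQ, Real.rpow_one, Real.rpow_mul hQ.le, Real.rpow_two,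
      Real.div_rpow (by positivity) hN0'.le, Real.rpow_neg hN0'.le]
    ring
  -- An exponential with a finite positive limit has base 1. Hence Q² = N, and the limit then says
  -- |a_N| = Q.
  have hlim3 : Tendsto (fun σ : ℝ ↦ (Q ^ 2 / N) ^ σ) atTop (nhds (‖a N‖ / Q)) := by
    have h1 := (hlim1.congr fun σ ↦ (hfe σ).symm).div (hlim2.const_mul Q) (by simpa using hQ.ne')
    rw [mul_one] at h1
    have hne := hlim2.eventually_ne one_ne_zero
    refine h1.congr' ?_
    filter_upwards [hne] with σ hσ
    simp only [Pi.div_apply]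
    field_simp
  have hr0 : 0 < Q ^ 2 / (N : ℝ) := by positivity
  have hpos : 0 < ‖a N‖ / Q := div_pos (norm_pos_iff.2 hN) hQ
  have hr1 : Q ^ 2 / (N : ℝ) = 1 := by
    rcases lt_trichotomy (Q ^ 2 / (N : ℝ)) 1 with h1 | h1 | h1
    · have := tendsto_rpow_atTop_of_base_lt_one _ (by linarith) h1
      exact absurd (tendsto_nhds_unique hlim3 this) hpos.ne'
    · exact h1
    · exact absurd hlim3 (not_tendsto_nhds_of_tendsto_atTop
        (tendsto_rpow_atTop_of_base_gt_one _ h1) _)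
  have hnorm : ‖a N‖ = Q := by
    rw [hr1] at hlim3
    simp only [Real.one_rpow] at hlim3
    have := tendsto_nhds_unique hlim3 tendsto_const_nhds
    rwa [div_eq_one_iff_eq hQ.ne'] at this
  have hQN : Q = (N : ℝ) ^ (1 / 2 : ℝ) := by
    rw [div_eq_one_iff_eq hN0'.ne'] at hr1
    rw [← hr1, ← Real.sqrt_eq_rpow, Real.sqrt_sq hQ.le]
  -- The Euler product gives |a_N| ≤ N^θ with θ < 1/2, incompatible with |a_N| = N^(1/2) unless N =
  -- 1.
  obtain ⟨b, θ, C, hC, hθ, hpp, hbC, -, hrel⟩ := hF.exists_log_coeff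
  have hle := norm_top_coeff_le (isMultiplicative_of_log_coeff ha1 hpp hrel) hbC hrel hN hmax
  rw [hnorm, hQN] at hle
  have hN1 : N = 1 := by
    by_contra hN1
    have : 1 < (N : ℝ) := by exact_mod_cast (by omega : 1 < N)
    exact absurd hle (not_le.2 (Real.rpow_lt_rpow_of_exponent_lt this hθ))
  ext n
  rcases eq_or_ne n 0 with rfl | hn0
  · simp
  rcases eq_or_ne n 1 with rfl | hn1
  · simp [ha1]
  · rw [hmax n (by omega), ArithmeticFunction.one_apply_ne hn1]

/-- A nontrivial element has degree bounded below. -/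
lemma sum_ge_of_ne_one (hF : IsSelberg a F) (ha : a ≠ 1) {k : ℕ} {ε : ℂ} {Q : ℝ}
    {w : Fin k → ℝ} {μ : Fin k → ℂ} (h : HasFunctionalEquation ε Q w μ F) :
    1 / 76 ≤ ∑ i, w i := by
  rcases Nat.eq_zero_or_pos k with rfl | hk
  · exact absurd (hF.eq_one_of_degree_zero h) ha
  · exact hF.sum_ge_of_hasFunctionalEquation h hk.ne'

end IsSelberg

/-! ### Factorization into primitive elements -/

noncomputable section

/-- A meromorphic continuation of an element of the Selberg class. -/
def selbergFunction (f : ArithmeticFunction ℂ) : ℂ → ℂ :=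
  open Classical in if h : f ∈ SelbergClass then h.choose else 0

end

lemma isSelberg_selbergFunction {f : ArithmeticFunction ℂ} (h : f ∈ SelbergClass) :
    IsSelberg f (selbergFunction f) := by
  rw [selbergFunction, dif_pos h]
  exact h.choose_spec

lemma LSeriesHasSum_list_prod {L : List (ArithmeticFunction ℂ)} (hL : ∀ f ∈ L, f ∈ SelbergClass)
    {s : ℂ} (hs : 1 < s.re) :
    LSeriesHasSum (fun n ↦ L.prod n) s (L.map fun f ↦ selbergFunction f s).prod := by
  induction L with
  | nil =>
    simp only [List.prod_nil, List.map_nil]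
    have h := hasSum_single (f := LSeries.term (fun n ↦ (1 : ArithmeticFunction ℂ) n) s) 1
      fun n hn ↦ ?_
    · simpa [LSeries.term_of_ne_zero, LSeriesHasSum] using h
    rw [LSeries.term_def₀ (by simp), ArithmeticFunction.one_apply_ne hn, zero_mul]
  | cons f L ih =>
    simp only [List.prod_cons, List.map_cons]
    exact ArithmeticFunction.LSeriesHasSum_mul
      ((isSelberg_selbergFunction (hL f (by simp))).dirichlet_series s hs)
      (ih fun g hg ↦ hL g (by simp [hg]))

lemma differentiableAt_list_prod {L : List (ArithmeticFunction ℂ)}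
    (hL : ∀ f ∈ L, f ∈ SelbergClass) {s : ℂ} (hs : s ≠ 1) :
    DifferentiableAt ℂ (fun s ↦ (L.map fun f ↦ selbergFunction f s).prod) s := by
  induction L with
  | nil => simp
  | cons f L ih =>
    simp only [List.map_cons, List.prod_cons]
    exact ((isSelberg_selbergFunction (hL f (by simp))).differentiableAt hs).mul
      (ih fun g hg ↦ hL g (by simp [hg]))

/-- The continuation of a product is the product of the continuations. -/
lemma IsSelberg.eq_list_prod {L : List (ArithmeticFunction ℂ)} (hL : ∀ f ∈ L, f ∈ SelbergClass)
    {F : ℂ → ℂ} (hF : IsSelberg L.prod F) {s : ℂ} (hs : s ≠ 1) :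
    F s = (L.map fun f ↦ selbergFunction f s).prod :=
  eq_of_eq_on_one_lt_re (fun _ ↦ hF.differentiableAt) (fun _ ↦ differentiableAt_list_prod hL)
    (fun z hz ↦ (hF.dirichlet_series z hz).unique (LSeriesHasSum_list_prod hL hz)) hs

/-- Growth exponents add up under products. On Re s = -1 a single nontrivial factor has lower
exponent 3 ∑ w_i ≥ 3/76. -/
lemma exists_le_norm_list_prod {L : List (ArithmeticFunction ℂ)}
    (hL : ∀ f ∈ L, f ∈ SelbergClass ∧ f ≠ 1) :
    ∃ K > 0, ∀ᶠ t : ℝ in atTop, K * t ^ ((3 / 76 : ℝ) * L.length) ≤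
      ‖(L.map fun f ↦ selbergFunction f (-(1 : ℝ) + t * I)).prod‖ := by
  induction L with
  | nil => exact ⟨1, one_pos, by simp⟩
  | cons f L ih =>
    obtain ⟨K, hK, h⟩ := ih fun g hg ↦ hL g (by simp [hg])
    obtain ⟨hf, hf1⟩ := hL f (by simp)
    have hF := isSelberg_selbergFunction hf
    obtain ⟨k, ε, Q, w, μ, hfe⟩ := hF.functional_equation
    have hfe' : HasFunctionalEquation ε Q w μ (selbergFunction f) := hfe
    obtain ⟨c, hc, hlow⟩ := hF.exists_le_norm (σ := 1 + 1) (by norm_num)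
    obtain ⟨K', hK', h'⟩ := hfe'.exists_le_norm one_pos hc hlow
    have hD := hF.sum_ge_of_ne_one hf1 hfe'
    refine ⟨K' * K, mul_pos hK' hK, ?_⟩
    filter_upwards [h, h', eventually_ge_atTop 1] with t h1 h2 ht
    have ht0 : 0 < t := by linarith
    rw [List.map_cons, List.prod_cons, norm_mul]
    have h3 : t ^ (3 / 76 : ℝ) ≤ t ^ ((1 + 2 * 1) * ∑ i, w i) :=
      Real.rpow_le_rpow_of_exponent_le ht (by linarith)
    have e : t ^ ((3 / 76 : ℝ) * ((f :: L).length : ℕ)) =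
        t ^ (3 / 76 : ℝ) * t ^ ((3 / 76 : ℝ) * L.length) := by
      rw [← Real.rpow_add ht0, List.length_cons]; push_cast; ring_nf
    rw [e]
    calc K' * K * (t ^ (3 / 76 : ℝ) * t ^ ((3 / 76 : ℝ) * L.length)) =
          (K' * t ^ (3 / 76 : ℝ)) * (K * t ^ ((3 / 76 : ℝ) * L.length)) := by ring
      _ ≤ (K' * t ^ ((1 + 2 * 1) * ∑ i, w i)) *
          (K * t ^ ((3 / 76 : ℝ) * L.length)) := by gcongr
      _ ≤ _ := by gcongr

/-- The number of nontrivial factors of an element of the Selberg class is bounded. -/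
lemma exists_length_le {a : ArithmeticFunction ℂ} (ha : a ∈ SelbergClass) :
    ∃ R : ℕ, ∀ L : List (ArithmeticFunction ℂ), (∀ f ∈ L, f ∈ SelbergClass ∧ f ≠ 1) →
      L.prod = a → L.length ≤ R := by
  obtain ⟨F, hF⟩ := ha
  obtain ⟨k, ε, Q, w, μ, hfe⟩ := hF.functional_equation
  have hfe' : HasFunctionalEquation ε Q w μ F := hfe
  obtain ⟨C, hC, hup⟩ := hF.exists_norm_le (σ := 1 + 1) (by norm_num)
  obtain ⟨K', hK', T, hT, h'⟩ := hfe'.exists_norm_le one_pos hC hup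
  set E := 2 * (1 + 2 * 1) * ∑ i, w i
  -- The upper growth exponent E of the whole product, divided by the least exponent of one factor.
  obtain ⟨R, hR⟩ := exists_nat_ge (E / (3 / 76))
  refine ⟨R, fun L hL hLa ↦ ?_⟩
  by_contra! hlt
  have hLR : E < 3 / 76 * (L.length : ℝ) := by
    rw [div_le_iff₀ (by norm_num)] at hR
    have : (R : ℝ) < L.length := by exact_mod_cast hlt
    linarith
  obtain ⟨K, hK, h⟩ := exists_le_norm_list_prod hL
  subst hLa
  have htend : Tendsto (fun t : ℝ ↦ K * t ^ (3 / 76 * (L.length : ℝ) - E)) atTop atTop :=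
    (tendsto_rpow_atTop (by linarith)).const_mul_atTop hK
  obtain ⟨t, ⟨ht, htT⟩, ht2⟩ := ((h.and (eventually_ge_atTop T)).and
    (htend.eventually_gt_atTop K')).exists
  have ht0 : 0 < t := by linarith
  have h1 := h' t (htT.trans (le_abs_self t))
  have h2 : (-((1 : ℝ) : ℂ) + t * I) ≠ 1 := fun h0 ↦ by
    have : t = 0 := by simpa using congrArg Complex.im h0
    linarith
  rw [hF.eq_list_prod (fun f hf ↦ (hL f hf).1) h2, abs_of_pos ht0] at h1
  have h3 := ht.trans h1
  rw [Real.rpow_sub ht0, mul_div_assoc', lt_div_iff₀ (Real.rpow_pos_of_pos ht0 _)] at ht2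
  linarith

/-- Factorization into primitive elements. -/
lemma exists_list_primitive {a : ArithmeticFunction ℂ} (ha : a ∈ SelbergClass) :
    ∃ L : List (ArithmeticFunction ℂ), (∀ f ∈ L, IsPrimitiveSelberg f) ∧ L.prod = a := by
  obtain ⟨R, hR⟩ := exists_length_le ha
  -- In a factorization of maximal length, splitting a factor nontrivially would produce a longer
  -- one, so all factors are primitive.
  set S : Set ℕ := {n | ∃ L : List (ArithmeticFunction ℂ),
    (∀ f ∈ L, f ∈ SelbergClass ∧ f ≠ 1) ∧ L.prod = a ∧ L.length = n} with hS
  have hne : S.Nonempty := by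
    by_cases h1 : a = 1
    · exact ⟨0, [], by simp, by simp [h1], rfl⟩
    · exact ⟨1, [a], by simpa using ⟨ha, h1⟩, by simp, rfl⟩
  have hbdd : BddAbove S := ⟨R, by rintro n ⟨L, h1, h2, rfl⟩; exact hR L h1 h2⟩
  obtain ⟨L, h1, h2, h3⟩ := Nat.sSup_mem hne hbdd
  refine ⟨L, fun f hf ↦ ⟨(h1 f hf).1, (h1 f hf).2, fun b hb c hc hbc ↦ ?_⟩, h2⟩
  by_contra! hne1
  obtain ⟨l₁, l₂, rfl⟩ := List.append_of_mem hf
  have hmem : l₁.length + l₂.length + 2 ∈ S := by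
    refine ⟨l₁ ++ b :: c :: l₂, fun g hg ↦ ?_, ?_, by simp; omega⟩
    · simp only [List.mem_append, List.mem_cons] at hg
      rcases hg with hg | rfl | rfl | hg
      · exact h1 g (by simp [hg])
      · exact ⟨hb, hne1.1⟩
      · exact ⟨hc, hne1.2⟩
      · exact h1 g (by simp [hg])
    · rw [← h2, hbc]
      simp [mul_assoc]
  have := le_csSup hbdd hmem
  rw [← h3] at this
  simp at this
  omega

/-! ### Pairings over primes and the index criterion for primitivity -/

/-- `∑_{p ≤ x} f p * conj (g p) / p = n log log x + O(1)`. -/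
def HasPairing (f g : ArithmeticFunction ℂ) (n : ℕ) : Prop :=
  (fun x : ℝ ↦ primeSum (fun p ↦ f p * conj (g p) / p) x
    - (((n : ℝ) * Real.log (Real.log x) : ℝ) : ℂ)) =O[atTop] (fun _ ↦ (1 : ℝ))

lemma primeSum_congr {f g : ℕ → ℂ} (h : ∀ p : ℕ, p.Prime → f p = g p) (x : ℝ) :
    primeSum f x = primeSum g x :=
  Finset.sum_congr rfl fun p hp ↦ h p (Finset.mem_filter.1 hp).2

lemma hasSelbergIndex_iff {f : ArithmeticFunction ℂ} {n : ℕ} :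
    HasSelbergIndex f n ↔ HasPairing f f n := by
  have : ∀ x, primeSum (fun p ↦ ((‖f p‖ ^ 2 / p : ℝ) : ℂ)) x =
      primeSum (fun p ↦ f p * conj (f p) / p) x := fun x ↦ primeSum_congr (fun p _ ↦ by
        rw [Complex.mul_conj, Complex.normSq_eq_norm_sq]; push_cast; rfl) x
  simp only [HasSelbergIndex, HasPairing, this, Int.cast_natCast]

lemma hasPairing_of_primitive (horth : SelbergOrthonormalityConjecture)
    {f g : ArithmeticFunction ℂ} (hf : IsPrimitiveSelberg f) (hg : IsPrimitiveSelberg g) :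
    HasPairing f g (open Classical in if f = g then 1 else 0) := by
  classical
  split_ifs with h
  · subst h
    exact hasSelbergIndex_iff.1 (by simpa using horth.1 f hf)
  · simpa [HasPairing] using horth.2 f g hf hg h

/-- The hypothesis concerns only the products f(p) conj(g(p)), so the same lemma serves additivity
in either argument. -/
lemma HasPairing.add {f₁ f₂ f g₁ g₂ g : ArithmeticFunction ℂ} {n₁ n₂ : ℕ}
    (h₁ : HasPairing f₁ g₁ n₁) (h₂ : HasPairing f₂ g₂ n₂)
    (h : ∀ p : ℕ, p.Prime → f p * conj (g p) = f₁ p * conj (g₁ p) + f₂ p * conj (g₂ p)) :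
    HasPairing f g (n₁ + n₂) := by
  refine (IsBigO.add h₁ h₂).congr_left fun x ↦ ?_
  have : primeSum (fun p ↦ f p * conj (g p) / p) x =
      primeSum (fun p ↦ f₁ p * conj (g₁ p) / p) x +
        primeSum (fun p ↦ f₂ p * conj (g₂ p) / p) x := by
    rw [primeSum, primeSum, primeSum, ← Finset.sum_add_distrib]
    refine Finset.sum_congr rfl fun p hp ↦ ?_
    rw [h p (Finset.mem_filter.1 hp).2, add_div]
  rw [this]; push_cast; ring

lemma hasPairing_zero {f g : ArithmeticFunction ℂ}
    (h : ∀ p : ℕ, p.Prime → f p * conj (g p) = 0) : HasPairing f g 0 := by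
  have : ∀ x, primeSum (fun p ↦ f p * conj (g p) / p) x = 0 := fun x ↦
    Finset.sum_eq_zero fun p hp ↦ by rw [h p (Finset.mem_filter.1 hp).2, zero_div]
  simp only [HasPairing, this]
  exact (isBigO_zero (E' := ℂ) (fun _ : ℝ ↦ (1 : ℝ)) atTop).congr_left fun x ↦ by simp

lemma one_apply_prime {p : ℕ} (hp : p.Prime) : (1 : ArithmeticFunction ℂ) p = 0 :=
  ArithmeticFunction.one_apply_ne hp.one_lt.ne'

/-- A prime has only the divisors 1 and p, so convolution becomes addition there; this makes the
pairing biadditive. -/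
lemma mul_apply_prime {f g : ArithmeticFunction ℂ} (hf : f 1 = 1) (hg : g 1 = 1) {p : ℕ}
    (hp : p.Prime) : (f * g) p = f p + g p := by
  rw [ArithmeticFunction.mul_apply, Nat.sum_divisorsAntidiagonal (f := fun i j ↦ f i * g j),
    hp.sum_divisors, Nat.div_self hp.pos, Nat.div_one, hf, hg]
  ring

lemma apply_one_of_mem {f : ArithmeticFunction ℂ} (hf : f ∈ SelbergClass) : f 1 = 1 := by
  obtain ⟨F, hF⟩ := hf
  exact hF.euler_product.1

lemma list_prod_apply_one {L : List (ArithmeticFunction ℂ)} (hL : ∀ f ∈ L, f ∈ SelbergClass) :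
    L.prod 1 = 1 := by
  induction L with
  | nil => simp
  | cons f L ih =>
    rw [List.prod_cons, ArithmeticFunction.mul_apply_one, apply_one_of_mem (hL f (by simp)),
      ih fun g hg ↦ hL g (by simp [hg]), one_mul]

lemma hasPairing_list_left (horth : SelbergOrthonormalityConjecture)
    {L : List (ArithmeticFunction ℂ)} (hL : ∀ f ∈ L, IsPrimitiveSelberg f)
    {g : ArithmeticFunction ℂ} (hg : IsPrimitiveSelberg g) :
    HasPairing L.prod g (open Classical in L.count g) := by
  classical
  induction L with
  | nil => exact hasPairing_zero fun p hp ↦ by rw [List.prod_nil, one_apply_prime hp, zero_mul]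
  | cons f L ih =>
    rw [List.prod_cons, List.count_cons]
    have h1 := hasPairing_of_primitive horth (hL f (by simp)) hg
    have h2 := ih fun k hk ↦ hL k (by simp [hk])
    convert h2.add h1 (fun p hp ↦ ?_) using 2
    · simp
    · rw [mul_apply_prime (apply_one_of_mem (hL f (by simp)).1)
        (list_prod_apply_one fun k hk ↦ (hL k (by simp [hk])).1) hp]
      ring

/-- For M = L the value is the sum of the squared multiplicities of the distinct factors. -/
lemma hasPairing_list_right (horth : SelbergOrthonormalityConjecture)
    {L M : List (ArithmeticFunction ℂ)} (hL : ∀ f ∈ L, IsPrimitiveSelberg f)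
    (hM : ∀ f ∈ M, IsPrimitiveSelberg f) :
    HasPairing L.prod M.prod (open Classical in (M.map fun g ↦ L.count g).sum) := by
  classical
  induction M with
  | nil =>
    exact hasPairing_zero fun p hp ↦ by
      rw [List.prod_nil, one_apply_prime hp, map_zero, mul_zero]
  | cons g M ih =>
    rw [List.prod_cons, List.map_cons, List.sum_cons]
    refine (hasPairing_list_left horth hL (hM g (by simp))).add
      (ih fun k hk ↦ hM k (by simp [hk])) fun p hp ↦ ?_
    rw [mul_apply_prime (apply_one_of_mem (hM g (by simp)).1)
        (list_prod_apply_one fun k hk ↦ (hM k (by simp [hk])).1) hp, map_add]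
    ring

lemma tendsto_log_log : Tendsto (fun x : ℝ ↦ Real.log (Real.log x)) atTop atTop :=
  Real.tendsto_log_atTop.comp Real.tendsto_log_atTop

lemma HasPairing.unique {f g : ArithmeticFunction ℂ} {m n : ℕ} (hm : HasPairing f g m)
    (hn : HasPairing f g n) : m = n := by
  have h := (IsBigO.sub hn hm).congr_left (f₂ := fun x ↦
    ((((m : ℝ) - n) * Real.log (Real.log x) : ℝ) : ℂ)) fun x ↦ by push_cast; ring
  by_contra hne
  have hmn : ((m : ℝ) - n) ≠ 0 := sub_ne_zero.2 (by exact_mod_cast hne)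
  obtain ⟨C, hC⟩ := h.bound
  have ht := (tendsto_log_log.const_mul_atTop (abs_pos.2 hmn)).eventually_gt_atTop (|C|)
  obtain ⟨x, hx, hx'⟩ := (hC.and ht).exists
  rw [Complex.norm_real, Real.norm_eq_abs, abs_mul, norm_one, mul_one] at hx
  have h1 : |(m : ℝ) - n| * Real.log (Real.log x) ≤ |(m : ℝ) - n| * |Real.log (Real.log x)| := by
    gcongr; exact le_abs_self _
  linarith [le_abs_self C]

/-- A nontrivial element of index at most one is primitive. -/
lemma isPrimitiveSelberg_of_hasSelbergIndex (horth : SelbergOrthonormalityConjecture)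
    {a : ArithmeticFunction ℂ} (ha : a ∈ SelbergClass) (ha1 : a ≠ 1)
    (h : ∀ n : ℕ, HasPairing a a n → n ≤ 1) : IsPrimitiveSelberg a := by
  classical
  obtain ⟨L, hL, rfl⟩ := exists_list_primitive ha
  have h1 := h _ (hasPairing_list_right horth hL hL)
  -- Each entry of L occurs at least once in L, so the index dominates the number of factors, and
  -- index at most 1 leaves at most one factor.
  have h2 : L.length ≤ (L.map fun g ↦ L.count g).sum := by
    have : (L.map fun _ ↦ 1).sum ≤ (L.map fun g ↦ L.count g).sum :=
      List.sum_le_sum fun g hg ↦ List.one_le_count_iff.2 hg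
    simpa using this
  match L, hL, ha1, h2.trans h1 with
  | [], _, ha1, _ => exact absurd (by simp) ha1
  | [f], hL, _, _ => simpa using hL f (by simp)
  | _ :: _ :: _, _, _, h => simp at h

/-! ### Bounded prime sums exclude a zero or pole at s = 1 -/

/-- The integers in question are p^(k+2). The term at p^(k+2) is at most p^(2(θ-1)) · 2^((θ-1)k),
and the sum over p converges because 2(θ - 1) < -1, which is the condition θ < 1/2. -/
lemma summable_primePow_not_prime {θ : ℝ} (hθ : θ < 1 / 2) :
    Summable fun n : ℕ ↦ open Classical in
      if IsPrimePow n ∧ ¬ n.Prime then (n : ℝ) ^ (θ - 1) else 0 := by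
  classical
  set g : Nat.Primes × ℕ → ℕ := fun x ↦ (x.1 : ℕ) ^ (x.2 + 2) with hg
  have hinj : Function.Injective g := by
    have h1 : g = fun x : Nat.Primes × ℕ ↦
        ((Nat.Primes.prodNatEquiv (x.1, x.2 + 1) : {n // IsPrimePow n}) : ℕ) := by
      ext x; simp [hg]
    rw [h1]
    intro x y hxy
    have := Nat.Primes.prodNatEquiv.injective (Subtype.val_injective hxy)
    simp only [Prod.mk.injEq, add_left_inj] at this
    exact Prod.ext this.1 this.2
  refine (hinj.summable_iff fun n hn ↦ ?_).1 ?_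
  · refine if_neg fun ⟨hpp, hnp⟩ ↦ hn ?_
    obtain ⟨p, k, hp, hk, rfl⟩ := (isPrimePow_nat_iff n).1 hpp
    rcases Nat.exists_eq_add_of_lt hk with ⟨j, rfl⟩
    rcases j with _ | j
    · exact absurd (by simpa using hp) hnp
    · exact ⟨(⟨p, hp⟩, j), by simp only [hg]; congr 1; omega⟩
  · have h1 : Summable fun p : Nat.Primes ↦ (p : ℝ) ^ (2 * (θ - 1)) :=
      Nat.Primes.summable_rpow.2 (by linarith)
    have h2 : Summable fun k : ℕ ↦ ((2 : ℝ) ^ (θ - 1)) ^ k :=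
      summable_geometric_of_lt_one (by positivity)
        (Real.rpow_lt_one_of_one_lt_of_neg (by norm_num) (by linarith))
    refine (h1.mul_of_nonneg h2 (fun _ ↦ by positivity) fun _ ↦ by positivity).of_nonneg_of_le
      (fun x ↦ ?_) fun x ↦ ?_
    · simp only [Function.comp]; split_ifs <;> positivity
    · simp only [Function.comp]
      have hp0 : (0 : ℝ) < (x.1 : ℕ) := by exact_mod_cast x.1.2.pos
      have hp2 : (2 : ℝ) ≤ (x.1 : ℕ) := by exact_mod_cast x.1.2.two_le
      split_ifs
      · have e : ((g x : ℕ) : ℝ) ^ (θ - 1) =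
            ((x.1 : ℕ) : ℝ) ^ (2 * (θ - 1)) * (((x.1 : ℕ) : ℝ) ^ (θ - 1)) ^ x.2 := by
          simp only [hg]
          rw [Nat.cast_pow, ← Real.rpow_natCast, ← Real.rpow_mul hp0.le, ← Real.rpow_natCast,
            ← Real.rpow_mul hp0.le, ← Real.rpow_add hp0]
          congr 1; push_cast; ring
        rw [e]
        gcongr ?_ * ?_ ^ _
        exact Real.rpow_le_rpow_of_nonpos two_pos hp2 (by linarith)
      · positivity

/-- The restriction of a sequence to the primes. -/
def primePart (a : ℕ → ℂ) (n : ℕ) : ℂ := if n.Prime then a n else 0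

namespace IsSelberg

variable {a : ArithmeticFunction ℂ} {F : ℂ → ℂ}

/-- On the real axis, `log |F|` is the sum over the primes up to a bounded error. -/
lemma exists_abs_log_norm_sub_le (hF : IsSelberg a F) : ∃ C, ∀ σ : ℝ, 1 < σ →
    LSeriesSummable (primePart fun n ↦ a n) σ ∧
    |Real.log ‖F σ‖ - (LSeries (primePart fun n ↦ a n) σ).re| ≤ C := by
  classical
  obtain ⟨b, θ, C, hC, hθ, hpp, hbC, hb, hrel⟩ := hF.exists_log_coeff
  -- The part of log F on higher prime powers converges absolutely at s = 1; on primes, b_p = a_p.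
  set r : ℕ → ℂ := fun n ↦ if n.Prime then 0 else b n with hr
  have hr1 : LSeriesSummable r 1 := by
    refine ((summable_primePow_not_prime hθ).mul_left C).of_norm_bounded fun n ↦ ?_
    rcases eq_or_ne n 0 with rfl | hn
    · simp [not_isPrimePow_zero]
    have hn0 : (0 : ℝ) < n := by positivity
    rw [LSeries.norm_term_eq, if_neg hn]
    by_cases hp : n.Prime
    · simp [hr, hp]
    by_cases hq : IsPrimePow n
    · rw [if_pos ⟨hq, hp⟩, one_re, Real.rpow_one, div_le_iff₀ hn0, mul_assoc,
        ← Real.rpow_add_one hn0.ne', sub_add_cancel]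
      simpa [hr, hp] using hbC n hn
    · simp [hr, hp, hpp n hq, hq]
  refine ⟨∑' n, ‖LSeries.term r 1 n‖, fun σ hσ ↦ ?_⟩
  have hσ' : 1 < (σ : ℂ).re := by simpa
  have hrσ : LSeriesSummable r σ := hr1.of_re_le_re (by simpa using hσ.le)
  have hc : (primePart fun n ↦ a n) = b - r := by
    ext n
    by_cases hp : n.Prime
    · simp [primePart, hr, hp, log_coeff_prime hF.euler_product.1 hrel hp]
    · simp [primePart, hr, hp]
  have hbs := (hb σ hσ').1
  refine ⟨hc ▸ hbs.sub hrσ, ?_⟩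
  rw [hc, LSeries_sub hbs hrσ, ← (hb σ hσ').2, Complex.norm_exp, Real.log_exp, sub_re,
    sub_sub_cancel]
  exact (abs_re_le_norm _).trans
    (LSeries.norm_le_tsum_of_re_le hr1 (by simpa using hσ.le))

end IsSelberg

lemma primeSum_natCast_eq (a : ℕ → ℂ) (N : ℕ) :
    primeSum (fun p ↦ a p / p) N = ∑ i ∈ Finset.range N,
      primePart a (i + 1) / ((i + 1 : ℕ) : ℂ) := by
  rw [primeSum, Nat.floor_natCast, Finset.sum_filter]
  have : Finset.Iic N = Finset.range (N + 1) := by ext; simp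
  rw [this, Finset.sum_range_succ']
  simp only [Nat.not_prime_zero, if_false, add_zero]
  refine Finset.sum_congr rfl fun i _ ↦ ?_
  rw [primePart]
  split_ifs <;> simp

/-- Abel's inequality. -/
lemma norm_sum_mul_le_of_antitone {u : ℕ → ℂ} {v : ℕ → ℝ} {M : ℝ} (hv : Antitone v)
    (hv0 : ∀ n, 0 ≤ v n) (hu : ∀ n, ‖∑ i ∈ Finset.range n, u i‖ ≤ M) (n : ℕ) :
    ‖∑ i ∈ Finset.range n, (v i : ℂ) * u i‖ ≤ M * v 0 := by
  have h := Finset.sum_range_by_parts (fun i ↦ (v i : ℂ)) u n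
  simp only [smul_eq_mul] at h
  rw [h]
  calc _ ≤ ‖(v (n - 1) : ℂ) * ∑ i ∈ Finset.range n, u i‖ +
        ∑ i ∈ Finset.range (n - 1), ‖((v (i + 1) : ℂ) - v i) *
          ∑ j ∈ Finset.range (i + 1), u j‖ :=
        (norm_sub_le _ _).trans (by gcongr; exact norm_sum_le _ _)
    _ ≤ v (n - 1) * M + ∑ i ∈ Finset.range (n - 1), (v i - v (i + 1)) * M := by
        gcongr with i
        · rw [norm_mul, Complex.norm_real, Real.norm_of_nonneg (hv0 _)]
          exact mul_le_mul_of_nonneg_left (hu n) (hv0 _)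
        · rw [norm_mul, ← Complex.ofReal_sub, Complex.norm_real, Real.norm_eq_abs, abs_sub_comm,
            abs_of_nonneg (sub_nonneg.2 (hv (Nat.le_succ i)))]
          exact mul_le_mul_of_nonneg_left (hu _) (sub_nonneg.2 (hv (Nat.le_succ i)))
    _ = M * v 0 := by
        rw [← Finset.sum_mul, Finset.sum_range_sub']; ring

/-- Bounded partial sums over primes give a bounded Dirichlet series near `1`. -/
lemma exists_norm_LSeries_primePart_le {a : ℕ → ℂ}
    (h : (fun x : ℝ ↦ primeSum (fun p ↦ a p / p) x) =O[atTop] (fun _ ↦ (1 : ℝ))) :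
    ∃ M, ∀ σ : ℝ, 1 < σ → LSeriesSummable (primePart a) σ → ‖LSeries (primePart a) σ‖ ≤ M := by
  obtain ⟨C, hC⟩ := h.bound
  have hC' := tendsto_natCast_atTop_atTop.eventually hC
  obtain ⟨N₀, hN₀⟩ := eventually_atTop.1 hC'
  set M := |C| + ∑ n ∈ Finset.range N₀, ‖primeSum (fun p ↦ a p / p) n‖ with hM
  have hMn : ∀ n : ℕ, ‖∑ i ∈ Finset.range n, primePart a (i + 1) / ((i + 1 : ℕ) : ℂ)‖ ≤ M := by
    intro n
    rw [← primeSum_natCast_eq]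
    have hs : 0 ≤ ∑ n ∈ Finset.range N₀, ‖primeSum (fun p ↦ a p / p) n‖ :=
      Finset.sum_nonneg fun _ _ ↦ norm_nonneg _
    rcases le_or_gt N₀ n with hn | hn
    · have := hN₀ n hn
      rw [norm_one, mul_one] at this
      linarith [le_abs_self C]
    · have := Finset.single_le_sum (f := fun n : ℕ ↦ ‖primeSum (fun p ↦ a p / p) n‖)
        (fun _ _ ↦ norm_nonneg _) (Finset.mem_range.2 hn)
      linarith [abs_nonneg C]
  refine ⟨M, fun σ hσ hsum ↦ ?_⟩
  -- These weights decrease from v 0 = 1, so Abel's inequality gives the bound M uniformly in σ.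
  set v : ℕ → ℝ := fun i ↦ ((i + 1 : ℕ) : ℝ) ^ (1 - σ) with hv
  have hterm : ∀ i : ℕ, (v i : ℂ) * (primePart a (i + 1) / ((i + 1 : ℕ) : ℂ)) =
      LSeries.term (primePart a) σ (i + 1) := by
    intro i
    have hi : ((i + 1 : ℕ) : ℂ) ≠ 0 := by exact_mod_cast i.succ_ne_zero
    rw [LSeries.term_of_ne_zero i.succ_ne_zero, hv]
    simp only
    rw [Complex.ofReal_cpow (by positivity), Complex.ofReal_natCast, Complex.ofReal_sub,
      Complex.ofReal_one, Complex.cpow_sub _ _ hi, Complex.cpow_one]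
    field_simp
  have hle := norm_sum_mul_le_of_antitone (u := fun i ↦ primePart a (i + 1) / ((i + 1 : ℕ) : ℂ))
    (v := v) (M := M) (fun i j hij ↦ Real.rpow_le_rpow_of_nonpos (by positivity)
      (by exact_mod_cast Nat.succ_le_succ hij) (by linarith)) (fun _ ↦ by positivity) hMn
  have hlim : Tendsto (fun n ↦ ∑ i ∈ Finset.range n, (v i : ℂ) *
      (primePart a (i + 1) / ((i + 1 : ℕ) : ℂ))) atTop (nhds (LSeries (primePart a) σ)) := by
    simp only [hterm]
    have := ((hasSum_nat_add_iff' 1).2 hsum.LSeriesHasSum).tendsto_sum_nat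
    simpa using this
  refine (le_of_tendsto hlim.norm (Eventually.of_forall hle)).trans_eq ?_
  simp [hv]

namespace IsSelberg

variable {a : ArithmeticFunction ℂ} {F : ℂ → ℂ}

/-- If `∑ a p / p` is bounded, `F` has neither a zero nor a pole at `1`. -/
lemma meromorphicOrderAt_one_eq_zero (hF : IsSelberg a F)
    (h : (fun x : ℝ ↦ primeSum (fun p ↦ a p / p) x) =O[atTop] (fun _ ↦ (1 : ℝ))) :
    meromorphicOrderAt F 1 = 0 := by
  obtain ⟨C, hC⟩ := hF.exists_abs_log_norm_sub_le
  obtain ⟨M, hM⟩ := exists_norm_LSeries_primePart_le h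
  have hne : ∀ σ : ℝ, 1 < σ → 0 < ‖F σ‖ := fun σ hσ ↦ by
    obtain ⟨c, hc, hlow⟩ := hF.exists_le_norm hσ
    exact hc.trans_le (hlow σ (by simp))
  -- A zero at 1 would send log |F(σ)| to -∞ as σ → 1+, a pole to +∞.
  have hlog : ∀ σ : ℝ, 1 < σ → |Real.log ‖F σ‖| ≤ C + M := fun σ hσ ↦ by
    obtain ⟨h1, h2⟩ := hC σ hσ
    have h3 := (abs_re_le_norm _).trans (hM σ hσ h1)
    have h4 := abs_add_le (Real.log ‖F σ‖ - (LSeries (primePart fun n ↦ a n) σ).re)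
      (LSeries (primePart fun n ↦ a n) σ).re
    rw [sub_add_cancel] at h4
    linarith
  have hmer := hF.meromorphicAt 1
  have htend : Tendsto (fun σ : ℝ ↦ (σ : ℂ)) (nhdsWithin 1 (Set.Ioi 1)) (nhdsWithin 1 {1}ᶜ) := by
    refine tendsto_nhdsWithin_iff.2 ⟨?_, ?_⟩
    · have : Tendsto (fun σ : ℝ ↦ (σ : ℂ)) (nhds 1) (nhds ((1 : ℝ) : ℂ)) :=
        continuous_ofReal.continuousAt
      rw [ofReal_one] at this
      exact this.mono_left nhdsWithin_le_nhds
    · filter_upwards [self_mem_nhdsWithin] with σ hσ h0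
      have : σ = 1 := by exact_mod_cast (show (σ : ℂ) = 1 from h0)
      exact absurd this (ne_of_gt hσ)
  refine le_antisymm ?_ ?_
  · by_contra! hpos
    have h1 := ((tendsto_zero_iff_meromorphicOrderAt_pos hmer).2 hpos).comp htend
    have h2 := h1.norm
    rw [norm_zero] at h2
    have h3 := ge_of_tendsto h2 (b := Real.exp (-(C + M))) (by
      filter_upwards [self_mem_nhdsWithin] with σ hσ
      have := neg_le_of_abs_le (hlog σ hσ)
      rwa [Real.le_log_iff_exp_le (hne σ hσ)] at this)
    exact absurd h3 (not_le.2 (Real.exp_pos _))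
  · by_contra! hneg
    have h1 := ((tendsto_cobounded_iff_meromorphicOrderAt_neg hmer).2 hneg).comp htend
    have h2 := tendsto_norm_cobounded_atTop.comp h1
    have h3 := h2.eventually_gt_atTop (Real.exp (C + M))
    obtain ⟨σ, hσ1, hσ⟩ := (h3.and self_mem_nhdsWithin).exists
    have := le_of_abs_le (hlog σ hσ)
    rw [Real.log_le_iff_le_exp (hne σ hσ)] at this
    exact absurd hσ1 (not_lt.2 this)

end IsSelberg

/-! ### The Riemann zeta function belongs to the class -/

/-- Raising the degree by one absorbs both the constant K and the shift 1 + r, so exponents K (1 +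
|s|)^n suffice for finite order. -/
lemma exists_mul_one_add_pow_le (K : ℝ) (hK : 0 ≤ K) (n : ℕ) :
    ∃ B, ∀ r : ℝ, 0 ≤ r → K * (1 + r) ^ n ≤ B + r ^ (n + 1) := by
  set R := max 1 (K * 2 ^ n) with hR
  have hR1 : 1 ≤ R := le_max_left _ _
  refine ⟨K * (1 + R) ^ n, fun r hr ↦ ?_⟩
  rcases le_total r R with h | h
  · have : K * (1 + r) ^ n ≤ K * (1 + R) ^ n := by gcongr
    have : 0 ≤ r ^ (n + 1) := by positivity
    linarith
  · have h1 : 1 ≤ r := hR1.trans h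
    have h2 : K * 2 ^ n ≤ r := (le_max_right _ _).trans h
    have h3 : K * (1 + r) ^ n ≤ r ^ (n + 1) := by
      calc K * (1 + r) ^ n ≤ K * (2 * r) ^ n := by gcongr; linarith
        _ = (K * 2 ^ n) * r ^ n := by rw [mul_pow]; ring
        _ ≤ r * r ^ n := by gcongr
        _ = _ := by ring
    have : 0 ≤ K * (1 + R) ^ n := by positivity
    linarith

lemma isEntireOfFiniteOrder_of_norm_le {E : ℂ → ℂ} (hE : Differentiable ℂ E) {C K : ℝ}
    (hK : 0 ≤ K) {n : ℕ} (h : ∀ s, ‖E s‖ ≤ C * Real.exp (K * (1 + ‖s‖) ^ n)) :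
    IsEntireOfFiniteOrder E := by
  obtain ⟨B, hB⟩ := exists_mul_one_add_pow_le K hK n
  refine ⟨hE, |C| * Real.exp B, ((n + 1 : ℕ) : ℝ), fun s ↦ (h s).trans ?_⟩
  rw [Real.rpow_natCast, mul_assoc, ← Real.exp_add]
  gcongr
  · exact le_abs_self C
  · exact hB _ (norm_nonneg s)

/-- `Λ₀` is a Mellin transform converging absolutely everywhere, and t^(Re s - 1) ≤ t^(a-1) +
t^(b-1) throughout the strip. -/
lemma WeakFEPair.exists_norm_Λ₀_le (P : WeakFEPair ℂ) (a b : ℝ) :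
    ∃ C, ∀ s : ℂ, a ≤ s.re → s.re ≤ b → ‖P.Λ₀ s‖ ≤ C := by
  have hconv : ∀ s : ℂ, MellinConvergent P.f_modif s := fun s ↦
    (P.isStrongFEPair_toStrongFEPair.hasMellin s).1
  refine ⟨∫ t in Set.Ioi (0 : ℝ), (‖(t : ℂ) ^ ((a : ℂ) - 1) • P.f_modif t‖ +
    ‖(t : ℂ) ^ ((b : ℂ) - 1) • P.f_modif t‖), fun s ha hb ↦ ?_⟩
  rw [WeakFEPair.Λ₀, mellin]
  refine MeasureTheory.norm_integral_le_of_norm_le ((hconv a).norm.add (hconv b).norm) ?_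
  filter_upwards [MeasureTheory.ae_restrict_mem measurableSet_Ioi] with t ht
  have ht0 : (0 : ℝ) < t := ht
  rw [norm_smul, norm_smul, norm_smul, ← add_mul]
  gcongr
  rw [Complex.norm_cpow_eq_rpow_re_of_pos ht0, Complex.norm_cpow_eq_rpow_re_of_pos ht0,
    Complex.norm_cpow_eq_rpow_re_of_pos ht0]
  simp only [sub_re, ofReal_re, one_re]
  rcases le_total t 1 with h1 | h1
  · have := Real.rpow_le_rpow_of_exponent_ge ht0 h1 (show a - 1 ≤ s.re - 1 by linarith)
    have := Real.rpow_pos_of_pos ht0 (b - 1)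
    linarith
  · have := Real.rpow_le_rpow_of_exponent_le h1 (show s.re - 1 ≤ b - 1 by linarith)
    have := Real.rpow_pos_of_pos ht0 (a - 1)
    linarith

lemma exists_norm_completedRiemannZeta₀_le (a b : ℝ) :
    ∃ C, ∀ s : ℂ, a ≤ s.re → s.re ≤ b → ‖completedRiemannZeta₀ s‖ ≤ C := by
  obtain ⟨C, hC⟩ := (HurwitzZeta.hurwitzEvenFEPair 0).exists_norm_Λ₀_le (a / 2) (b / 2)
  refine ⟨C / 2, fun s ha hb ↦ ?_⟩
  rw [completedRiemannZeta₀, HurwitzZeta.completedHurwitzZetaEven₀, norm_div]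
  have h2 : (s / 2).re = s.re / 2 := by simp
  have := hC (s / 2) (by rw [h2]; linarith) (by rw [h2]; linarith)
  rw [show ‖(2 : ℂ)‖ = 2 by simp]
  linarith

lemma norm_sin_le_exp (z : ℂ) : ‖Complex.sin z‖ ≤ Real.exp ‖z‖ := by
  rw [Complex.sin, norm_div, norm_mul, norm_I, mul_one, Complex.norm_two, div_le_iff₀ two_pos]
  refine (norm_sub_le _ _).trans ?_
  have h : ∀ w : ℂ, ‖Complex.exp w‖ ≤ Real.exp ‖w‖ := fun w ↦ Complex.norm_exp_le_exp_norm w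
  have h1 := h (-z * I)
  have h2 := h (z * I)
  simp only [norm_mul, norm_neg, norm_I, mul_one] at h1 h2
  linarith

/-- The inverse Gamma function, by the reflection formula. -/
lemma inv_Gamma_eq (z : ℂ) :
    (Complex.Gamma z)⁻¹ = Complex.Gamma (1 - z) * Complex.sin (Real.pi * z) / Real.pi ∨
      Complex.sin (Real.pi * z) = 0 := by
  by_cases h : Complex.sin (Real.pi * z) = 0
  · exact Or.inr h
  left
  have h1 := Complex.Gamma_mul_Gamma_one_sub z
  have hpi : (Real.pi : ℂ) ≠ 0 := by exact_mod_cast Real.pi_ne_zero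
  have h2 : Complex.Gamma z ≠ 0 := fun h0 ↦ by
    rw [h0, zero_mul] at h1
    exact div_ne_zero hpi h h1.symm
  rw [eq_div_iff hpi, inv_mul_eq_iff_eq_mul₀ h2, ← mul_assoc, h1, div_mul_cancel₀ _ h]

lemma Gamma_le_exp {x : ℝ} (hx : 1 / 2 ≤ x) : Real.Gamma x ≤ 2 * Real.exp (x ^ 2) := by
  have hx0 : 0 < x := by linarith
  have h1 := Gamma_add_le (X := 1) (c := x) one_pos hx0.le
  rw [Real.Gamma_one, mul_one, add_comm 1 x, Real.Gamma_add_one hx0.ne'] at h1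
  have h2 : (x + 1) ^ x ≤ Real.exp (x ^ 2) := by
    calc (x + 1) ^ x ≤ (Real.exp x) ^ x := by gcongr; exact Real.add_one_le_exp x
      _ = _ := by rw [← Real.exp_mul, sq]
  have h3 : 0 ≤ Real.Gamma x := (Real.Gamma_pos_of_pos hx0).le
  nlinarith

lemma norm_Gamma_le_Gamma_re {z : ℂ} (hz : 0 < z.re) :
    ‖Complex.Gamma z‖ ≤ Real.Gamma z.re := by
  rw [Complex.Gamma_eq_integral hz, Real.Gamma_eq_integral hz, Complex.GammaIntegral]
  refine MeasureTheory.norm_integral_le_of_norm_le (Real.GammaIntegral_convergent hz) ?_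
  filter_upwards [MeasureTheory.ae_restrict_mem measurableSet_Ioi] with t ht
  have ht0 : (0 : ℝ) < t := ht
  rw [norm_mul, Complex.norm_cpow_eq_rpow_re_of_pos ht0, Complex.norm_real,
    Real.norm_of_nonneg (Real.exp_pos _).le]
  simp

lemma norm_inv_Gamma_le_of_re_le {z : ℂ} (hz : z.re ≤ 1 / 2) (hs : Complex.sin (Real.pi * z) ≠ 0) :
    ‖(Complex.Gamma z)⁻¹‖ ≤ Real.exp (10 * (1 + ‖z‖) ^ 2) := by
  rw [(inv_Gamma_eq z).resolve_right hs, norm_div, norm_mul, Complex.norm_real,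
    Real.norm_of_nonneg Real.pi_pos.le, div_le_iff₀ Real.pi_pos]
  have hre : (1 - z).re = 1 - z.re := by simp
  have h1 : ‖Complex.Gamma (1 - z)‖ ≤ 2 * Real.exp ((1 + ‖z‖) ^ 2) := by
    refine (norm_Gamma_le_Gamma_re (by rw [hre]; linarith)).trans
      ((Gamma_le_exp (by rw [hre]; linarith)).trans ?_)
    rw [hre]
    have := neg_le_of_abs_le (abs_re_le_norm z)
    gcongr ?_ * Real.exp (?_ ^ 2)
    · linarith
    · linarith
  have h2 : ‖Complex.sin (Real.pi * z)‖ ≤ Real.exp (4 * (1 + ‖z‖) ^ 2) := by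
    refine (norm_sin_le_exp _).trans (Real.exp_le_exp.2 ?_)
    rw [norm_mul, Complex.norm_real, Real.norm_of_nonneg Real.pi_pos.le]
    nlinarith [norm_nonneg z, Real.pi_lt_four]
  calc _ ≤ (2 * Real.exp ((1 + ‖z‖) ^ 2)) * Real.exp (4 * (1 + ‖z‖) ^ 2) := by gcongr
    _ = 2 * Real.exp (5 * (1 + ‖z‖) ^ 2) := by rw [mul_assoc, ← Real.exp_add]; ring_nf
    _ ≤ Real.exp (10 * (1 + ‖z‖) ^ 2) * Real.pi := by
      rw [mul_comm]
      have : 0 ≤ (1 + ‖z‖) ^ 2 := by positivity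
      gcongr
      · linarith
      · linarith [Real.pi_gt_three]

lemma exists_norm_inv_Gamma_le_strip : ∃ C > 0, ∀ z : ℂ, 1 / 2 ≤ z.re → z.re ≤ 2 →
    ‖(Complex.Gamma z)⁻¹‖ ≤ C * Real.exp (10 * (1 + ‖z‖) ^ 2) := by
  have hcont : ContinuousOn (fun x : ℝ ↦ (Real.Gamma x)⁻¹) (Set.Icc (1 / 2) 2) := by
    intro x hx
    have hx0 : 0 < x := by linarith [hx.1]
    refine ContinuousAt.continuousWithinAt (ContinuousAt.inv₀ ?_ (Real.Gamma_pos_of_pos hx0).ne')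
    exact (Real.differentiableAt_Gamma fun m h ↦ by
      have : (0 : ℝ) ≤ m := m.cast_nonneg
      linarith).continuousAt
  obtain ⟨C, hC⟩ := isCompact_Icc.exists_bound_of_continuousOn hcont
  refine ⟨Real.Gamma (1 / 2) * (|C| + 1) * Real.exp 40, by
    have := Real.Gamma_pos_of_pos (show (0 : ℝ) < 1 / 2 by norm_num); positivity,
    fun z hz hz' ↦ ?_⟩
  set u : ℂ := ((1 / 2 : ℝ) : ℂ) + z.im * I with hu
  have hure : u.re = 1 / 2 := by simp [hu]
  have h1 := norm_Gamma_add_ge (z := u) (c := z.re - 1 / 2) (by rw [hure]; norm_num) (by linarith)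
  have e1 : u + ((z.re - 1 / 2 : ℝ) : ℂ) = z := by
    apply Complex.ext <;> simp [hu]
  rw [e1, hure, add_sub_cancel] at h1
  have hGx : 0 < Real.Gamma z.re := Real.Gamma_pos_of_pos (by linarith)
  have hGu : 0 < ‖Complex.Gamma u‖ := norm_pos_iff.2
    (Complex.Gamma_ne_zero_of_re_pos (by rw [hure]; norm_num))
  have hGz : 0 < ‖Complex.Gamma z‖ := norm_pos_iff.2
    (Complex.Gamma_ne_zero_of_re_pos (by linarith))
  have hxC : (Real.Gamma z.re)⁻¹ ≤ |C| + 1 := by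
    have := hC z.re ⟨hz, hz'⟩
    linarith [le_abs_self C, le_abs_self (Real.Gamma z.re)⁻¹, (Real.norm_eq_abs (Real.Gamma z.re)⁻¹).symm.le]
  have hun : ‖u‖ ≤ 1 + ‖z‖ := by
    refine (norm_add_le _ _).trans ?_
    rw [Complex.norm_real, norm_mul, norm_I, mul_one, Complex.norm_real]
    have := abs_im_le_norm z
    rw [← Real.norm_eq_abs] at this
    have : ‖(1 / 2 : ℝ)‖ ≤ 1 := by norm_num
    linarith
  have hsin : Complex.sin (Real.pi * u) ≠ 0 := by
    intro h0
    have h2 := Complex.Gamma_mul_Gamma_one_sub u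
    rw [h0, div_zero] at h2
    rcases mul_eq_zero.1 h2 with h3 | h3
    · rw [h3, norm_zero] at hGu; exact lt_irrefl _ hGu
    · exact Complex.Gamma_ne_zero_of_re_pos (s := 1 - u) (by
        rw [sub_re, hure]; norm_num) h3
  have h2 : ‖Complex.Gamma u‖⁻¹ ^ 2 ≤ Real.exp (4 * (2 + ‖z‖)) := by
    have h3 := Complex.Gamma_mul_Gamma_one_sub u
    have h4 : 1 - u = conj u := by
      apply Complex.ext <;> simp [hu]; norm_num
    rw [h4, Complex.Gamma_conj] at h3
    have h5 := congrArg norm h3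
    rw [norm_mul, RCLike.norm_conj, norm_div, Complex.norm_real,
      Real.norm_of_nonneg Real.pi_pos.le] at h5
    rw [inv_pow, sq, h5, inv_div]
    have h6 := norm_sin_le_exp (Real.pi * u)
    rw [norm_mul, Complex.norm_real, Real.norm_of_nonneg Real.pi_pos.le] at h6
    calc _ ≤ ‖Complex.sin (Real.pi * u)‖ := div_le_self (norm_nonneg _)
            (by linarith [Real.pi_gt_three])
      _ ≤ _ := h6.trans (Real.exp_le_exp.2 (by
          nlinarith [Real.pi_lt_four, Real.pi_pos, norm_nonneg z, norm_nonneg u]))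
  have h3 : ‖Complex.Gamma u‖⁻¹ ≤ Real.exp (2 * (2 + ‖z‖)) := by
    refine abs_le_of_sq_le_sq' (h2.trans_eq ?_) (Real.exp_pos _).le |>.2
    rw [← Real.exp_nat_mul]; ring_nf
  rw [norm_inv]
  have hG12 := Real.Gamma_pos_of_pos (show (0 : ℝ) < 1 / 2 by norm_num)
  calc ‖Complex.Gamma z‖⁻¹ ≤ ‖Complex.Gamma u‖⁻¹ * (Real.Gamma z.re)⁻¹ * Real.Gamma (1 / 2) := by
        rw [← mul_inv, inv_mul_eq_div, inv_eq_one_div, div_le_div_iff₀ hGz (mul_pos hGu hGx)]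
        linarith
    _ ≤ Real.exp (2 * (2 + ‖z‖)) * (|C| + 1) * Real.Gamma (1 / 2) := by gcongr
    _ = Real.Gamma (1 / 2) * (|C| + 1) * Real.exp (2 * (2 + ‖z‖)) := by ring
    _ ≤ Real.Gamma (1 / 2) * (|C| + 1) * Real.exp (40 + 10 * (1 + ‖z‖) ^ 2) := by
        gcongr; nlinarith [norm_nonneg z]
    _ = _ := by rw [Real.exp_add]; ring

/-- The entire function `(s - 1) ζ(s)`. -/
noncomputable def zetaEntire (s : ℂ) : ℂ :=
  (s * (s - 1) * completedRiemannZeta₀ s + 1) * ((Real.pi : ℂ) ^ (s / 2) / 2) *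
    (Complex.Gamma (s / 2 + 1))⁻¹

lemma differentiable_zetaEntire : Differentiable ℂ zetaEntire := by
  have hpi : (Real.pi : ℂ) ≠ 0 := by exact_mod_cast Real.pi_ne_zero
  have h1 : Differentiable ℂ fun s : ℂ ↦ (Complex.Gamma (s / 2 + 1))⁻¹ :=
    Complex.differentiable_one_div_Gamma.comp (by fun_prop)
  have h2 := differentiable_completedZeta₀
  have h3 : Differentiable ℂ fun s : ℂ ↦ (Real.pi : ℂ) ^ (s / 2) := fun s ↦
    DifferentiableAt.const_cpow (by fun_prop) (Or.inl hpi)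
  have h4 : Differentiable ℂ fun s : ℂ ↦ s * (s - 1) * completedRiemannZeta₀ s + 1 := by fun_prop
  exact (h4.mul (h3.div_const 2)).mul h1

lemma zetaEntire_eq {s : ℂ} (hs : s ≠ 1) : (s - 1) * riemannZeta s = zetaEntire s := by
  have hs' : 1 - s ≠ 0 := sub_ne_zero.2 hs.symm
  have hpi : (Real.pi : ℂ) ≠ 0 := by exact_mod_cast Real.pi_ne_zero
  rw [riemannZeta_eq_mul_completedRiemannZeta₀, zetaEntire, neg_div, Complex.cpow_neg]
  have hp : (Real.pi : ℂ) ^ (s / 2) ≠ 0 := by simp [Complex.cpow_eq_zero_iff, hpi]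
  rw [div_eq_mul_inv, mul_inv, mul_inv, inv_inv]
  have e : (s - 1) * (s * completedRiemannZeta₀ s - 1 - s / (1 - s)) =
      s * (s - 1) * completedRiemannZeta₀ s + 1 := by
    field_simp; ring
  rw [← e]; ring

/-- The reflection formula is unavailable where sin πz = 0. There z is a nonpositive integer, and
the conventional value Γ(z) = 0 makes the left side 0. -/
lemma norm_inv_Gamma_le {z : ℂ} (hz : z.re ≤ 1 / 2) :
    ‖(Complex.Gamma z)⁻¹‖ ≤ Real.exp (10 * (1 + ‖z‖) ^ 2) := by
  by_cases hs : Complex.sin (Real.pi * z) = 0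
  · obtain ⟨k, hk⟩ := Complex.sin_eq_zero_iff.1 hs
    have hpi : (Real.pi : ℂ) ≠ 0 := by exact_mod_cast Real.pi_ne_zero
    have hzk : z = k := by
      rw [mul_comm] at hk
      exact mul_right_cancel₀ hpi hk
    have hk0 : k ≤ 0 := by
      rw [hzk, intCast_re] at hz
      by_contra! h
      have : (1 : ℝ) ≤ k := by exact_mod_cast h
      linarith
    obtain ⟨n, hn⟩ := Int.exists_eq_neg_ofNat hk0
    have : z = -(n : ℂ) := by rw [hzk, hn]; push_cast; rfl
    rw [this, Complex.Gamma_neg_nat_eq_zero, inv_zero, norm_zero]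
    exact (Real.exp_pos _).le
  · exact norm_inv_Gamma_le_of_re_le hz hs

lemma riemannZeta_norm_le : ∃ C > 0, ∀ s : ℂ, 2 ≤ s.re → ‖riemannZeta s‖ ≤ C := by
  refine ⟨1 + ∑' n, ‖LSeries.term 1 2 n‖, by positivity, fun s hs ↦ ?_⟩
  rw [← (LSeriesHasSum_one (by linarith)).LSeries_eq]
  have := LSeries.norm_le_tsum_of_re_le (f := 1) (s₀ := 2) (s := s)
    (LSeriesHasSum_one (by simp)).LSeriesSummable (by simpa)
  linarith

lemma exists_norm_zetaEntire_le_right : ∃ C > 0, ∀ s : ℂ, 2 ≤ s.re →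
    ‖zetaEntire s‖ ≤ C * Real.exp ((1 + ‖s‖) ^ 2) := by
  obtain ⟨C, hC, h⟩ := riemannZeta_norm_le
  refine ⟨C, hC, fun s hs ↦ ?_⟩
  have hs1 : s ≠ 1 := fun h0 ↦ by rw [h0] at hs; norm_num at hs
  rw [← zetaEntire_eq hs1, norm_mul, mul_comm]
  have h1 : ‖s - 1‖ ≤ 1 + ‖s‖ := by
    have := norm_sub_le s 1; rw [norm_one] at this; linarith
  have h2 : 1 + ‖s‖ ≤ Real.exp ((1 + ‖s‖) ^ 2) := by
    have := Real.add_one_le_exp ((1 + ‖s‖) ^ 2)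
    nlinarith [norm_nonneg s]
  have := h s hs
  gcongr
  linarith

lemma norm_half_add_one_le (s : ℂ) : (1 + ‖s / 2 + 1‖) ^ 2 ≤ 4 * (1 + ‖s‖) ^ 2 := by
  have : ‖s / 2 + 1‖ ≤ ‖s‖ / 2 + 1 := by
    refine (norm_add_le _ _).trans ?_
    rw [norm_div, norm_one, Complex.norm_two]
  have h : 1 + ‖s / 2 + 1‖ ≤ 2 * (1 + ‖s‖) := by linarith [norm_nonneg s]
  calc (1 + ‖s / 2 + 1‖) ^ 2 ≤ (2 * (1 + ‖s‖)) ^ 2 := by gcongr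
    _ = _ := by ring

lemma norm_pi_cpow (s : ℂ) : ‖(Real.pi : ℂ) ^ s‖ = Real.pi ^ s.re :=
  Complex.norm_cpow_eq_rpow_re_of_pos Real.pi_pos s

lemma exists_norm_zetaEntire_le_strip : ∃ C > 0, ∀ s : ℂ, -1 ≤ s.re → s.re ≤ 2 →
    ‖zetaEntire s‖ ≤ C * Real.exp (41 * (1 + ‖s‖) ^ 2) := by
  obtain ⟨M, hM⟩ := exists_norm_completedRiemannZeta₀_le (-1) 2
  obtain ⟨C, hC, hG⟩ := exists_norm_inv_Gamma_le_strip
  refine ⟨(|M| + 1) * 2 * C, by positivity, fun s hs hs' ↦ ?_⟩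
  have hre : (s / 2 + 1).re = s.re / 2 + 1 := by simp
  have h1 : ‖(Complex.Gamma (s / 2 + 1))⁻¹‖ ≤ C * Real.exp (40 * (1 + ‖s‖) ^ 2) := by
    refine (hG _ (by rw [hre]; linarith) (by rw [hre]; linarith)).trans ?_
    gcongr C * Real.exp ?_
    linarith [norm_half_add_one_le s]
  have h2 : ‖(Real.pi : ℂ) ^ (s / 2) / 2‖ ≤ 2 := by
    have e : (s / 2).re = s.re / 2 := by simp
    rw [norm_div, norm_pi_cpow, Complex.norm_two, e, div_le_iff₀ two_pos]
    calc Real.pi ^ (s.re / 2) ≤ Real.pi ^ (1 : ℝ) := by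
          apply Real.rpow_le_rpow_of_exponent_le <;> linarith [Real.pi_gt_three]
      _ ≤ _ := by rw [Real.rpow_one]; linarith [Real.pi_lt_four]
  have h3 : ‖s * (s - 1) * completedRiemannZeta₀ s + 1‖ ≤
      (|M| + 1) * Real.exp ((1 + ‖s‖) ^ 2) := by
    have h4 : ‖s - 1‖ ≤ 1 + ‖s‖ := by
      have := norm_sub_le s 1; rw [norm_one] at this; linarith
    have h5 : ‖completedRiemannZeta₀ s‖ ≤ |M| := (hM s hs hs').trans (le_abs_self M)
    have h6 := norm_nonneg s
    calc _ ≤ ‖s‖ * ‖s - 1‖ * ‖completedRiemannZeta₀ s‖ + 1 := by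
          refine (norm_add_le _ _).trans ?_
          rw [norm_mul, norm_mul, norm_one]
      _ ≤ (1 + ‖s‖) * (1 + ‖s‖) * |M| + (1 + ‖s‖) * (1 + ‖s‖) := by
          gcongr
          · linarith
          · nlinarith
      _ = (|M| + 1) * (1 + ‖s‖) ^ 2 := by ring
      _ ≤ _ := by gcongr; linarith [Real.add_one_le_exp ((1 + ‖s‖) ^ 2)]
  rw [zetaEntire, norm_mul, norm_mul]
  calc _ ≤ ((|M| + 1) * Real.exp ((1 + ‖s‖) ^ 2)) * 2 *
        (C * Real.exp (40 * (1 + ‖s‖) ^ 2)) := by gcongr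
    _ = (|M| + 1) * 2 * C * (Real.exp ((1 + ‖s‖) ^ 2) * Real.exp (40 * (1 + ‖s‖) ^ 2)) := by ring
    _ = _ := by rw [← Real.exp_add]; ring_nf

/-- The symmetry of the completed zeta function under s ↦ 1 - s transports the bound from Re u ≥ 2,
where u = 1 - s. -/
lemma exists_norm_zetaEntire_le_left : ∃ C > 0, ∀ s : ℂ, s.re ≤ -1 →
    ‖zetaEntire s‖ ≤ C * Real.exp (60 * (1 + ‖s‖) ^ 2) := by
  obtain ⟨C, hC, h⟩ := exists_norm_zetaEntire_le_right
  refine ⟨4 * C, by positivity, fun s hs ↦ ?_⟩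
  have hpi : (Real.pi : ℂ) ≠ 0 := by exact_mod_cast Real.pi_ne_zero
  set u := 1 - s with hu
  have hure : u.re = 1 - s.re := by simp [hu]
  have hun : 1 + ‖u‖ ≤ 2 * (1 + ‖s‖) := by
    have := norm_sub_le 1 s; rw [norm_one, ← hu] at this; linarith [norm_nonneg s]
  have hun2 : (1 + ‖u‖) ^ 2 ≤ 4 * (1 + ‖s‖) ^ 2 := by
    calc (1 + ‖u‖) ^ 2 ≤ (2 * (1 + ‖s‖)) ^ 2 := by gcongr
      _ = _ := by ring
  have hre2 : (u / 2 + 1).re = u.re / 2 + 1 := by simp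
  have hGu : Complex.Gamma (u / 2 + 1) ≠ 0 :=
    Complex.Gamma_ne_zero_of_re_pos (by rw [hre2, hure]; linarith)
  have hxi : s * (s - 1) * completedRiemannZeta₀ s + 1 =
      zetaEntire u * (2 * (Real.pi : ℂ) ^ (-(u / 2)) * Complex.Gamma (u / 2 + 1)) := by
    have hp : (Real.pi : ℂ) ^ (u / 2) ≠ 0 := by simp [Complex.cpow_eq_zero_iff, hpi]
    have hs' : s * (s - 1) = u * (u - 1) := by rw [hu]; ring
    rw [zetaEntire, Complex.cpow_neg, ← completedRiemannZeta₀_one_sub s, ← hu, hs']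
    generalize Complex.Gamma (u / 2 + 1) = G at hGu ⊢
    generalize (Real.pi : ℂ) ^ (u / 2) = P at hp ⊢
    field_simp
  have h1 : ‖(Complex.Gamma (s / 2 + 1))⁻¹‖ ≤ Real.exp (40 * (1 + ‖s‖) ^ 2) := by
    have hre : (s / 2 + 1).re = s.re / 2 + 1 := by simp
    refine (norm_inv_Gamma_le (by rw [hre]; linarith)).trans ?_
    gcongr Real.exp ?_
    linarith [norm_half_add_one_le s]
  have hpow : ∀ z : ℂ, z.re ≤ 0 → ‖(Real.pi : ℂ) ^ z‖ ≤ 1 := fun z hz ↦ by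
    rw [norm_pi_cpow]
    exact Real.rpow_le_one_of_one_le_of_nonpos (by linarith [Real.pi_gt_three]) hz
  have h2 : ‖(Real.pi : ℂ) ^ (s / 2) / 2‖ ≤ 1 := by
    rw [norm_div, Complex.norm_two]
    have := hpow (s / 2) (by simp; linarith)
    linarith
  have h3 : ‖Complex.Gamma (u / 2 + 1)‖ ≤ 2 * Real.exp (16 * (1 + ‖s‖) ^ 2) := by
    refine (norm_Gamma_le_Gamma_re (by rw [hre2, hure]; linarith)).trans
      ((Gamma_le_exp (by rw [hre2, hure]; linarith)).trans ?_)
    gcongr 2 * Real.exp ?_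
    have h5 := norm_half_add_one_le u
    have h6 : (u / 2 + 1).re ≤ 1 + ‖u / 2 + 1‖ := by
      linarith [le_abs_self (u / 2 + 1).re, abs_re_le_norm (u / 2 + 1)]
    have h7 : 0 ≤ (u / 2 + 1).re := by rw [hre2, hure]; linarith
    calc (u / 2 + 1).re ^ 2 ≤ (1 + ‖u / 2 + 1‖) ^ 2 := by gcongr
      _ ≤ _ := by linarith
  have h4 : ‖zetaEntire u‖ ≤ C * Real.exp (4 * (1 + ‖s‖) ^ 2) := by
    refine (h u (by rw [hure]; linarith)).trans ?_
    gcongr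
  have h5 := hpow (-(u / 2)) (by simp; rw [hure]; linarith)
  rw [zetaEntire, hxi, norm_mul, norm_mul, norm_mul, norm_mul, norm_mul, Complex.norm_two]
  calc _ ≤ (C * Real.exp (4 * (1 + ‖s‖) ^ 2)) * (2 * 1 * (2 * Real.exp (16 * (1 + ‖s‖) ^ 2))) * 1 *
        Real.exp (40 * (1 + ‖s‖) ^ 2) := by gcongr
    _ = 4 * C * (Real.exp (4 * (1 + ‖s‖) ^ 2) * Real.exp (16 * (1 + ‖s‖) ^ 2) *
        Real.exp (40 * (1 + ‖s‖) ^ 2)) := by ring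
    _ = _ := by rw [← Real.exp_add, ← Real.exp_add]; ring_nf

lemma isEntireOfFiniteOrder_zetaEntire : IsEntireOfFiniteOrder zetaEntire := by
  obtain ⟨C₁, hC₁, h₁⟩ := exists_norm_zetaEntire_le_left
  obtain ⟨C₂, hC₂, h₂⟩ := exists_norm_zetaEntire_le_strip
  obtain ⟨C₃, hC₃, h₃⟩ := exists_norm_zetaEntire_le_right
  refine isEntireOfFiniteOrder_of_norm_le differentiable_zetaEntire (C := C₁ + C₂ + C₃) (K := 60)
    (by norm_num) (n := 2) fun s ↦ ?_
  have h0 : 0 ≤ (1 + ‖s‖) ^ 2 := by positivity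
  rcases le_total s.re (-1) with h | h
  · exact (h₁ s h).trans (by gcongr; linarith)
  rcases le_total s.re 2 with h' | h'
  · refine (h₂ s h h').trans ?_
    gcongr
    · linarith
    · norm_num
  · refine (h₃ s h').trans ?_
    gcongr
    · linarith
    · linarith

/-- The coefficients of `log ζ`. -/
noncomputable def logZetaCoeff (n : ℕ) : ℂ := ((ArithmeticFunction.vonMangoldt n / Real.log n : ℝ) : ℂ)

lemma norm_logZetaCoeff_le (n : ℕ) : ‖logZetaCoeff n‖ ≤ 1 := by
  have h0 : 0 ≤ Real.log n := Real.log_natCast_nonneg n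
  rw [logZetaCoeff, Complex.norm_real, Real.norm_of_nonneg
    (div_nonneg ArithmeticFunction.vonMangoldt_nonneg h0)]
  exact div_le_one_of_le₀ ArithmeticFunction.vonMangoldt_le_log h0

lemma summable_logZetaCoeff {s : ℂ} (hs : 1 < s.re) : LSeriesSummable logZetaCoeff s :=
  LSeriesSummable_of_bounded_of_one_lt_re (fun n _ ↦ norm_logZetaCoeff_le n) hs

/-- With B the series of Λ(n) / log n, one has B' = ζ'/ζ on Re s > 1. So ζ exp(-B) is constant
there, and it tends to 1 along the real axis. -/
lemma exp_LSeries_logZetaCoeff {s : ℂ} (hs : 1 < s.re) :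
    Complex.exp (LSeries logZetaCoeff s) = riemannZeta s := by
  have habs : LSeries.abscissaOfAbsConv logZetaCoeff ≤ 1 :=
    LSeries.abscissaOfAbsConv_le_of_forall_lt_LSeriesSummable fun y hy ↦
      summable_logZetaCoeff (by simpa using hy)
  have hlogMul : LSeries.logMul logZetaCoeff = fun n ↦ (ArithmeticFunction.vonMangoldt n : ℂ) := by
    ext n
    rw [LSeries.logMul, logZetaCoeff, ← Complex.natCast_log, ← Complex.ofReal_mul]
    congr 1
    rcases le_or_gt n 1 with h | h
    · interval_cases n <;> simp
    · have : Real.log n ≠ 0 := (Real.log_pos (by exact_mod_cast h)).ne'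
      field_simp
  set H : ℂ → ℂ := fun s ↦ riemannZeta s * Complex.exp (-LSeries logZetaCoeff s) with hH
  have hderiv : ∀ z : ℂ, 1 < z.re → HasDerivAt H 0 z := by
    intro z hz
    have hz1 : z ≠ 1 := fun h0 ↦ by simp [h0] at hz
    have h1 := (differentiableAt_riemannZeta hz1).hasDerivAt
    have h2 := (LSeries_hasDerivAt (f := logZetaCoeff) (s := z)
      (habs.trans_lt (by exact_mod_cast hz))).neg.cexp
    have h3 := h1.mul h2
    rw [hlogMul, neg_neg, ArithmeticFunction.LSeries_vonMangoldt_eq_deriv_riemannZeta_div hz] at h3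
    have hz0 : riemannZeta z ≠ 0 := riemannZeta_ne_zero_of_one_le_re hz.le
    have h4 : deriv riemannZeta z * cexp ((-LSeries logZetaCoeff) z) +
      riemannZeta z * (cexp ((-LSeries logZetaCoeff) z) *
        (-deriv riemannZeta z / riemannZeta z)) = 0 := by
      field_simp
      ring
    rw [h4] at h3
    exact h3
  have hconst : ∀ z : ℂ, 1 < z.re → H z = H s := fun z hz ↦ by
    have ho : IsOpen {z : ℂ | 1 < z.re} := isOpen_lt continuous_const continuous_re
    exact ho.is_const_of_deriv_eq_zero (convex_halfSpace_re_gt 1).isPreconnected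
      (fun w hw ↦ (hderiv w hw).differentiableAt.differentiableWithinAt)
      (fun w hw ↦ (hderiv w hw).deriv) hz hs
  have h1 : (1 : EReal) < ⊤ := by exact_mod_cast EReal.coe_lt_top 1
  have hlim1 := LSeries.tendsto_atTop (habs.trans_lt h1)
  have hlim2 := LSeries.tendsto_atTop (f := 1)
    (LSeries.abscissaOfAbsConv_one.trans_lt h1)
  have hb1 : logZetaCoeff 1 = 0 := by simp [logZetaCoeff]
  have hlim3 : Tendsto (fun x : ℝ ↦ H x) atTop (nhds 1) := by
    have := hlim2.mul ((Complex.continuous_exp.tendsto _).comp hlim1.neg)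
    rw [hb1] at this
    simp only [neg_zero, Complex.exp_zero, mul_one, Pi.one_apply] at this
    refine this.congr' ?_
    filter_upwards [eventually_gt_atTop 1] with x hx
    simp only [hH, Function.comp]
    rw [(LSeriesHasSum_one (s := x) (by simpa)).LSeries_eq]
  have hlim4 : Tendsto (fun x : ℝ ↦ H x) atTop (nhds (H s)) := by
    refine tendsto_const_nhds.congr' ?_
    filter_upwards [eventually_gt_atTop 1] with x hx
    exact (hconst x (by simpa)).symm
  have := tendsto_nhds_unique hlim4 hlim3
  simp only [hH, Complex.exp_neg] at this
  exact (mul_inv_eq_one₀ (Complex.exp_ne_zero _)).1 this |>.symm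

/-- The arithmetic function of the Riemann zeta function, with complex values. -/
noncomputable def zetaCoeff : ArithmeticFunction ℂ := (ArithmeticFunction.zeta : ArithmeticFunction ℂ)

lemma zetaCoeff_apply {n : ℕ} (hn : n ≠ 0) : zetaCoeff n = 1 := by
  simp [zetaCoeff, ArithmeticFunction.natCoe_apply, hn]

/-- The chosen data turn the gamma factor into π^(-s/2) Γ(s/2). The conjugations disappear because ζ
and this factor are real on the real axis. -/
lemma hasFunctionalEquation_riemannZeta :
    HasFunctionalEquation (k := 1) 1 (Real.pi ^ (-(1 / 2) : ℝ)) (fun _ ↦ 1 / 2) (fun _ ↦ 0)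
      riemannZeta := by
  have hpi : (Real.pi : ℂ) ≠ 0 := by exact_mod_cast Real.pi_ne_zero
  have hgamma : ∀ s, gammaFactor (k := 1) 1 (Real.pi ^ (-(1 / 2) : ℝ)) (fun _ ↦ 1 / 2)
      (fun _ ↦ 0) s = Complex.Gammaℝ s := by
    intro s
    have e : ((Real.pi ^ (-(1 / 2) : ℝ) : ℝ) : ℂ) ^ s = (Real.pi : ℂ) ^ (-s / 2) := by
      have h0 : ((Real.pi ^ (-(1 / 2) : ℝ) : ℝ) : ℂ) ≠ 0 := by
        exact_mod_cast (Real.rpow_pos_of_pos Real.pi_pos _).ne'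
      rw [Complex.cpow_def_of_ne_zero h0, Complex.cpow_def_of_ne_zero hpi, ← Complex.ofReal_log
        (Real.rpow_pos_of_pos Real.pi_pos _).le, Real.log_rpow Real.pi_pos,
        ← Complex.ofReal_log Real.pi_pos.le]
      congr 1; push_cast; ring
    rw [gammaFactor, e, Complex.Gammaℝ_def]
    simp only [Finset.univ_unique, Finset.prod_singleton, one_mul, add_zero]
    congr 2; push_cast; ring
  have hconj : ∀ s, conj (Complex.Gammaℝ (conj s)) = Complex.Gammaℝ s := by
    intro s
    rw [← hgamma, ← hgamma, gammaFactor, gammaFactor, map_mul, map_mul, map_one, map_prod]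
    congr 1
    · congr 1
      have h0 : 0 < Real.pi ^ (-(1 / 2) : ℝ) := Real.rpow_pos_of_pos Real.pi_pos _
      rw [Complex.cpow_conj _ _ (by
        rw [Complex.arg_ofReal_of_nonneg h0.le]; exact Real.pi_pos.ne), conj_conj, conj_ofReal]
    · refine Finset.prod_congr rfl fun i _ ↦ ?_
      rw [← Complex.Gamma_conj]
      simp [Complex.conj_ofNat]
  have hne : ∀ s, IsGammaRegular (k := 1) (fun _ ↦ 1 / 2) (fun _ ↦ 0) s → Complex.Gammaℝ s ≠ 0 := by
    intro s hs h0
    obtain ⟨n, hn⟩ := Complex.Gammaℝ_eq_zero_iff.1 h0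
    refine hs 0 n ?_
    rw [hn]; push_cast; ring
  have hcompl : ∀ s, s ≠ 0 → IsGammaRegular (k := 1) (fun _ ↦ 1 / 2) (fun _ ↦ 0) s →
      Complex.Gammaℝ s * riemannZeta s = completedRiemannZeta s := by
    intro s hs hr
    rw [riemannZeta_def_of_ne_zero hs, mul_div_cancel₀ _ (hne s hr)]
  refine ⟨norm_one, Real.rpow_pos_of_pos Real.pi_pos _, fun _ ↦ by norm_num, fun _ ↦ by simp,
    fun s hs0 hs1 hr hr' ↦ ?_⟩
  have h1 : (1 : ℂ) - conj s ≠ 0 := fun h0 ↦ hs1 (by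
    have := congrArg conj (sub_eq_zero.1 h0); simpa using this.symm)
  rw [hgamma, hgamma, hcompl s hs0 hr, hcompl _ h1 hr', completedRiemannZeta_one_sub]
  have hr2 : IsGammaRegular (k := 1) (fun _ ↦ 1 / 2) (fun _ ↦ 0) (conj s) := fun i n hn ↦ by
    refine hr i n ?_
    have := congrArg conj hn
    simpa [Complex.conj_ofNat] using this
  have hs2 : conj s ≠ 0 := by simpa using hs0
  rw [← hcompl _ hs2 hr2, map_mul, hconj, riemannZeta_conj, conj_conj, hcompl s hs0 hr]

lemma isSelberg_riemannZeta : IsSelberg zetaCoeff riemannZeta where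
  dirichlet_series s hs := by
    refine (LSeriesHasSum_congr (f := 1) s _ fun {n} hn ↦ ?_).1 (LSeriesHasSum_one hs)
    rw [zetaCoeff_apply hn]; rfl
  analyticity := ⟨1, zetaEntire, isEntireOfFiniteOrder_zetaEntire, fun s hs ↦ by
    rw [pow_one, zetaEntire_eq hs]⟩
  ramanujan δ hδ := by
    refine IsBigO.of_bound 1 ?_
    filter_upwards [eventually_ge_atTop 1] with n hn
    rw [zetaCoeff_apply (by omega), norm_one, one_mul, Real.norm_of_nonneg (by positivity)]
    exact Real.one_le_rpow (by exact_mod_cast hn) hδ.le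
  functional_equation := ⟨1, _, _, _, _, hasFunctionalEquation_riemannZeta⟩
  euler_product := by
    refine ⟨zetaCoeff_apply one_ne_zero, logZetaCoeff, 0, by norm_num, fun n hn ↦ ?_, ?_,
      fun s hs ↦ ⟨summable_logZetaCoeff hs, exp_LSeries_logZetaCoeff hs⟩⟩
    · rw [logZetaCoeff, ArithmeticFunction.vonMangoldt_eq_zero_iff.2 hn, zero_div, ofReal_zero]
    · refine IsBigO.of_bound 1 (Eventually.of_forall fun n ↦ ?_)
      simpa using norm_logZetaCoeff_le n

/-! ### The index of ζ is at most one, so ζ is primitive -/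

lemma eventually_norm_riemannZeta_le :
    ∀ᶠ δ : ℝ in nhdsWithin 0 (Set.Ioi 0), ‖riemannZeta (1 + δ : ℝ)‖ ≤ 2 / δ := by
  have htend : Tendsto (fun δ : ℝ ↦ ((1 + δ : ℝ) : ℂ)) (nhdsWithin 0 (Set.Ioi 0))
      (nhdsWithin 1 {1}ᶜ) := by
    refine tendsto_nhdsWithin_iff.2 ⟨?_, ?_⟩
    · have : Tendsto (fun δ : ℝ ↦ ((1 + δ : ℝ) : ℂ)) (nhds 0) (nhds ((1 + 0 : ℝ) : ℂ)) :=
        (by fun_prop : Continuous fun δ : ℝ ↦ ((1 + δ : ℝ) : ℂ)).continuousAt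
      rw [add_zero, ofReal_one] at this
      exact this.mono_left nhdsWithin_le_nhds
    · filter_upwards [self_mem_nhdsWithin] with δ hδ h0
      have : 1 + δ = 1 := by exact_mod_cast (show ((1 + δ : ℝ) : ℂ) = 1 from h0)
      have hδ' : 0 < δ := hδ
      linarith
  have h := (riemannZeta_residue_one.comp htend).norm
  rw [norm_one] at h
  filter_upwards [h.eventually_lt_const one_lt_two, self_mem_nhdsWithin] with δ h1 hδ
  have hδ' : 0 < δ := hδ
  rw [le_div_iff₀ hδ', mul_comm]
  have e : (((1 + δ : ℝ) : ℂ) - 1) = (δ : ℂ) := by push_cast; ring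
  simp only [Function.comp_apply] at h1
  rw [e, norm_mul, Complex.norm_real, Real.norm_of_nonneg hδ'.le] at h1
  exact h1.le

/-- Rankin's trick for the sum of reciprocals of primes. -/
lemma norm_primeSum_inv_le {N : ℕ} {δ : ℝ} (hδ : 0 ≤ δ)
    (hsum : LSeriesSummable (primePart fun n ↦ zetaCoeff n) (1 + δ : ℝ)) :
    ‖primeSum (fun p ↦ 1 / (p : ℂ)) N‖ ≤
      (N : ℝ) ^ δ * (LSeries (primePart fun n ↦ zetaCoeff n) (1 + δ : ℝ)).re := by
  have hre : ∀ n, (LSeries.term (primePart fun n ↦ zetaCoeff n) (1 + δ : ℝ) n).re =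
      if n.Prime then ((n : ℝ) ^ (1 + δ))⁻¹ else 0 := by
    intro n
    rcases eq_or_ne n 0 with rfl | hn
    · simp [Nat.not_prime_zero]
    rw [LSeries.term_of_ne_zero hn, primePart]
    split_ifs with hp
    · rw [zetaCoeff_apply hn, one_div, ← Complex.ofReal_natCast n,
        ← Complex.ofReal_cpow (by positivity), ← Complex.ofReal_inv, Complex.ofReal_re]
    · simp
  have h1 := (Complex.hasSum_re hsum.LSeriesHasSum)
  simp only [hre] at h1
  have h2 := sum_le_hasSum (Finset.Iic N) (fun n _ ↦ by positivity) h1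
  refine le_trans ?_ (mul_le_mul_of_nonneg_left h2 (by positivity))
  rw [primeSum, Nat.floor_natCast, ← Finset.sum_filter, Finset.mul_sum]
  refine (norm_sum_le _ _).trans (Finset.sum_le_sum fun p hp ↦ ?_)
  obtain ⟨hpN, hp⟩ := Finset.mem_filter.1 hp
  have hp0 : (0 : ℝ) < p := by exact_mod_cast hp.pos
  have hpN' : (p : ℝ) ≤ N := by exact_mod_cast Finset.mem_Iic.1 hpN
  rw [norm_div, norm_one, Complex.norm_natCast, Real.rpow_add hp0, Real.rpow_one, mul_inv,
    mul_left_comm, one_div]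
  refine le_mul_of_one_le_right (by positivity) ?_
  rw [← div_eq_mul_inv, one_le_div (by positivity)]
  gcongr

/-- Rankin's trick with δ = 1 / (2 log N): then N^δ = e^(1/2) and |ζ(1 + δ)| ≤ 2/δ = 4 log N.
Asymptotics are not needed, only a leading constant e^(1/2) below 2. -/
lemma exists_norm_primeSum_inv_le : ∃ C, ∀ᶠ N : ℕ in atTop,
    ‖primeSum (fun p ↦ 1 / (p : ℂ)) N‖ ≤
      Real.exp (1 / 2) * (Real.log (Real.log N) + C) := by
  obtain ⟨C, hC⟩ := isSelberg_riemannZeta.exists_abs_log_norm_sub_le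
  have hlog : Tendsto (fun N : ℕ ↦ Real.log N) atTop atTop :=
    Real.tendsto_log_atTop.comp tendsto_natCast_atTop_atTop
  have hδ : Tendsto (fun N : ℕ ↦ (2 * Real.log N)⁻¹) atTop (nhdsWithin 0 (Set.Ioi 0)) :=
    tendsto_inv_atTop_nhdsGT_zero.comp (hlog.const_mul_atTop two_pos)
  refine ⟨Real.log 4 + C, ?_⟩
  filter_upwards [hδ.eventually eventually_norm_riemannZeta_le, hlog.eventually_gt_atTop 0,
    eventually_gt_atTop 0] with N hN hlogN hN0
  set δ := (2 * Real.log N)⁻¹ with hδdef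
  have hδ0 : 0 < δ := by positivity
  obtain ⟨h1, h2⟩ := hC (1 + δ) (by linarith)
  have hN0' : (0 : ℝ) < N := by exact_mod_cast hN0
  have hpow : (N : ℝ) ^ δ = Real.exp (1 / 2) := by
    rw [Real.rpow_def_of_pos hN0', hδdef]
    congr 1; field_simp
  refine (norm_primeSum_inv_le hδ0.le h1).trans ?_
  rw [hpow]
  gcongr
  have h3 : Real.log ‖riemannZeta (1 + δ : ℝ)‖ ≤ Real.log (Real.log N) + Real.log 4 := by
    have h0 : riemannZeta (1 + δ : ℝ) ≠ 0 :=
      riemannZeta_ne_zero_of_one_le_re (by rw [Complex.ofReal_re]; linarith)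
    rw [← Real.log_mul hlogN.ne' (by norm_num)]
    refine Real.log_le_log (norm_pos_iff.2 h0) (hN.trans_eq ?_)
    rw [hδdef]; field_simp; norm_num
  linarith [neg_le_of_abs_le h2]

/-- An index n ≥ 2 would make the prime sum at least 2 log log N - O(1), above Rankin's bound
e^(1/2) log log N + O(1). -/
lemma HasPairing.zetaCoeff_le_one {n : ℕ} (h : HasPairing zetaCoeff zetaCoeff n) : n ≤ 1 := by
  by_contra! hn
  obtain ⟨C, hC⟩ := exists_norm_primeSum_inv_le
  obtain ⟨K, hK⟩ := h.bound
  have hT : Tendsto (fun N : ℕ ↦ Real.log (Real.log N)) atTop atTop :=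
    tendsto_log_log.comp tendsto_natCast_atTop_atTop
  have he : Real.exp (1 / 2) < 2 := by
    rw [← Real.lt_log_iff_exp_lt two_pos]
    linarith [Real.log_two_gt_d9]
  have hT' := (hT.const_mul_atTop (sub_pos.2 he)).eventually_gt_atTop (Real.exp (1 / 2) * C + K)
  obtain ⟨N, h1, h2, h3, h4⟩ := (hC.and ((tendsto_natCast_atTop_atTop.eventually hK).and
    (hT'.and (hT.eventually_ge_atTop 0)))).exists
  have e : primeSum (fun p ↦ zetaCoeff p * conj (zetaCoeff p) / p) N =
      primeSum (fun p ↦ 1 / (p : ℂ)) N := primeSum_congr (fun p hp ↦ by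
    rw [zetaCoeff_apply hp.ne_zero, map_one, one_mul]) _
  rw [e, norm_one, mul_one] at h2
  have h5 : (n : ℝ) * Real.log (Real.log N) ≤ K + ‖primeSum (fun p ↦ 1 / (p : ℂ)) N‖ := by
    have := norm_le_norm_add_norm_sub (primeSum (fun p ↦ 1 / (p : ℂ)) N)
      (((n : ℝ) * Real.log (Real.log N) : ℝ) : ℂ)
    rw [Complex.norm_real, Real.norm_of_nonneg (by positivity), norm_sub_rev] at this
    rw [norm_sub_rev] at h2
    linarith [norm_sub_rev (primeSum (fun p ↦ 1 / (p : ℂ)) N)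
      (((n : ℝ) * Real.log (Real.log N) : ℝ) : ℂ)]
  have h6 : 2 * Real.log (Real.log N) ≤ n * Real.log (Real.log N) := by
    gcongr; exact_mod_cast hn
  linarith

lemma isPrimitiveSelberg_zetaCoeff (horth : SelbergOrthonormalityConjecture) :
    IsPrimitiveSelberg zetaCoeff := by
  refine isPrimitiveSelberg_of_hasSelbergIndex horth ⟨_, isSelberg_riemannZeta⟩ (fun h ↦ ?_)
    fun n hn ↦ hn.zetaCoeff_le_one
  have h2 := congrArg (fun f : ArithmeticFunction ℂ ↦ f 2) h
  simp [zetaCoeff_apply] at h2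

lemma meromorphicOrderAt_riemannZeta_one_nonpos : meromorphicOrderAt riemannZeta 1 ≤ 0 := by
  by_contra! h
  have h1 := (tendsto_zero_iff_meromorphicOrderAt_pos (isSelberg_riemannZeta.meromorphicAt 1)).2 h
  have h2 : Tendsto (fun s : ℂ ↦ s - 1) (nhdsWithin 1 {1}ᶜ) (nhds (1 - 1)) :=
    (by fun_prop : Continuous fun s : ℂ ↦ s - 1).continuousAt.mono_left nhdsWithin_le_nhds
  have h3 := h2.mul h1
  rw [mul_zero] at h3
  exact zero_ne_one (tendsto_nhds_unique h3 riemannZeta_residue_one)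

/-! ### Primitive functions at s = 1 -/

/-- A function in the class other than `ζ` that is orthogonal to `ζ` is regular and nonzero
at `1`. -/
lemma IsSelberg.meromorphicOrderAt_one_eq_zero_of_primitive
    (horth : SelbergOrthonormalityConjecture) {a : ArithmeticFunction ℂ} {F : ℂ → ℂ}
    (hF : IsSelberg a F) (ha : IsPrimitiveSelberg a) (hne : a ≠ zetaCoeff) :
    meromorphicOrderAt F 1 = 0 := by
  refine hF.meromorphicOrderAt_one_eq_zero ?_
  refine (horth.2 a zetaCoeff ha (isPrimitiveSelberg_zetaCoeff horth) hne).congr_left fun x ↦ ?_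
  exact primeSum_congr (fun p hp ↦ by rw [zetaCoeff_apply hp.ne_zero, map_one, mul_one]) x

lemma IsSelberg.congr_of_ne_one {a : ArithmeticFunction ℂ} {F G : ℂ → ℂ} (hF : IsSelberg a F)
    (hG : IsSelberg a G) {s : ℂ} (hs : s ≠ 1) : F s = G s :=
  eq_of_eq_on_one_lt_re (fun _ h ↦ hF.differentiableAt h) (fun _ h ↦ hG.differentiableAt h)
    (fun _ h ↦ (hF.eq_LSeries h).trans (hG.eq_LSeries h).symm) hs

lemma eventually_nhdsNE_ne_one (s : ℂ) : ∀ᶠ z in nhdsWithin s {s}ᶜ, z ≠ 1 := by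
  rcases eq_or_ne s 1 with rfl | hs
  · exact self_mem_nhdsWithin
  · exact nhdsWithin_le_nhds (isOpen_compl_singleton.mem_nhds hs)

lemma meromorphicOrderAt_riemannZeta_nonpos {s : ℂ} (hs : s.re = 1) : meromorphicOrderAt riemannZeta s ≤ 0 := by
  rcases eq_or_ne s 1 with rfl | h1
  · exact meromorphicOrderAt_riemannZeta_one_nonpos
  by_contra! h
  have h2 := (tendsto_zero_iff_meromorphicOrderAt_pos (isSelberg_riemannZeta.meromorphicAt s)).2 h
  have h3 := (differentiableAt_riemannZeta h1).continuousAt.tendsto.mono_left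
    (nhdsWithin_le_nhds (s := {s}ᶜ))
  exact riemannZeta_ne_zero_of_one_le_re hs.ge (tendsto_nhds_unique h3 h2)

/-- The order depends only on a punctured neighbourhood, so the arbitrary value at 1 is harmless. -/
lemma meromorphicOrderAt_congr_of_ne_one {F G : ℂ → ℂ} (h : ∀ s ≠ 1, F s = G s) (s : ℂ) :
    meromorphicOrderAt F s = meromorphicOrderAt G s := by
  refine meromorphicOrderAt_congr ?_
  filter_upwards [eventually_nhdsNE_ne_one s] with z hz using h z hz

lemma IsSelberg.meromorphicOrderAt_nonpos_of_zetaCoeff {F : ℂ → ℂ} (hF : IsSelberg zetaCoeff F)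
    {s : ℂ} (hs : s.re = 1) : meromorphicOrderAt F s ≤ 0 :=
  (meromorphicOrderAt_congr_of_ne_one (fun _ h ↦ hF.congr_of_ne_one isSelberg_riemannZeta h) s).trans_le
    (meromorphicOrderAt_riemannZeta_nonpos hs)

lemma IsSelberg.meromorphicOrderAt_one_nonpos_of_primitive
    (horth : SelbergOrthonormalityConjecture) {a : ArithmeticFunction ℂ} {F : ℂ → ℂ}
    (hF : IsSelberg a F) (ha : IsPrimitiveSelberg a) : meromorphicOrderAt F 1 ≤ 0 := by
  by_cases h : a = zetaCoeff
  · subst h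
    exact hF.meromorphicOrderAt_nonpos_of_zetaCoeff one_re
  · exact (hF.meromorphicOrderAt_one_eq_zero_of_primitive horth ha h).le

/-! ### Vertical shifts and non-vanishing on Re s = 1 -/

lemma IsEntireOfFiniteOrder.exists_norm_le_exp_one_add_pow {E : ℂ → ℂ}
    (hE : IsEntireOfFiniteOrder E) :
    ∃ C > 0, ∃ n : ℕ, ∀ s, ‖E s‖ ≤ C * Real.exp ((1 + ‖s‖) ^ n) := by
  obtain ⟨C, hC, n, h⟩ := hE.exists_norm_le_exp_pow
  obtain ⟨M, hM⟩ := (isCompact_closedBall (0 : ℂ) 1).exists_bound_of_continuousOn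
    hE.1.continuous.continuousOn
  refine ⟨C + |M|, by positivity, n, fun s ↦ ?_⟩
  rcases le_total 1 ‖s‖ with hs | hs
  · refine (h s hs).trans ?_
    gcongr
    · linarith [abs_nonneg M]
    · linarith
  · refine (hM s (by simpa using hs)).trans ((le_abs_self M).trans ?_)
    have h1 : 1 ≤ Real.exp ((1 + ‖s‖) ^ n) := Real.one_le_exp (by positivity)
    nlinarith [abs_nonneg M]

lemma IsEntireOfFiniteOrder.comp_add_const {E : ℂ → ℂ} (hE : IsEntireOfFiniteOrder E) (c : ℂ) :
    IsEntireOfFiniteOrder fun s ↦ E (s + c) := by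
  obtain ⟨C, hC, n, h⟩ := hE.exists_norm_le_exp_one_add_pow
  refine isEntireOfFiniteOrder_of_norm_le (C := C) (K := (1 + ‖c‖) ^ n) (n := n)
    (hE.1.comp (by fun_prop)) (by positivity) fun s ↦ (h _).trans ?_
  rw [← mul_pow]
  gcongr
  nlinarith [norm_add_le s c, norm_nonneg s, norm_nonneg c]

namespace IsSelberg

variable {a : ArithmeticFunction ℂ} {F : ℂ → ℂ}

/-- If `F` has no pole at `1`, it extends to an entire function of finite order. -/
lemma exists_entire (hF : IsSelberg a F) (h : 0 ≤ meromorphicOrderAt F 1) :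
    ∃ E, IsEntireOfFiniteOrder E ∧ ∀ s ≠ 1, F s = E s := by
  obtain ⟨c, hc⟩ := tendsto_nhds_of_meromorphicOrderAt_nonneg (hF.meromorphicAt 1) h
  obtain ⟨m, E₀, hE₀, hrel⟩ := hF.analyticity
  have heq : ∀ s ≠ 1, F s = Function.update F 1 c s := fun s hs ↦
    (Function.update_of_ne hs _ _).symm
  have hdiff : Differentiable ℂ (Function.update F 1 c) := by
    rw [← differentiableOn_univ, ← Complex.differentiableOn_compl_singleton_and_continuousAt_iff
      (c := 1) univ_mem]
    refine ⟨fun s hs ↦ ?_, continuousAt_update_same.2 hc⟩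
    have hs1 : s ≠ 1 := hs.2
    refine ((hF.differentiableAt hs1).congr_of_eventuallyEq ?_).differentiableWithinAt
    filter_upwards [isOpen_compl_singleton.mem_nhds hs1] with z hz
    exact (heq z hz).symm
  refine ⟨_, ?_, heq⟩
  obtain ⟨C, hC, n, hb⟩ := hE₀.exists_norm_le_exp_one_add_pow
  obtain ⟨M, hM⟩ := (isCompact_closedBall (0 : ℂ) 2).exists_bound_of_continuousOn
    hdiff.continuous.continuousOn
  -- For |s| ≥ 2 one has |s - 1| ≥ 1, so dividing by (s - 1)^m does not increase the modulus; the
  -- disc |s| ≤ 2 is compact.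
  refine isEntireOfFiniteOrder_of_norm_le hdiff (C := C + |M|) (K := 1) zero_le_one (n := n)
    fun s ↦ ?_
  rw [one_mul]
  rcases le_total 2 ‖s‖ with hs | hs
  · have hs1 : s ≠ 1 := fun h0 ↦ by rw [h0, norm_one] at hs; linarith
    have h1 : 1 ≤ ‖s - 1‖ := by
      have := norm_sub_norm_le s 1; rw [norm_one] at this; linarith
    have h2 : ‖F s‖ ≤ ‖E₀ s‖ := by
      rw [← hrel s hs1, norm_mul, norm_pow]
      exact le_mul_of_one_le_left (norm_nonneg _) (one_le_pow₀ h1)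
    rw [← heq s hs1]
    refine h2.trans ((hb s).trans ?_)
    gcongr
    linarith [abs_nonneg M]
  · refine (hM s (by simpa using hs)).trans ((le_abs_self M).trans ?_)
    have h1 : 1 ≤ Real.exp ((1 + ‖s‖) ^ n) := Real.one_le_exp (by positivity)
    nlinarith [abs_nonneg M]

end IsSelberg

/-- 1/Γ is continuous and vanishes exactly at the poles of Γ, also with the convention that Γ takes
the value 0 there. -/
lemma eventually_isGammaRegular {k : ℕ} {w : Fin k → ℝ} {μ : Fin k → ℂ} {s : ℂ}
    (h : IsGammaRegular w μ s) : ∀ᶠ z in nhds s, IsGammaRegular w μ z := by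
  refine eventually_all.2 fun i ↦ ?_
  have h1 : Continuous fun z : ℂ ↦ (Complex.Gamma (w i * z + μ i))⁻¹ :=
    Complex.differentiable_one_div_Gamma.continuous.comp (by fun_prop)
  have h2 : (Complex.Gamma (w i * s + μ i))⁻¹ ≠ 0 := inv_ne_zero (Complex.Gamma_ne_zero (h i))
  filter_upwards [h1.continuousAt.eventually_ne h2] with z hz n hn
  exact hz (inv_eq_zero.2 ((Complex.Gamma_eq_zero_iff _).2 ⟨n, hn⟩))

lemma continuousAt_gammaFactor {k : ℕ} {ε : ℂ} {Q : ℝ} (hQ : 0 < Q) {w : Fin k → ℝ}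
    {μ : Fin k → ℂ} {s : ℂ} (h : IsGammaRegular w μ s) :
    ContinuousAt (gammaFactor ε Q w μ) s := by
  have hQ' : (Q : ℂ) ≠ 0 := by exact_mod_cast hQ.ne'
  have h1 : ContinuousAt (fun s : ℂ ↦ (Q : ℂ) ^ s) s := continuousAt_const_cpow hQ'
  have h2 : ∀ i, ContinuousAt (fun s : ℂ ↦ Complex.Gamma (w i * s + μ i)) s := fun i ↦
    (Complex.differentiableAt_Gamma _ (h i)).continuousAt.comp
      (f := fun s : ℂ ↦ (w i : ℂ) * s + μ i) (by fun_prop)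
  exact (continuousAt_const.mul h1).mul (tendsto_finsetProd _ fun i _ ↦ h2 i)

/-- For continuous `F` the points `0` and `1` are not exceptional in the functional equation. -/
lemma HasFunctionalEquation.eq_of_continuous {k : ℕ} {ε : ℂ} {Q : ℝ} {w : Fin k → ℝ}
    {μ : Fin k → ℂ} {F : ℂ → ℂ} (h : HasFunctionalEquation ε Q w μ F) (hF : Continuous F) {s : ℂ}
    (hs : IsGammaRegular w μ s) (hs' : IsGammaRegular w μ (1 - conj s)) :
    gammaFactor ε Q w μ s * F s = conj (gammaFactor ε Q w μ (1 - conj s) * F (1 - conj s)) := by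
  obtain ⟨-, hQ, -, -, h⟩ := h
  have hc : Continuous fun z : ℂ ↦ 1 - conj z := continuous_const.sub continuous_conj
  have h1 : ContinuousAt (fun z ↦ gammaFactor ε Q w μ z * F z) s :=
    (continuousAt_gammaFactor hQ hs).mul hF.continuousAt
  have h2 : ContinuousAt (fun z ↦ conj (gammaFactor ε Q w μ (1 - conj z) * F (1 - conj z))) s :=
    continuous_conj.continuousAt.comp (((continuousAt_gammaFactor hQ hs').comp
      (f := fun z : ℂ ↦ 1 - conj z) hc.continuousAt).mul (hF.comp hc).continuousAt)
  refine tendsto_nhds_unique_of_eventuallyEq (h1.tendsto.mono_left nhdsWithin_le_nhds)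
    (h2.tendsto.mono_left (nhdsWithin_le_nhds (s := {s}ᶜ))) ?_
  have hne : ∀ c : ℂ, ∀ᶠ z in nhdsWithin s {s}ᶜ, z ≠ c := fun c ↦ by
    rcases eq_or_ne s c with rfl | hs
    · exact self_mem_nhdsWithin
    · exact nhdsWithin_le_nhds (isOpen_compl_singleton.mem_nhds hs)
  filter_upwards [hne 0, hne 1, nhdsWithin_le_nhds (eventually_isGammaRegular hs),
    nhdsWithin_le_nhds (hc.continuousAt.eventually (eventually_isGammaRegular hs'))]
    with z h0 h1 h2 h3 using h z h0 h1 h2 h3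

/-- The twist of the coefficients by `n ^ (-i t)`. -/
noncomputable def imTwist (a : ArithmeticFunction ℂ) (t : ℝ) : ArithmeticFunction ℂ :=
  ⟨fun n ↦ a n * (n : ℂ) ^ (-(t * I)), by simp⟩

lemma imTwist_apply (a : ArithmeticFunction ℂ) (t : ℝ) (n : ℕ) :
    imTwist a t n = a n * (n : ℂ) ^ (-(t * I)) := rfl

lemma norm_natCast_cpow_neg_mul_I {n : ℕ} (hn : n ≠ 0) (t : ℝ) :
    ‖(n : ℂ) ^ (-(t * I))‖ = 1 := by
  rw [Complex.norm_natCast_cpow_of_pos (Nat.pos_of_ne_zero hn)]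
  simp

lemma LSeries.term_imTwist (f : ℕ → ℂ) (t : ℝ) (s : ℂ) :
    LSeries.term (fun n ↦ f n * (n : ℂ) ^ (-(t * I))) s = LSeries.term f (s + t * I) := by
  ext n
  rcases eq_or_ne n 0 with rfl | hn
  · simp
  have hn' : (n : ℂ) ≠ 0 := by exact_mod_cast hn
  rw [LSeries.term_of_ne_zero hn, LSeries.term_of_ne_zero hn, Complex.cpow_add _ _ hn',
    Complex.cpow_neg]
  rw [div_mul_eq_div_div_swap, div_eq_mul_inv (f n)]

lemma gammaFactor_add_mul_I {k : ℕ} {ε : ℂ} {Q : ℝ} (hQ : 0 < Q) {w : Fin k → ℝ}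
    {μ : Fin k → ℂ} (t : ℝ) (s : ℂ) :
    gammaFactor (ε * (Q : ℂ) ^ (t * I)) Q w (fun i ↦ μ i + w i * (t * I)) s =
      gammaFactor ε Q w μ (s + t * I) := by
  have hQ' : (Q : ℂ) ≠ 0 := by exact_mod_cast hQ.ne'
  rw [gammaFactor, gammaFactor, Complex.cpow_add _ _ hQ']
  congr 1
  · ring
  · refine Finset.prod_congr rfl fun i _ ↦ ?_
    congr 1; ring

lemma isGammaRegular_add_mul_I {k : ℕ} {w : Fin k → ℝ} {μ : Fin k → ℂ} {t : ℝ} {s : ℂ}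
    (h : IsGammaRegular w (fun i ↦ μ i + w i * (t * I)) s) : IsGammaRegular w μ (s + t * I) :=
  fun i n hn ↦ h i n (by rw [← hn]; ring)

/-- The class is stable under vertical shifts of its entire members. -/
lemma IsSelberg.imTwist {a : ArithmeticFunction ℂ} {E : ℂ → ℂ} (hF : IsSelberg a E)
    (hE : IsEntireOfFiniteOrder E) (t : ℝ) :
    IsSelberg (imTwist a t) (fun s ↦ E (s + t * I)) where
  dirichlet_series s hs := by
    have h := hF.dirichlet_series (s + t * I) (by simpa using hs)
    rw [LSeriesHasSum, ← LSeries.term_imTwist] at h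
    exact h
  analyticity := ⟨0, _, hE.comp_add_const _, fun s _ ↦ by rw [pow_zero, one_mul]⟩
  ramanujan δ hδ := by
    refine IsBigO.trans (IsBigO.of_bound 1 ?_) (hF.ramanujan δ hδ)
    filter_upwards [eventually_ne_atTop 0] with n hn
    rw [imTwist_apply, norm_mul, norm_natCast_cpow_neg_mul_I hn, mul_one, one_mul]
  functional_equation := by
    obtain ⟨k, ε, Q, w, μ, hfe⟩ := hF.functional_equation
    have hfe' : HasFunctionalEquation ε Q w μ E := hfe
    obtain ⟨hε, hQ, hw, hμ, -⟩ := hfe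
    -- The shift by it is absorbed into a unimodular factor Q^(it) and purely imaginary changes of
    -- the μ_i, so all constraints on the data persist.
    refine ⟨k, ε * (Q : ℂ) ^ (t * I), Q, w, fun i ↦ μ i + w i * (t * I), ?_, hQ, hw,
      fun i ↦ by simpa using hμ i, fun s _ _ hs hs' ↦ ?_⟩
    · rw [norm_mul, hε, Complex.norm_cpow_eq_rpow_re_of_pos hQ]
      simp
    · have e : 1 - conj s + t * I = 1 - conj (s + t * I) := by
        rw [map_add, map_mul, conj_ofReal, conj_I]; ring
      have h1 := isGammaRegular_add_mul_I hs
      have h2 := isGammaRegular_add_mul_I hs'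
      rw [gammaFactor_add_mul_I hQ, gammaFactor_add_mul_I hQ]
      rw [e] at h2 ⊢
      -- The shifted point s + it may be 0 or 1 although s is not, so the equation is needed there
      -- too; continuity of E supplies it.
      exact hfe'.eq_of_continuous hE.1.continuous h1 h2
  euler_product := by
    obtain ⟨h1, b, θ, hθ, hpp, hbO, hb⟩ := hF.euler_product
    refine ⟨by rw [imTwist_apply, h1]; simp, fun n ↦ b n * (n : ℂ) ^ (-(t * I)), θ, hθ,
      fun n hn ↦ by simp only [hpp n hn, zero_mul], ?_, fun s hs ↦ ?_⟩
    · refine IsBigO.trans (IsBigO.of_bound 1 ?_) hbO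
      filter_upwards [eventually_ne_atTop 0] with n hn
      rw [norm_mul, norm_natCast_cpow_neg_mul_I hn, mul_one, one_mul]
    · have h2 := hb (s + t * I) (by simpa using hs)
      rw [LSeriesSummable, LSeries, ← LSeries.term_imTwist] at h2
      exact h2

/-- Twisting keeps every |a_n|, hence the index 1 and nontriviality, and the index criterion applies
again. -/
lemma IsPrimitiveSelberg.imTwist (horth : SelbergOrthonormalityConjecture)
    {a : ArithmeticFunction ℂ} (ha : IsPrimitiveSelberg a) {t : ℝ}
    (h : imTwist a t ∈ SelbergClass) : IsPrimitiveSelberg (imTwist a t) := by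
  refine isPrimitiveSelberg_of_hasSelbergIndex horth h (fun h1 ↦ ha.2.1 ?_) fun n hn ↦ ?_
  · ext n
    rcases eq_or_ne n 0 with rfl | hn
    · simp
    rcases eq_or_ne n 1 with rfl | hn1
    · rw [apply_one_of_mem ha.1, ArithmeticFunction.one_one]
    have h2 := congrArg (fun f : ArithmeticFunction ℂ ↦ ‖f n‖) h1
    simp only [imTwist_apply, norm_mul, norm_natCast_cpow_neg_mul_I hn, mul_one,
      ArithmeticFunction.one_apply_ne hn1, norm_zero, norm_eq_zero] at h2
    rw [h2, ArithmeticFunction.one_apply_ne hn1]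
  · have h1 : HasPairing a a 1 := hasSelbergIndex_iff.1 (by exact_mod_cast horth.1 a ha)
    refine (HasPairing.unique (f := a) (g := a) (hn.congr_left fun x ↦ ?_) h1).le
    congr 1
    refine primeSum_congr (fun p hp ↦ ?_) x
    rw [Complex.mul_conj, Complex.mul_conj, Complex.normSq_eq_norm_sq, Complex.normSq_eq_norm_sq,
      imTwist_apply, norm_mul, norm_natCast_cpow_neg_mul_I hp.ne_zero, mul_one]

lemma IsSelberg.congr {a : ArithmeticFunction ℂ} {F G : ℂ → ℂ} (hF : IsSelberg a F)
    (h : ∀ s ≠ 1, F s = G s) : IsSelberg a G where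
  dirichlet_series s hs := h s (fun h0 ↦ by simp [h0] at hs) ▸ hF.dirichlet_series s hs
  analyticity := by
    obtain ⟨m, E, hE, hrel⟩ := hF.analyticity
    exact ⟨m, E, hE, fun s hs ↦ h s hs ▸ hrel s hs⟩
  ramanujan := hF.ramanujan
  functional_equation := by
    obtain ⟨k, ε, Q, w, μ, hε, hQ, hw, hμ, hfe⟩ := hF.functional_equation
    refine ⟨k, ε, Q, w, μ, hε, hQ, hw, hμ, fun s h0 h1 hs hs' ↦ ?_⟩
    have h2 : 1 - conj s ≠ 1 := fun h2 ↦ h0 (by simpa using h2)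
    rw [← h s h1, ← h _ h2]
    exact hfe s h0 h1 hs hs'
  euler_product := by
    obtain ⟨h1, b, θ, hθ, hpp, hbO, hb⟩ := hF.euler_product
    exact ⟨h1, b, θ, hθ, hpp, hbO, fun s hs ↦
      ⟨(hb s hs).1, (hb s hs).2.trans (h s (fun h0 ↦ by simp [h0] at hs))⟩⟩

/-- A primitive function has no zero on `Re s = 1`. -/
lemma IsSelberg.meromorphicOrderAt_nonpos_of_primitive
    (horth : SelbergOrthonormalityConjecture) {a : ArithmeticFunction ℂ} {F : ℂ → ℂ}
    (hF : IsSelberg a F) (ha : IsPrimitiveSelberg a) {s : ℂ} (hs : s.re = 1) :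
    meromorphicOrderAt F s ≤ 0 := by
  by_cases hz : a = zetaCoeff
  · subst hz
    exact hF.meromorphicOrderAt_nonpos_of_zetaCoeff hs
  obtain ⟨E, hE, heq⟩ := hF.exists_entire
    (hF.meromorphicOrderAt_one_eq_zero_of_primitive horth ha hz).ge
  rw [meromorphicOrderAt_congr_of_ne_one heq]
  have hFE : IsSelberg a E := hF.congr heq
  have hG := hFE.imTwist hE s.im
  -- The shift E(z + i Im s) is primitive, so it has no zero at z = 1; a zero of E at s would be
  -- one.
  have hG1 := hG.meromorphicOrderAt_one_nonpos_of_primitive horth (ha.imTwist horth ⟨_, hG⟩)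
  contrapose! hG1
  have h1 := (tendsto_zero_iff_meromorphicOrderAt_pos (hE.1.analyticAt s).meromorphicAt).2 hG1
  have h2 : E s = 0 := tendsto_nhds_unique
    (hE.1.continuous.continuousAt.tendsto.mono_left nhdsWithin_le_nhds) h1
  rw [← tendsto_zero_iff_meromorphicOrderAt_pos (hG.meromorphicAt 1)]
  have h3 : (1 : ℂ) + s.im * I = s := by apply Complex.ext <;> simp [hs]
  have h4 : ContinuousAt (fun z : ℂ ↦ E (z + s.im * I)) 1 :=
    (hE.1.continuous.comp (by fun_prop)).continuousAt
  have h5 := h4.tendsto.mono_left (nhdsWithin_le_nhds (s := {1}ᶜ))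
  rwa [h3, h2] at h5

lemma meromorphicOrderAt_list_prod_nonpos {s : ℂ} (L : List (ArithmeticFunction ℂ))
    (hL : ∀ f ∈ L, f ∈ SelbergClass ∧ meromorphicOrderAt (selbergFunction f) s ≤ 0) :
    MeromorphicAt (fun z ↦ (L.map fun f ↦ selbergFunction f z).prod) s ∧
      meromorphicOrderAt (fun z ↦ (L.map fun f ↦ selbergFunction f z).prod) s ≤ 0 := by
  induction L with
  | nil =>
    simp only [List.map_nil, List.prod_nil]
    exact ⟨MeromorphicAt.const 1 s, by rw [meromorphicOrderAt_const]; simp⟩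
  | cons f L ih =>
    simp only [List.map_cons, List.prod_cons]
    obtain ⟨h1, h2⟩ := ih fun g hg ↦ hL g (by simp [hg])
    obtain ⟨h3, h4⟩ := hL f (by simp)
    have h5 := (isSelberg_selbergFunction h3).meromorphicAt s
    refine ⟨h5.mul h1, ?_⟩
    have := meromorphicOrderAt_mul h5 h1
    refine this.trans_le ?_
    exact add_nonpos h4 h2

theorem proposition4p6
    (hreg : SelbergRegularityConjecture)
    (horth : SelbergOrthonormalityConjecture)
    (a : ArithmeticFunction ℂ) (F : ℂ → ℂ) (hF : IsSelberg a F)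
    (s : ℂ) (hs : s.re = 1) :
    ¬ HasZeroAt F s := by
  -- Orders add under products, so it suffices that each primitive factor has order at most 0 at s.
  obtain ⟨L, hL, rfl⟩ := exists_list_primitive ⟨F, hF⟩
  rw [HasZeroAt, not_lt, meromorphicOrderAt_congr_of_ne_one
    (fun z hz ↦ hF.eq_list_prod (fun f hf ↦ (hL f hf).1) hz)]
  exact (meromorphicOrderAt_list_prod_nonpos L fun f hf ↦ ⟨(hL f hf).1,
    (isSelberg_selbergFunction (hL f hf).1).meromorphicOrderAt_nonpos_of_primitive horth
      (hL f hf) hs⟩).2
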